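/- **Setting.** Let $n\ge 2$, $c>0$, $\alpha\in(0,1]$. Let $V^l,V^s\in C^2(\mathbb R^n,\mathbb R)$ and let $B^l,B^s\in C^1(\mathbb R^n,A_n(\mathbb R))$, where $A_n(\mathbb R)$ is the space of antisymmetric $n\times n$ matrices, and suppose that $B=B^l+B^s$ satisfies $\partial_iB_{k,m}+\partial_mB_{i,k}+\partial_kB_{m,i}=0$ for all $i,k,m$. Let $\beta^l_0,\beta^l_1,\beta^l_2,\beta^s_1,\beta^s_2,\beta^s_3>0$ be such that for all $x\in\mathbb R^n$, all $i,k$ and all multi-indices with $|j_1|\le 2$, $|j_2|\le 1$, $$|\partial^{j_1}V^l(x)|\le\beta^l_{|j_1|}(1+|x|)^{-(\alpha+|j_1|)},\qquad |\partial^{j_2}B^l_{i,k}(x)|\le\beta^l_{|j_2|+1}(1+|x|)^{-(\alpha+|j_2|+1)},$$ $$|\partial^{j_1}V^s(x)|\le\beta^s_{|j_1|+1}(1+|x|)^{-(\alpha+1+|j_1|)},\qquad |\partial^{j_2}B^s_{i,k}(x)|\le\beta^s_{|j_2|+2}(1+|x|)^{-(\alpha+|j_2|+2)}.$$ Put $F^l(x,v)=-\nabla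 V^l(x)+\frac1cB^l(x)v$, $F^s(x,v)=-\nabla V^s(x)+\frac1cB^s(x)v$, $F=F^l+F^s$, $\beta=\max(\beta_1^l,\beta_2^l,\beta_2^s,\beta_3^s)$, $g(p)=p/\sqrt{1+|p|^2/c^2}$ and $g^{-1}(v)=v/\sqrt{1-|v|^2/c^2}$ for $|v|<c$. A *solution for a force* $G$ is a curve $x\in C^2(\mathbb R,\mathbb R^n)$ with $|\dot x|<c$ and $\frac{d}{dt}g^{-1}(\dot x(t))=G(x(t),\dot x(t))$ for all $t\in\mathbb R$. **Scattering data.** Let $\mu(\sigma)=\Big(\frac{2\sigma}{\sigma/c^2+\sqrt{\sigma^2/c^4+4}}\Big)^{1/2}$ and $\mu^l=\mu\big(2^8\alpha^{-1}n^2\max(\beta_1^l,\beta_2^l)\big)$. For $\mu^l\le|v|<c$, $z_\pm(v,\cdot)$ is the unique solution for $F^l$ with $z_\pm(v,0)=0$, $\dot z_\pm(v,t)\to v$ as $t\to\pm\infty$ and $|z_\pm(v,t)-tv|\le\frac{2^{9/2}n^{3/2}\beta_1^l\sqrt{1-|v|^2/c^2}}{\alpha|v|}|t|$ for all $t\in\mathbb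 R$. For $\mu^l\le|v_-|<c$ and $x_-\in\mathbb R^n$ let $x(\cdot)$ be the unique solution for $F$ with $x(t)=z_-(v_-,t)+x_-+y_-(t)$, $|\dot y_-(t)|+|y_-(t)|\to0$ as $t\to-\infty$. If there is a unique pair $(v_+,x_+)$ with $\mu^l\le|v_+|<c$ such that $x(t)=z_+(v_+,t)+x_++y_+(t)$, $|\dot y_+(t)|+|y_+(t)|\to0$ as $t\to+\infty$, then $(v_-,x_-)$ belongs to the domain $\mathcal D(S)$ of the scattering map and $a(v_-,x_-)=v_+$, $b(v_-,x_-)=x_+$, $a_{sc}=a-v_-$, $b_{sc}=b-x_-$. For $(v,x)\in\mathcal D(S)$ and $a=a(v,x)$ put $$\begin{aligned}W(v,x)=&\int_{-\infty}^0\Big[g\Big(g^{-1}(v)+\int_{-\infty}^\sigma F^l(z_-(v,\tau)+x,\dot z_-(v,\tau))d\tau\Big)-g\Big(g^{-1}(v)+\int_{-\infty}^\sigma F^l(z_-(v,\tau),\dot z_-(v,\tau))d\tau\Big)\Big]d\sigma\\&+\int_0^{+\infty}\Big[g\Big(g^{-1}(a)-\int_\sigma^{+\infty}F^l(z_+(a,\tau)+x,\dot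 z_+(a,\tau))d\tau\Big)-g\Big(g^{-1}(a)-\int_\sigma^{+\infty}F^l(z_+(a,\tau),\dot z_+(a,\tau))d\tau\Big)\Big]d\sigma.\end{aligned}$$ Finally, for $\sigma\ge0$ and $r\in(0,\min(1,2^{-3/2}c))$ let $\rho_0(\sigma,r,\beta,\alpha)$ be the unique root in $(2^{3/2}r,c)$ of $$1=\frac{32n^2\sqrt{1-\rho_0^2/c^2}\;\beta\,(1+\sigma+\frac1c)\big(1+\frac1{\rho_0/2^{3/2}-r}\big)}{\alpha\,(\rho_0/2^{3/2}-r)\,r\,(1-r)^{\alpha+2}}.$$ **Theorem.** Let $\theta,x\in\mathbb R^n$ with $|\theta|=1$ and $\theta\cdot x=0$. Then $(\rho\theta,x)\in\mathcal D(S)$ for all $\rho<c$ close enough to $c$, all the integrals below and in $W(\rho\theta,x)$ converge absolutely, and $$\lim_{\rho\to c,\,\rho<c}\frac{\rho}{\sqrt{1-\rho^2/c^2}}\,a_{sc}(\rho\theta,x)=\int_{-\infty}^{+\infty}F(\tau\theta+x,c\theta)\,d\tau,$$ $$\begin{aligned}\lim_{\rho\to c,\,\rho<c}\frac{\rho^2}{\sqrt{1-\rho^2/c^2}}\,\big(b_{sc}(\rho\theta,x)-W(\rho\theta,x)\big)=&\int_{-\infty}^0\int_{-\infty}^\sigma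 F^s(\tau\theta+x,c\theta)\,d\tau d\sigma-\int_0^{+\infty}\int_\sigma^{+\infty}F^s(\tau\theta+x,c\theta)\,d\tau d\sigma\\&+\Big(\int_{-\infty}^{+\infty}V^s(t\theta+x)\,dt\Big)\theta.\end{aligned}$$ In addition, for every $r\in(0,\min(1,2^{-3/2}c))$ and every $\rho\in(\rho_0(|x|,r,\beta,\alpha),c)$ one has $(\rho\theta,x)\in\mathcal D(S)$, $$\Big|\frac{\rho}{\sqrt{1-\rho^2/c^2}}a_{sc}(\rho\theta,x)-\int_{-\infty}^{+\infty}F(\tau\theta+x,\rho\theta)d\tau\Big|\le\beta^2\sqrt{1-\tfrac{\rho^2}{c^2}}\;\frac{640\,n^4\rho\,\big(\frac rc+|x|+1\big)\big(\frac1c+1\big)\big(1+\frac1{\frac{\rho}{2\sqrt2}-r}\big)^2}{\alpha^2\big(\frac\rho{2\sqrt2}-r\big)^2(1-r)^{2\alpha+3}},$$ $$\begin{aligned}&\Big|\frac{\rho^2}{\sqrt{1-\rho^2/c^2}}\big(b_{sc}(\rho\theta,x)-W(\rho\theta,x)\big)-\int_{-\infty}^0\int_{-\infty}^\sigma F^s(\tau\theta+x,\rho\theta)d\tau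 d\sigma+\int_0^{+\infty}\int_\sigma^{+\infty}F^s(\tau\theta+x,\rho\theta)d\tau d\sigma\\&\qquad-\int_{-\infty}^{+\infty}V^s(\sigma\theta+x)d\sigma\,\frac{\rho^2\theta}{c^2}\Big|\le\beta^2\sqrt{1-\tfrac{\rho^2}{c^2}}\;\frac{464\,n^4\rho^2\big(\frac rc+|x|+1\big)\big(\frac1c+1\big)\big(1+\frac1{\frac\rho{2\sqrt2}-r}\big)^2}{\alpha^2(\alpha+1)\big(\frac\rho{2\sqrt2}-r\big)^3(1-r)^{2\alpha+2}}.\end{aligned}$$ -/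

import Mathlib

open Filter Topology MeasureTheory Set

noncomputable section

namespace RelScattering

/-- The configuration space `ℝⁿ` with its Euclidean norm. -/
abbrev Sp (n : ℕ) : Type := EuclideanSpace ℝ (Fin n)

/-- Iterated partial derivative along a list of coordinate directions. The order of the derivative
is the length of the list; on the functions used below (of class `C^k`, `k` at least the length)
these are exactly the multi-index derivatives `∂^j`, `|j|` being the length. -/
def pderivs {n : ℕ} : List (Fin n) → (Sp n → ℝ) → Sp n → ℝ
  | [], f => f
  | i :: j, f => fun x => fderiv ℝ (pderivs j f) x (EuclideanSpace.single i 1)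

/-- A static electromagnetic field: a potential `V ∈ C²(ℝⁿ, ℝ)` and a magnetic field
`B ∈ C¹(ℝⁿ, Aₙ(ℝ))` with values in the antisymmetric matrices. -/
structure EMField (n : ℕ) where
  V : Sp n → ℝ
  B : Sp n → Matrix (Fin n) (Fin n) ℝ
  contDiff_V : ContDiff ℝ 2 V
  contDiff_B : ∀ i k, ContDiff ℝ 1 (fun x => B x i k)
  antisymm_B : ∀ x i k, B x k i = -B x i k

/-- The force `-∇V(x) + c⁻¹ B(x) v`. -/
def EMField.force {n : ℕ} (f : EMField n) (c : ℝ) (x v : Sp n) : Sp n :=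
  -gradient f.V x + (1 / c) • WithLp.toLp 2 ((f.B x).mulVec (WithLp.ofLp v))

/-- Long range decay: `|∂^j V| ≤ β_{|j|} (1+|x|)^{-(α+|j|)}` for `|j| ≤ 2` and
`|∂^j B_{i,k}| ≤ β_{|j|+1} (1+|x|)^{-(α+|j|+1)}` for `|j| ≤ 1`. -/
def EMField.IsLongRange {n : ℕ} (f : EMField n) (α : ℝ) (β : ℕ → ℝ) : Prop :=
  (∀ j : List (Fin n), j.length ≤ 2 → ∀ x,
    |pderivs j f.V x| ≤ β j.length * (1 + ‖x‖) ^ (-(α + (j.length : ℝ)))) ∧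
  (∀ i k, ∀ j : List (Fin n), j.length ≤ 1 → ∀ x,
    |pderivs j (fun y => f.B y i k) x| ≤
      β (j.length + 1) * (1 + ‖x‖) ^ (-(α + (j.length : ℝ) + 1)))

/-- Short range decay: `|∂^j V| ≤ β_{|j|+1} (1+|x|)^{-(α+1+|j|)}` for `|j| ≤ 2` and
`|∂^j B_{i,k}| ≤ β_{|j|+2} (1+|x|)^{-(α+|j|+2)}` for `|j| ≤ 1`. -/
def EMField.IsShortRange {n : ℕ} (f : EMField n) (α : ℝ) (β : ℕ → ℝ) : Prop :=
  (∀ j : List (Fin n), j.length ≤ 2 → ∀ x,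
    |pderivs j f.V x| ≤ β (j.length + 1) * (1 + ‖x‖) ^ (-(α + 1 + (j.length : ℝ)))) ∧
  (∀ i k, ∀ j : List (Fin n), j.length ≤ 1 → ∀ x,
    |pderivs j (fun y => f.B y i k) x| ≤
      β (j.length + 2) * (1 + ‖x‖) ^ (-(α + (j.length : ℝ) + 2)))

/-- The standing assumptions: the speed of light `c > 0`, the exponent `α ∈ (0,1]`, a long range
field `l` and a short range field `s` with their decay constants `β_m^l` (`m = 0,1,2`) and `β_m^s`
(`m = 1,2,3`), all positive, and the closure condition for the total magnetic field `B^l + B^s`. -/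
structure Setting (n : ℕ) where
  c : ℝ
  α : ℝ
  βl : ℕ → ℝ
  βs : ℕ → ℝ
  l : EMField n
  s : EMField n
  c_pos : 0 < c
  α_pos : 0 < α
  α_le_one : α ≤ 1
  βl_pos : ∀ m, m ≤ 2 → 0 < βl m
  βs_pos : ∀ m, 1 ≤ m → m ≤ 3 → 0 < βs m
  longRange : l.IsLongRange α βl
  shortRange : s.IsShortRange α βs
  closed_B : ∀ x i k m,
    pderivs [i] (fun y => l.B y k m + s.B y k m) x
      + pderivs [m] (fun y => l.B y i k + s.B y i k) x
      + pderivs [k] (fun y => l.B y m i + s.B y m i) x = 0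

/-- `g(p) = p / √(1 + |p|²/c²)`: velocity as a function of the impulse. -/
def gmap {n : ℕ} (c : ℝ) (p : Sp n) : Sp n := (1 / √(1 + ‖p‖ ^ 2 / c ^ 2)) • p

/-- `g⁻¹(v) = v / √(1 - |v|²/c²)`, for `|v| < c`: impulse as a function of the velocity. -/
def ginv {n : ℕ} (c : ℝ) (v : Sp n) : Sp n := (1 / √(1 - ‖v‖ ^ 2 / c ^ 2)) • v

/-- `x` is a `C²` solution on `ℝ`, with `|ẋ| < c`, of the relativistic Newton equation
`ṗ = F(x, ẋ)`, `p = ẋ / √(1 - |ẋ|²/c²)`. -/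
def IsTrajectory {n : ℕ} (c : ℝ) (F : Sp n → Sp n → Sp n) (x : ℝ → Sp n) : Prop :=
  ContDiff ℝ 2 x ∧ (∀ t, ‖deriv x t‖ < c) ∧
    ∀ t, HasDerivAt (fun τ => ginv c (deriv x τ)) (F (x t) (deriv x t)) t

/-- The function `μ(σ) = √(2σ / (σ/c² + √(σ²/c⁴ + 4)))`. -/
def mu (c σ : ℝ) : ℝ := √(2 * σ / (σ / c ^ 2 + √(σ ^ 2 / c ^ 4 + 4)))

/-- The X-ray transform `Pf(θ,x) = ∫ f(tθ + x) dt`. -/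
def xray {n : ℕ} {G : Type*} [NormedAddCommGroup G] [NormedSpace ℝ G]
    (f : Sp n → G) (θ x : Sp n) : G :=
  ∫ t : ℝ, f (t • θ + x)

/-- The right-hand side of the equation which defines `ρ₀(σ, r, β, α)`. -/
def rhoFun (n : ℕ) (c σ r β α ρ : ℝ) : ℝ :=
  32 * (n : ℝ) ^ 2 * √(1 - ρ ^ 2 / c ^ 2) * β * (1 + σ + 1 / c)
      * (1 + 1 / (ρ / (2 : ℝ) ^ (3 / 2 : ℝ) - r))
    / (α * (ρ / (2 : ℝ) ^ (3 / 2 : ℝ) - r) * r * (1 - r) ^ (α + 2))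

/-- `ρ` is a root in `(2^{3/2} r, c)` of the equation which defines `ρ₀(σ, r, β, α)`. -/
def IsRhoRoot (n : ℕ) (c σ r β α ρ : ℝ) : Prop :=
  ρ ∈ Ioo ((2 : ℝ) ^ (3 / 2 : ℝ) * r) c ∧ 1 = rhoFun n c σ r β α ρ

/-- For the parameters in question the equation has exactly one root in `(2^{3/2} r, c)`. -/
theorem existsUnique_isRhoRoot {n : ℕ} {c σ r β α : ℝ} (hn : 0 < n) (hc : 0 < c) (hσ : 0 ≤ σ)
    (hβ : 0 < β) (hα : 0 < α) (hr : 0 < r) (hr1 : r < 1) (hrc : (2 : ℝ) ^ (3 / 2 : ℝ) * r < c) :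
    ∃! ρ, IsRhoRoot n c σ r β α ρ := by
  obtain ⟨k, hk⟩ : ∃ k : ℝ, k = (2 : ℝ) ^ (3 / 2 : ℝ) := ⟨_, rfl⟩
  have hk0 : 0 < k := by rw [hk]; positivity
  obtain ⟨A, hA⟩ : ∃ A : ℝ, A = 32 * (n : ℝ) ^ 2 * β * (1 + σ + 1 / c) := ⟨_, rfl⟩
  have hA0 : 0 < A := by
    have : (0 : ℝ) < n := by exact_mod_cast hn
    rw [hA]; positivity
  obtain ⟨D, hD⟩ : ∃ D : ℝ, D = α * r * (1 - r) ^ (α + 2) := ⟨_, rfl⟩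
  have hD0 : 0 < D := by
    have : 0 < (1 - r) ^ (α + 2) := Real.rpow_pos_of_pos (by linarith) _
    rw [hD]; positivity
  have hform : ∀ ρ, rhoFun n c σ r β α ρ
      = A * (√(1 - ρ ^ 2 / c ^ 2) * (1 + 1 / (ρ / k - r))) / (D * (ρ / k - r)) := by
    intro ρ
    rw [rhoFun, hA, hD, ← hk]
    congr 1 <;> ring
  rw [← hk] at hrc
  have hu : ∀ ρ, k * r < ρ → 0 < ρ / k - r := by
    intro ρ h
    have : r < ρ / k := by rw [lt_div_iff₀ hk0]; linarith
    linarith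
  have hanti : ∀ ρ₁ ρ₂, k * r < ρ₁ → ρ₁ < ρ₂ → ρ₂ < c →
      rhoFun n c σ r β α ρ₂ < rhoFun n c σ r β α ρ₁ := by
    intro ρ₁ ρ₂ h1 h12 h2
    have hu1 := hu ρ₁ h1
    have hu12 : ρ₁ / k - r < ρ₂ / k - r := by gcongr
    have hp1 : 0 < ρ₁ := lt_trans (by positivity) h1
    have hp2 : 0 < ρ₂ := hp1.trans h12
    have hs : √(1 - ρ₂ ^ 2 / c ^ 2) < √(1 - ρ₁ ^ 2 / c ^ 2) := by
      apply Real.sqrt_lt_sqrt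
      · have : ρ₂ ^ 2 / c ^ 2 ≤ 1 := by
          rw [div_le_one (by positivity)]; gcongr
        linarith
      · gcongr
    have hq : 1 / (ρ₂ / k - r) < 1 / (ρ₁ / k - r) := one_div_lt_one_div_of_lt hu1 hu12
    have hq2 : 0 < 1 / (ρ₂ / k - r) := one_div_pos.2 (hu1.trans hu12)
    have hs1 := Real.sqrt_nonneg (1 - ρ₂ ^ 2 / c ^ 2)
    rw [hform, hform]
    apply div_lt_div₀
    · gcongr
    · gcongr
    · have := hs1.trans_lt hs
      have := hq2.trans hq
      positivity
    · positivity
  have hcont : ContinuousOn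
      (fun ρ : ℝ => A * √(1 - ρ ^ 2 / c ^ 2) * (ρ / k - r + 1) - D * (ρ / k - r) ^ 2)
      (Icc (k * r) c) := by
    fun_prop
  have hmem := intermediate_value_Ioo' hrc.le hcont
  have h0 : (0 : ℝ) ∈ Ioo
      (A * √(1 - c ^ 2 / c ^ 2) * (c / k - r + 1) - D * (c / k - r) ^ 2)
      (A * √(1 - (k * r) ^ 2 / c ^ 2) * (k * r / k - r + 1) - D * (k * r / k - r) ^ 2) := by
    have e1 : c ^ 2 / c ^ 2 = 1 := div_self (by positivity)
    have e2 : k * r / k = r := by field_simp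
    constructor
    · have := hu c hrc
      rw [e1, sub_self, Real.sqrt_zero]
      have : 0 < D * (c / k - r) ^ 2 := by positivity
      linarith
    · have : (k * r) ^ 2 / c ^ 2 < 1 := by
        rw [div_lt_one (by positivity)]; gcongr
      have : 0 < √(1 - (k * r) ^ 2 / c ^ 2) := Real.sqrt_pos.2 (by linarith)
      have : 0 < A * √(1 - (k * r) ^ 2 / c ^ 2) := by positivity
      rw [e2, sub_self]
      linarith
  obtain ⟨ρ, hρ, hρ0⟩ := hmem h0
  have hroot : 1 = rhoFun n c σ r β α ρ := by
    have hρu := hu ρ hρ.1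
    simp only at hρ0
    have e : A * (√(1 - ρ ^ 2 / c ^ 2) * (1 + 1 / (ρ / k - r))) = D * (ρ / k - r) := by
      generalize ρ / k - r = u at hρ0 hρu
      have : A * (√(1 - ρ ^ 2 / c ^ 2) * (1 + 1 / u))
          = A * √(1 - ρ ^ 2 / c ^ 2) * (u + 1) / u := by
        rw [eq_div_iff hρu.ne', one_div, mul_assoc, mul_assoc, add_mul, inv_mul_cancel₀ hρu.ne']
        ring
      rw [this, div_eq_iff hρu.ne']
      linarith
    rw [hform, e, div_self (by positivity)]
  refine ⟨ρ, ⟨by rwa [← hk], hroot⟩, ?_⟩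
  rintro ρ' ⟨h1, h2⟩
  rw [← hk] at h1
  rcases lt_trichotomy ρ' ρ with h | h | h
  · have := hanti _ _ h1.1 h hρ.2
    linarith
  · exact h
  · have := hanti _ _ hρ.1 h h1.2
    linarith

/-- `ρ₀(σ, r, β, α)`: the root of the equation (it exists and is unique, see
`existsUnique_isRhoRoot`). -/
def rhoZero (n : ℕ) (c σ r β α : ℝ) : ℝ := Classical.epsilon (IsRhoRoot n c σ r β α)

namespace Setting

variable {n : ℕ} (S : Setting n)

/-- The long range force `F^l`. -/
def Fl (x v : Sp n) : Sp n := S.l.force S.c x v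

/-- The short range force `F^s`. -/
def Fs (x v : Sp n) : Sp n := S.s.force S.c x v

/-- The force `F = F^l + F^s`. -/
def F (x v : Sp n) : Sp n := S.Fl x v + S.Fs x v

/-- `μ^l = μ(2⁸ α⁻¹ n² max(β₁^l, β₂^l))`. -/
def muL : ℝ := mu S.c (2 ^ 8 * S.α⁻¹ * (n : ℝ) ^ 2 * max (S.βl 1) (S.βl 2))

/-- `β = max(β₁^l, β₂^l, β₂^s, β₃^s)`. -/
def β : ℝ := max (max (S.βl 1) (S.βl 2)) (max (S.βs 2) (S.βs 3))

/-- The solutions of `ṗ = F^l(z, ż)` which start at the origin at time `0`, have velocity `v` in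
the limit along `e` (`e = atBot` for `z_-(v,·)`, `e = atTop` for `z_+(v,·)`), and stay close
to `tv`. -/
def IsFree (e : Filter ℝ) (v : Sp n) (z : ℝ → Sp n) : Prop :=
  IsTrajectory S.c S.Fl z ∧ Tendsto (fun t => deriv z t - v) e (𝓝 0) ∧ z 0 = 0 ∧
    ∀ t : ℝ, ‖z t - t • v‖ ≤
      (2 : ℝ) ^ (9 / 2 : ℝ) * (n : ℝ) ^ (3 / 2 : ℝ) * S.βl 1 * √(1 - ‖v‖ ^ 2 / S.c ^ 2)
        / (S.α * ‖v‖) * |t|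

/-- The solution `z_-(v,·)`. -/
def zMinus (v : Sp n) : ℝ → Sp n := Classical.epsilon (S.IsFree atBot v)

/-- The solution `z_+(v,·)`. -/
def zPlus (v : Sp n) : ℝ → Sp n := Classical.epsilon (S.IsFree atTop v)

/-- `X` solves `ṗ = F(X, Ẋ)` and `X(t) = z_-(v,t) + x + y_-(t)` with `|ẏ_-(t)| + |y_-(t)| → 0`
as `t → -∞`. -/
def IsIncoming (v x : Sp n) (X : ℝ → Sp n) : Prop :=
  IsTrajectory S.c S.F X ∧
    Tendsto (fun t => ‖deriv X t - deriv (S.zMinus v) t‖ + ‖X t - (S.zMinus v t + x)‖)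
      atBot (𝓝 0)

/-- The solution with the incoming data `(v, x)`. -/
def sol (v x : Sp n) : ℝ → Sp n := Classical.epsilon (S.IsIncoming v x)

/-- The trajectory `X` has the outgoing data `q = (v_+, x_+)`, `μ^l ≤ |v_+| < c`:
`X(t) = z_+(v_+,t) + x_+ + y_+(t)` with `|ẏ_+(t)| + |y_+(t)| → 0` as `t → +∞`. -/
def IsOutgoing (X : ℝ → Sp n) (q : Sp n × Sp n) : Prop :=
  S.muL ≤ ‖q.1‖ ∧ ‖q.1‖ < S.c ∧
    Tendsto (fun t => ‖deriv X t - deriv (S.zPlus q.1) t‖ + ‖X t - (S.zPlus q.1 t + q.2)‖)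
      atTop (𝓝 0)

/-- The scattering map `(v_-, x_-) ↦ (v_+, x_+)`, with junk values off its domain. -/
def scat (v x : Sp n) : Sp n × Sp n := Classical.epsilon (S.IsOutgoing (S.sol v x))

/-- The scattering datum `a(v_-, x_-) = v_+`. -/
def a (v x : Sp n) : Sp n := (S.scat v x).1

/-- The scattering datum `b(v_-, x_-) = x_+`. -/
def b (v x : Sp n) : Sp n := (S.scat v x).2

/-- `a_sc(v_-, x_-) = a(v_-, x_-) - v_-`. -/
def asc (v x : Sp n) : Sp n := S.a v x - v

/-- `b_sc(v_-, x_-) = b(v_-, x_-) - x_-`. -/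
def bsc (v x : Sp n) : Sp n := S.b v x - x

/-- The domain of definition of the scattering map: `μ^l ≤ |v_-| < c`, and all the objects which
enter the definition of `a(v_-, x_-)` and `b(v_-, x_-)` exist and are unique. -/
def domain : Set (Sp n × Sp n) :=
  {q | S.muL ≤ ‖q.1‖ ∧ ‖q.1‖ < S.c ∧ (∃! z, S.IsFree atBot q.1 z) ∧
    (∃! X, S.IsIncoming q.1 q.2 X) ∧ (∃! w, S.IsOutgoing (S.sol q.1 q.2) w) ∧
    ∃! z, S.IsFree atTop (S.a q.1 q.2) z}

/-- The long range force along the translate by `y` of the curve `z`. -/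
def FlAlong (z : ℝ → Sp n) (y : Sp n) (τ : ℝ) : Sp n := S.Fl (z τ + y) (deriv z τ)

/-- The integrand over `(-∞, 0]` in the definition of `W(v,x)`. -/
def WPast (v x : Sp n) (σ : ℝ) : Sp n :=
  gmap S.c (ginv S.c v + ∫ τ in Iic σ, S.FlAlong (S.zMinus v) x τ)
    - gmap S.c (ginv S.c v + ∫ τ in Iic σ, S.FlAlong (S.zMinus v) 0 τ)

/-- The integrand over `[0, +∞)` in the definition of `W(v,x)`. -/
def WFuture (v x : Sp n) (σ : ℝ) : Sp n :=
  gmap S.c (ginv S.c (S.a v x) - ∫ τ in Ioi σ, S.FlAlong (S.zPlus (S.a v x)) x τ)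
    - gmap S.c (ginv S.c (S.a v x) - ∫ τ in Ioi σ, S.FlAlong (S.zPlus (S.a v x)) 0 τ)

/-- The vector `W(v,x)`. -/
def W (v x : Sp n) : Sp n := (∫ σ in Iic (0 : ℝ), S.WPast v x σ) + ∫ σ in Ioi (0 : ℝ), S.WFuture v x σ

/-- All the integrals in the definition of `W(v,x)` converge absolutely. -/
def WConverges (v x : Sp n) : Prop :=
  IntegrableOn (S.FlAlong (S.zMinus v) x) (Iic 0) ∧
  IntegrableOn (S.FlAlong (S.zMinus v) 0) (Iic 0) ∧
  IntegrableOn (S.FlAlong (S.zPlus (S.a v x)) x) (Ioi 0) ∧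
  IntegrableOn (S.FlAlong (S.zPlus (S.a v x)) 0) (Ioi 0) ∧
  IntegrableOn (S.WPast v x) (Iic 0) ∧ IntegrableOn (S.WFuture v x) (Ioi 0)

/-- The integral `∫ F(τθ + x, w) dτ` over `ℝ`. -/
def lineF (θ x w : Sp n) : Sp n := ∫ τ : ℝ, S.F (τ • θ + x) w

/-- The difference of the iterated integrals
`∫_{-∞}^0 ∫_{-∞}^σ F^s(τθ+x, w) dτ dσ - ∫_0^{+∞} ∫_σ^{+∞} F^s(τθ+x, w) dτ dσ`. -/
def iterFs (θ x w : Sp n) : Sp n :=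
  (∫ σ in Iic (0 : ℝ), ∫ τ in Iic σ, S.Fs (τ • θ + x) w)
    - ∫ σ in Ioi (0 : ℝ), ∫ τ in Ioi σ, S.Fs (τ • θ + x) w

/-- All the integrals of `F`, `F^s` and `V^s` along the line `τ ↦ τθ + x`, with velocity argument
`w`, which occur in the main theorem converge absolutely. -/
def LineIntegralsConverge (θ x w : Sp n) : Prop :=
  Integrable (fun τ : ℝ => S.F (τ • θ + x) w) ∧
  Integrable (fun τ : ℝ => S.Fs (τ • θ + x) w) ∧
  IntegrableOn (fun σ : ℝ => ∫ τ in Iic σ, S.Fs (τ • θ + x) w) (Iic 0) ∧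
  IntegrableOn (fun σ : ℝ => ∫ τ in Ioi σ, S.Fs (τ • θ + x) w) (Ioi 0) ∧
  Integrable (fun σ : ℝ => S.s.V (σ • θ + x))

end Setting

end RelScattering

end

open RelScattering

/-!
At speeds `ρ` close to `c` a force changes the velocity only little: the derivative of
`g(p) = p / √(1 + |p|²/c²)` at the impulse `g⁻¹(v)`, `|v| = ρ`, is `s = √(1 - ρ²/c²)` times a
bounded map (`Dmap`). All trajectories in question therefore stay in a tube (`tube`) around the
straight line `t ↦ tv + x`. As `v` is orthogonal to `x`, the distance from the origin is at least
comparable to `1 + ρ|t|` in the tube, and the decay of the forces in space becomes decay in time,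
with weights `wt`. A single small parameter `ε = s n²β (1 + |x|) / (α ρ²)` (`smallness`) controls
every perturbation argument; the condition `ρ > ρ₀(|x|, r, β, α)` gives `ε ≤ 1/1728`
(`small_of_rhoZero_lt`), after which the parameter `r` plays no role.

*Existence and uniqueness.* The equation of motion is the integral equation `ẋ(t) = g(g⁻¹(v) +
∫_{-∞}^t F(x, ẋ))`. For the long range force it is solved near `tv` by a contraction
(`existsUnique_free`; the condition `μ^l ≤ |v|` amounts to the smallness condition used there, see
`muL_le_iff`). For the full force the difference `ẋ - ż_-` is found by a contraction in a space of
functions decaying at `-∞` like `wt ρ (α + 1)` (`Regime.exists_incoming`). Uniqueness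
(`Regime.incoming_unique`) follows because every bound on the difference of two solutions near
`-∞` improves by a factor.

*Outgoing data.* The impulse converges as `t → +∞` since the force is integrable along the
trajectory, and conservation of energy gives `|a| = |v|` (`norm_velocity_eq`): the magnetic force
does no work and the potentials vanish at infinity. Read backwards in time, the motion for `t ≥ 0`
is again a motion with given data at `-∞`, for the magnetic field of the opposite sign, so the
estimates on the half line `t ≤ 0` (`Incoming`) apply to both halves.

*Asymptotics.* Because `|a| = |v|`, the vector `a_sc / s` is the change of impulse, that is
`∫ F(x, ẋ)`, and replacing the trajectory by the line costs `O(ε)` relatively. The vector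
`b_sc` is the integral of `ẋ - ż_±`. The part due to displacing the free trajectory by `x` is `W`;
what remains is `g(P) - g(P')`, where the impulses `P` and `P'` differ by the impulse of the short
range force along the line up to `O(ε)` (`Incoming.norm_impulse_sub_sub_le`). Linearizing `g`
gives `Dmap` applied to the iterated integrals of `F^s`, whose component along `θ` is
`-∫ V^s(σθ + x) dσ` since `θ · F^s(τθ + x, ρθ) = -∂_τ V^s(τθ + x)` (`inner_iterFs`). The limits
follow from these error bounds, as `F` is affine in the velocity.
-/

namespace RelScattering

/-! ### Decaying weights and improper integrals -/

/-- The weight `(1 + ρ|t|)^{-b}` which measures the decay along a curve of speed about `ρ`. -/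
noncomputable def wt (ρ b t : ℝ) : ℝ := (1 + ρ * |t|) ^ (-b)

section Weights

variable {ρ b b' t : ℝ}

theorem one_le_base (hρ : 0 ≤ ρ) (t : ℝ) : 1 ≤ 1 + ρ * |t| := by
  have : 0 ≤ ρ * |t| := by positivity
  linarith

theorem wt_pos (hρ : 0 ≤ ρ) (b t : ℝ) : 0 < wt ρ b t :=
  Real.rpow_pos_of_pos (by have := one_le_base hρ t; linarith) _

theorem wt_le_one (hρ : 0 ≤ ρ) (hb : 0 ≤ b) (t : ℝ) : wt ρ b t ≤ 1 :=
  Real.rpow_le_one_of_one_le_of_nonpos (one_le_base hρ t) (by linarith)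

theorem wt_le_wt (hρ : 0 ≤ ρ) (h : b ≤ b') (t : ℝ) : wt ρ b' t ≤ wt ρ b t :=
  Real.rpow_le_rpow_of_exponent_le (one_le_base hρ t) (by linarith)

theorem wt_add (hρ : 0 ≤ ρ) (b b' t : ℝ) : wt ρ (b + b') t = wt ρ b t * wt ρ b' t := by
  rw [wt, wt, wt, ← Real.rpow_add (by have := one_le_base hρ t; linarith)]
  congr 1; ring

theorem base_mul_wt (hρ : 0 ≤ ρ) (b t : ℝ) : (1 + ρ * |t|) * wt ρ (b + 1) t = wt ρ b t := by
  have h := one_le_base hρ t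
  rw [wt_add hρ, wt, wt, Real.rpow_neg_one]
  field_simp

theorem abs_mul_wt_le (hρ : 0 ≤ ρ) (b t : ℝ) : ρ * |t| * wt ρ (b + 1) t ≤ wt ρ b t := by
  have := base_mul_wt hρ b t
  have := wt_pos hρ (b + 1) t
  nlinarith

theorem wt_neg (ρ b t : ℝ) : wt ρ b (-t) = wt ρ b t := by rw [wt, wt, abs_neg]

theorem continuous_wt (hρ : 0 ≤ ρ) (b : ℝ) : Continuous (wt ρ b) := by
  unfold wt
  refine Continuous.rpow_const (by fun_prop) fun t => Or.inl ?_
  have := one_le_base hρ t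
  linarith

theorem tendsto_wt_atBot (hρ : 0 < ρ) (hb : 0 < b) : Tendsto (wt ρ b) atBot (𝓝 0) := by
  refine (tendsto_rpow_neg_atTop hb).comp ?_
  exact tendsto_atTop_add_const_left _ _ (tendsto_abs_atBot_atTop.const_mul_atTop hρ)

theorem hasDerivAt_primitive_wt (hρ : 0 < ρ) (hb : 0 < b) (ht : 0 ≤ t) :
    HasDerivAt (fun τ => -((1 + ρ * τ) ^ (-b) / (b * ρ))) ((1 + ρ * t) ^ (-(b + 1))) t := by
  have h1 : HasDerivAt (fun τ : ℝ => 1 + ρ * τ) ρ t := by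
    simpa using ((hasDerivAt_id t).const_mul ρ).const_add 1
  have h0 : 0 < 1 + ρ * t := by positivity
  have := ((h1.rpow_const (p := -b) (Or.inl h0.ne')).div_const (b * ρ)).neg
  convert! this using 1
  rw [show -(b + 1) = -b - 1 by ring]
  field_simp

theorem wt_integrable_and_integral (hρ : 0 < ρ) (hb : 0 < b) (ht : t ≤ 0) :
    IntegrableOn (wt ρ (b + 1)) (Iic t) ∧
      ∫ τ in Iic t, wt ρ (b + 1) τ = wt ρ b t / (b * ρ) := by
  have hlim : Tendsto (fun τ => -((1 + ρ * τ) ^ (-b) / (b * ρ))) atTop (𝓝 (-(0 / (b * ρ)))) := by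
    refine (Tendsto.div_const ?_ _).neg
    exact (tendsto_rpow_neg_atTop hb).comp
      (tendsto_atTop_add_const_left _ _ (tendsto_id.const_mul_atTop hρ))
  have hd : ∀ τ ∈ Ici (-t), HasDerivAt (fun τ => -((1 + ρ * τ) ^ (-b) / (b * ρ)))
      ((1 + ρ * τ) ^ (-(b + 1))) τ := fun τ hτ =>
    hasDerivAt_primitive_wt hρ hb (by have : -t ≤ τ := hτ; linarith)
  have hp : ∀ τ ∈ Ioi (-t), 0 ≤ (1 + ρ * τ) ^ (-(b + 1)) := fun τ hτ => by
    have : -t < τ := hτ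
    have : 0 ≤ τ := by linarith
    positivity
  have hi := integrableOn_Ioi_deriv_of_nonneg' hd hp hlim
  have hv := integral_Ioi_of_hasDerivAt_of_nonneg' hd hp hlim
  have he : EqOn (fun τ : ℝ => (1 + ρ * τ) ^ (-(b + 1))) (wt ρ (b + 1)) (Ioi (-t)) := by
    intro τ hτ
    have h1 : -t < τ := hτ
    simp only [wt]
    rw [abs_of_nonneg (by linarith : (0 : ℝ) ≤ τ)]
  have hi' : IntegrableOn (wt ρ (b + 1)) (Ioi (-t)) := hi.congr_fun he measurableSet_Ioi
  constructor
  · have := ((MeasurePreserving.integrableOn_comp_preimage (Measure.measurePreserving_neg volume)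
      (Homeomorph.neg ℝ).measurableEmbedding).2 hi')
    have h2 : IntegrableOn (wt ρ (b + 1)) (Iio t) := by
      refine (this.congr_fun (fun τ _ => wt_neg ρ (b + 1) τ) ?_).mono_set (by simp)
      simp
    exact (integrableOn_Iic_iff_integrableOn_Iio (by finiteness)).2 h2
  · rw [setIntegral_congr_fun measurableSet_Ioi he] at hv
    have h3 := integral_comp_neg_Iic t (wt ρ (b + 1))
    simp only [wt_neg] at h3
    rw [h3, hv, wt, abs_of_nonpos ht]
    ring_nf

theorem integrable_wt (hρ : 0 < ρ) (hb : 0 < b) : Integrable (wt ρ (b + 1)) := by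
  have h := (wt_integrable_and_integral hρ hb le_rfl).1
  rw [← integrableOn_univ, ← Iic_union_Ioi (a := (0 : ℝ))]
  refine h.union ?_
  have := ((MeasurePreserving.integrableOn_comp_preimage (Measure.measurePreserving_neg volume)
      (Homeomorph.neg ℝ).measurableEmbedding).2 h)
  refine (this.congr_fun (fun τ _ => wt_neg ρ (b + 1) τ) ?_).mono_set ?_
  · simp
  · intro τ hτ
    have : (0 : ℝ) < τ := hτ
    simp only [neg_preimage, neg_Iic, neg_zero, mem_Ici]
    exact this.le

theorem integral_wt (hρ : 0 < ρ) (hb : 0 < b) : ∫ τ, wt ρ (b + 1) τ = 2 / (b * ρ) := by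
  have h := (wt_integrable_and_integral hρ hb le_rfl).2
  have h1 := integral_comp_neg_Iic 0 (wt ρ (b + 1))
  simp only [wt_neg, neg_zero] at h1
  have hi := integrable_wt hρ hb
  rw [← intervalIntegral.integral_Iic_add_Ioi (b := 0) hi.integrableOn hi.integrableOn, ← h1, h]
  simp [wt]
  ring

end Weights

section Integrals

variable {E : Type*} [NormedAddCommGroup E]
variable {f : ℝ → E} {ρ b₁ b₂ K₁ K₂ t : ℝ}

theorem integrableOn_Iic_of_wt_bound (hf : Continuous f) (hρ : 0 < ρ)
    (hb₁ : 0 < b₁) (hb₂ : 0 < b₂)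
    (h : ∀ τ ≤ t, ‖f τ‖ ≤ K₁ * wt ρ (b₁ + 1) τ + K₂ * wt ρ (b₂ + 1) τ) :
    IntegrableOn f (Iic t) := by
  have hg : Integrable fun τ => K₁ * wt ρ (b₁ + 1) τ + K₂ * wt ρ (b₂ + 1) τ :=
    ((integrable_wt hρ hb₁).const_mul _).add ((integrable_wt hρ hb₂).const_mul _)
  refine Integrable.mono' hg.integrableOn hf.aestronglyMeasurable ?_
  exact (ae_restrict_iff' measurableSet_Iic).2 (ae_of_all _ fun τ hτ => h τ hτ)

theorem integrable_of_wt_bound (hf : Continuous f) (hρ : 0 < ρ)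
    (hb₁ : 0 < b₁) (hb₂ : 0 < b₂)
    (h : ∀ τ, ‖f τ‖ ≤ K₁ * wt ρ (b₁ + 1) τ + K₂ * wt ρ (b₂ + 1) τ) :
    Integrable f :=
  Integrable.mono' (((integrable_wt hρ hb₁).const_mul _).add ((integrable_wt hρ hb₂).const_mul _))
    hf.aestronglyMeasurable (ae_of_all _ h)

theorem integrableOn_Iic_of_continuous (hf : Continuous f) {a : ℝ} (hi : IntegrableOn f (Iic a))
    (t : ℝ) : IntegrableOn f (Iic t) := by
  refine (hi.union (hf.integrableOn_Icc (a := a) (b := t))).mono_set fun τ hτ => ?_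
  rcases le_total τ a with h | h
  · exact Or.inl h
  · exact Or.inr ⟨h, hτ⟩

variable [NormedSpace ℝ E]

theorem norm_integral_Iic_le (hρ : 0 < ρ)
    (hb₁ : 0 < b₁) (hb₂ : 0 < b₂) (ht : t ≤ 0)
    (h : ∀ τ ≤ t, ‖f τ‖ ≤ K₁ * wt ρ (b₁ + 1) τ + K₂ * wt ρ (b₂ + 1) τ) :
    ‖∫ τ in Iic t, f τ‖ ≤ K₁ / (b₁ * ρ) * wt ρ b₁ t + K₂ / (b₂ * ρ) * wt ρ b₂ t := by
  have h1 := wt_integrable_and_integral hρ hb₁ ht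
  have h2 := wt_integrable_and_integral hρ hb₂ ht
  calc ‖∫ τ in Iic t, f τ‖
      ≤ ∫ τ in Iic t, (K₁ * wt ρ (b₁ + 1) τ + K₂ * wt ρ (b₂ + 1) τ) := by
        refine norm_integral_le_of_norm_le ((h1.1.const_mul _).add (h2.1.const_mul _)) ?_
        exact (ae_restrict_iff' measurableSet_Iic).2 (ae_of_all _ fun τ hτ => h τ hτ)
    _ = _ := by
        rw [integral_add (h1.1.const_mul _) (h2.1.const_mul _), integral_const_mul,
          integral_const_mul, h1.2, h2.2]
        ring

theorem norm_setIntegral_le (s : Set ℝ) (hρ : 0 < ρ) (hK₁ : 0 ≤ K₁) (hK₂ : 0 ≤ K₂)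
    (hb₁ : 0 < b₁) (hb₂ : 0 < b₂) (hs : MeasurableSet s)
    (h : ∀ τ ∈ s, ‖f τ‖ ≤ K₁ * wt ρ (b₁ + 1) τ + K₂ * wt ρ (b₂ + 1) τ) :
    ‖∫ τ in s, f τ‖ ≤ 2 * K₁ / (b₁ * ρ) + 2 * K₂ / (b₂ * ρ) := by
  have h1 := integrable_wt hρ hb₁
  have h2 := integrable_wt hρ hb₂
  have hg := (h1.const_mul K₁).add (h2.const_mul K₂)
  calc ‖∫ τ in s, f τ‖
      ≤ ∫ τ in s, (K₁ * wt ρ (b₁ + 1) τ + K₂ * wt ρ (b₂ + 1) τ) := by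
        refine norm_integral_le_of_norm_le hg.integrableOn ?_
        exact (ae_restrict_iff' hs).2 (ae_of_all _ fun τ hτ => h τ hτ)
    _ ≤ ∫ τ, (K₁ * wt ρ (b₁ + 1) τ + K₂ * wt ρ (b₂ + 1) τ) := by
        refine setIntegral_le_integral hg (ae_of_all _ fun τ => ?_)
        have := (wt_pos hρ.le (b₁ + 1) τ).le
        have := (wt_pos hρ.le (b₂ + 1) τ).le
        show 0 ≤ K₁ * wt ρ (b₁ + 1) τ + K₂ * wt ρ (b₂ + 1) τ
        positivity
    _ = _ := by
        rw [integral_add (h1.const_mul _) (h2.const_mul _), integral_const_mul,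
          integral_const_mul, integral_wt hρ hb₁, integral_wt hρ hb₂]
        ring

theorem hasDerivAt_integral_Iic [CompleteSpace E] (hf : Continuous f) {a : ℝ}
    (hi : IntegrableOn f (Iic a)) (t : ℝ) :
    HasDerivAt (fun s => ∫ τ in Iic s, f τ) (f t) t := by
  have h : (fun s => ∫ τ in Iic s, f τ) = fun s => (∫ τ in Iic a, f τ) + ∫ τ in a..s, f τ := by
    funext s
    rw [← intervalIntegral.integral_Iic_sub_Iic hi (integrableOn_Iic_of_continuous hf hi s)]
    abel
  rw [h]
  exact (intervalIntegral.integral_hasDerivAt_right (hf.intervalIntegrable _ _)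
    (hf.stronglyMeasurableAtFilter _ _) hf.continuousAt).const_add _

variable (f) in
theorem tendsto_integral_Iic_atBot :
    Tendsto (fun s => ∫ τ in Iic s, f τ) atBot (𝓝 0) := by
  exact tendsto_integral_Iic_zero (a := fun s : ℝ => s) tendsto_id

end Integrals

/-! ### Two fixed point arguments -/

/-- If every bound `u ≤ Aψ` improves to `u ≤ (A₀ + A/2)ψ`, then any finite bound at all gives
`u ≤ 2A₀ψ`. -/
theorem le_of_improving_bound {ι : Type*} {s : Set ι} {u ψ : ι → ℝ} {A₀ A₁ : ℝ} (hA₀ : 0 ≤ A₀)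
    (hA₁ : 0 ≤ A₁) (hψ : ∀ i ∈ s, 0 ≤ ψ i) (h₁ : ∀ i ∈ s, u i ≤ A₁ * ψ i)
    (step : ∀ A, 0 ≤ A → (∀ i ∈ s, u i ≤ A * ψ i) → ∀ i ∈ s, u i ≤ (A₀ + A / 2) * ψ i) :
    ∀ i ∈ s, u i ≤ 2 * A₀ * ψ i := by
  have key : ∀ k : ℕ, ∀ i ∈ s, u i ≤ (2 * A₀ + A₁ * (1 / 2) ^ k) * ψ i := by
    intro k
    induction k with
    | zero =>
      intro i hi
      have := h₁ i hi
      have := hψ i hi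
      simp only [pow_zero, mul_one]
      nlinarith
    | succ k ih =>
      intro i hi
      have := step (2 * A₀ + A₁ * (1 / 2) ^ k) (by positivity) ih i hi
      refine this.trans_eq ?_
      rw [pow_succ]; ring
  intro i hi
  have hlim : Tendsto (fun k : ℕ => (2 * A₀ + A₁ * (1 / 2 : ℝ) ^ k) * ψ i) atTop
      (𝓝 ((2 * A₀ + A₁ * 0) * ψ i)) :=
    ((tendsto_pow_atTop_nhds_zero_of_lt_one (by norm_num) (by norm_num)).const_mul _
      |>.const_add _).mul_const _
  simpa using ge_of_tendsto' hlim fun k => key k i hi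

/-- Banach's fixed point theorem for continuous curves `w` subject to a pointwise bound `‖w‖ ≤ m`,
in the norm `sup ‖w‖/φ`. -/
theorem exists_fixedPoint_weighted {E : Type*} [NormedAddCommGroup E] [NormedSpace ℝ E]
    [CompleteSpace E] {φ m : ℝ → ℝ} {B : ℝ} (hφ : Continuous φ) (hφ0 : ∀ t, 0 < φ t)
    (hm : ∀ t, 0 ≤ m t) (hmB : ∀ t, m t ≤ B * φ t) (T : (ℝ → E) → ℝ → E)
    (hT : ∀ w, Continuous w → (∀ t, ‖w t‖ ≤ m t) → Continuous (T w) ∧ ∀ t, ‖T w t‖ ≤ m t)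
    (hc : ∀ w w', Continuous w → (∀ t, ‖w t‖ ≤ m t) → Continuous w' → (∀ t, ‖w' t‖ ≤ m t) →
      ∀ Δ, 0 ≤ Δ → (∀ t, ‖w t - w' t‖ ≤ Δ * φ t) → ∀ t, ‖T w t - T w' t‖ ≤ Δ / 2 * φ t) :
    ∃ w, Continuous w ∧ (∀ t, ‖w t‖ ≤ m t) ∧ T w = w := by
  let K : Set (BoundedContinuousFunction ℝ E) := {f | ∀ t, ‖φ t • f t‖ ≤ m t}
  have hK : IsClosed K := by
    simp only [K, Set.ofPred_forall]
    refine isClosed_iInter fun t => isClosed_le ?_ continuous_const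
    exact ((continuous_eval_const t).const_smul (φ t)).norm
  have : CompleteSpace K := hK.completeSpace_coe
  have : Nonempty K := ⟨⟨0, fun t => by simpa using hm t⟩⟩
  have hcont : ∀ f : K, Continuous fun t => φ t • f.1 t := fun f => hφ.smul f.1.continuous
  have hTf := fun f : K => hT _ (hcont f) f.2
  have hbd : ∀ f : K, ∀ t, ‖(φ t)⁻¹ • T (fun t => φ t • f.1 t) t‖ ≤ B := by
    intro f t
    rw [norm_smul, norm_inv, Real.norm_of_nonneg (hφ0 t).le, inv_mul_le_iff₀ (hφ0 t), mul_comm]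
    exact ((hTf f).2 t).trans (hmB t)
  let Φ : K → K := fun f => ⟨BoundedContinuousFunction.ofNormedAddCommGroup
    (fun t => (φ t)⁻¹ • T (fun t => φ t • f.1 t) t)
    ((hφ.inv₀ fun t => (hφ0 t).ne').smul (hTf f).1) B (hbd f), fun t => by
      simpa [smul_smul, mul_inv_cancel₀ (hφ0 t).ne'] using (hTf f).2 t⟩
  have hΦ : ContractingWith (1 / 2) Φ := by
    refine ⟨by norm_num, LipschitzWith.of_dist_le_mul fun f g => ?_⟩
    have h0 : (0 : ℝ) ≤ dist f g := dist_nonneg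
    refine (BoundedContinuousFunction.dist_le (by positivity)).2 fun t => ?_
    have h1 : ∀ t, ‖φ t • f.1 t - φ t • g.1 t‖ ≤ dist f g * φ t := fun t => by
      rw [← smul_sub, norm_smul, Real.norm_of_nonneg (hφ0 t).le, mul_comm, ← dist_eq_norm]
      exact mul_le_mul_of_nonneg_right (BoundedContinuousFunction.dist_coe_le_dist t) (hφ0 t).le
    have h2 := hc _ _ (hcont f) f.2 (hcont g) g.2 _ h0 h1 t
    simp only [Φ, BoundedContinuousFunction.coe_ofNormedAddCommGroup]
    rw [dist_eq_norm, ← smul_sub, norm_smul, norm_inv, Real.norm_of_nonneg (hφ0 t).le,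
      inv_mul_le_iff₀ (hφ0 t)]
    refine h2.trans_eq ?_
    push_cast
    ring
  refine ⟨fun t => φ t • (hΦ.fixedPoint Φ).1 t, hcont _, (hΦ.fixedPoint Φ).2, ?_⟩
  have hfix : Φ (hΦ.fixedPoint Φ) = hΦ.fixedPoint Φ := hΦ.fixedPoint_isFixedPt
  funext t
  have := congrArg (fun f : K => φ t • f.1 t) hfix
  simpa [Φ, smul_smul, mul_inv_cancel₀ (hφ0 t).ne'] using this

/-! ### Impulse and velocity -/

section Momentum

variable {n : ℕ} {c : ℝ} {p q v : Sp n}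

/-- The Lorentz factor `√(1 + |p|²/c²)` as a function of the impulse. -/
noncomputable def gam (c : ℝ) (p : Sp n) : ℝ := √(1 + ‖p‖ ^ 2 / c ^ 2)

theorem gam_sq (c : ℝ) (p : Sp n) : gam c p ^ 2 = 1 + ‖p‖ ^ 2 / c ^ 2 :=
  Real.sq_sqrt (by positivity)

theorem one_le_gam (c : ℝ) (p : Sp n) : 1 ≤ gam c p := by
  rw [gam, Real.one_le_sqrt]
  have : 0 ≤ ‖p‖ ^ 2 / c ^ 2 := by positivity
  linarith

theorem gam_pos (c : ℝ) (p : Sp n) : 0 < gam c p := by linarith [one_le_gam c p]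

theorem norm_lt_gam (hc : 0 < c) (p : Sp n) : ‖p‖ < c * gam c p := by
  refine lt_of_pow_lt_pow_left₀ 2 (by have := gam_pos c p; positivity) ?_
  rw [mul_pow, gam_sq, mul_add, mul_div_cancel₀ _ (by positivity)]
  nlinarith

theorem abs_gam_sub_le (hc : 0 < c) (p q : Sp n) : |gam c p - gam c q| ≤ ‖p - q‖ / c := by
  have h1 := norm_lt_gam hc p
  have h2 := norm_lt_gam hc q
  have hp := gam_pos c p
  have hq := gam_pos c q
  have h3 : (gam c p - gam c q) * (c ^ 2 * (gam c p + gam c q))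
      = (‖p‖ - ‖q‖) * (‖p‖ + ‖q‖) := by
    have : (gam c p - gam c q) * (c ^ 2 * (gam c p + gam c q))
      = c ^ 2 * (gam c p ^ 2 - gam c q ^ 2) := by ring
    rw [this, gam_sq, gam_sq]
    field_simp
    ring
  have h4 := abs_norm_sub_norm_le p q
  rw [le_div_iff₀ hc]
  have h5 : |gam c p - gam c q| * (c ^ 2 * (gam c p + gam c q))
      ≤ ‖p - q‖ * (c * (gam c p + gam c q)) := by
    rw [← abs_of_pos (show 0 < c ^ 2 * (gam c p + gam c q) by positivity), ← abs_mul, h3, abs_mul,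
      abs_of_nonneg (show 0 ≤ ‖p‖ + ‖q‖ by positivity)]
    refine mul_le_mul h4 ?_ (by positivity) (by positivity)
    linarith
  have h6 : 0 < c * (gam c p + gam c q) := by positivity
  refine le_of_mul_le_mul_right ?_ h6
  linarith

theorem abs_inv_gam_sub_le (hc : 0 < c) (p q : Sp n) :
    |1 / gam c p - 1 / gam c q| ≤ ‖p - q‖ / (c * gam c p * gam c q) := by
  have hp := gam_pos c p
  have hq := gam_pos c q
  have h : 1 / gam c p - 1 / gam c q = (gam c q - gam c p) / (gam c p * gam c q) := by
    field_simp
  rw [h, abs_div, abs_of_pos (mul_pos hp hq), div_le_div_iff₀ (by positivity) (by positivity)]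
  have := abs_gam_sub_le hc q p
  rw [le_div_iff₀ hc, norm_sub_rev] at this
  calc _ = |gam c q - gam c p| * c * (gam c p * gam c q) := by ring
    _ ≤ _ := by gcongr

theorem gmap_eq (c : ℝ) (p : Sp n) : gmap c p = (1 / gam c p) • p := rfl

theorem norm_gmap (c : ℝ) (p : Sp n) : ‖gmap c p‖ = ‖p‖ / gam c p := by
  rw [gmap_eq, norm_smul, Real.norm_of_nonneg (by have := gam_pos c p; positivity)]
  ring

theorem norm_gmap_lt (hc : 0 < c) (p : Sp n) : ‖gmap c p‖ < c := by
  rw [norm_gmap, div_lt_iff₀ (gam_pos c p)]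
  exact norm_lt_gam hc p

/-- Only the Lorentz factor of one of the two impulses enters the Lipschitz constant. -/
theorem norm_gmap_sub_le (hc : 0 < c) (p q : Sp n) :
    ‖gmap c p - gmap c q‖ ≤ 2 / gam c q * ‖p - q‖ := by
  have hp := gam_pos c p
  have hq := gam_pos c q
  have h : gmap c p - gmap c q = (1 / gam c q) • (p - q) + (1 / gam c p - 1 / gam c q) • p := by
    rw [gmap_eq, gmap_eq, smul_sub, sub_smul]; abel
  have h1 : ‖(1 / gam c p - 1 / gam c q) • p‖ ≤ 1 / gam c q * ‖p - q‖ := by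
    rw [norm_smul, Real.norm_eq_abs]
    calc |1 / gam c p - 1 / gam c q| * ‖p‖
        ≤ ‖p - q‖ / (c * gam c p * gam c q) * (c * gam c p) := by
          gcongr
          · exact abs_inv_gam_sub_le hc p q
          · exact (norm_lt_gam hc p).le
      _ = 1 / gam c q * ‖p - q‖ := by field_simp
  have h2 : ‖(1 / gam c q) • (p - q)‖ = 1 / gam c q * ‖p - q‖ := by
    rw [norm_smul, Real.norm_of_nonneg (by positivity)]
  rw [h]
  refine (norm_add_le _ _).trans ?_
  rw [h2]
  calc _ ≤ 1 / gam c q * ‖p - q‖ + 1 / gam c q * ‖p - q‖ := by gcongr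
    _ = _ := by ring

theorem one_sub_sq_pos (hv : ‖v‖ < c) : 0 < 1 - ‖v‖ ^ 2 / c ^ 2 := by
  have hc : 0 < c := (norm_nonneg v).trans_lt hv
  have : ‖v‖ ^ 2 / c ^ 2 < 1 := by rw [div_lt_one (by positivity)]; gcongr
  linarith

theorem norm_ginv (c : ℝ) (v : Sp n) : ‖ginv c v‖ = ‖v‖ / √(1 - ‖v‖ ^ 2 / c ^ 2) := by
  rw [ginv, norm_smul, Real.norm_of_nonneg (by positivity)]
  ring

theorem gam_ginv (hv : ‖v‖ < c) : gam c (ginv c v) = 1 / √(1 - ‖v‖ ^ 2 / c ^ 2) := by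
  have hc : 0 < c := (norm_nonneg v).trans_lt hv
  have h := one_sub_sq_pos hv
  have hs := Real.sqrt_pos.2 h
  rw [gam, Real.sqrt_eq_iff_mul_self_eq (by positivity) (by positivity), norm_ginv, div_pow,
    Real.sq_sqrt h.le, div_mul_div_comm, Real.mul_self_sqrt h.le]
  field_simp
  have h2 : c ^ 2 - ‖v‖ ^ 2 ≠ 0 := by nlinarith [norm_nonneg v]
  field_simp
  ring

theorem gmap_ginv (hv : ‖v‖ < c) : gmap c (ginv c v) = v := by
  have hs := Real.sqrt_pos.2 (one_sub_sq_pos hv)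
  rw [gmap_eq, gam_ginv hv, ginv, smul_smul]
  field_simp
  simp

theorem sqrt_one_sub_gmap (hc : 0 < c) (p : Sp n) :
    √(1 - ‖gmap c p‖ ^ 2 / c ^ 2) = 1 / gam c p := by
  have hp := gam_pos c p
  rw [Real.sqrt_eq_iff_mul_self_eq]
  · have h2 := gam_sq c p
    have h3 : ‖p‖ ^ 2 = c ^ 2 * (gam c p ^ 2 - 1) := by
      rw [h2]; field_simp; ring
    rw [norm_gmap, div_pow, h3]
    field_simp
    ring
  · exact (one_sub_sq_pos (norm_gmap_lt hc p)).le
  · positivity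

theorem ginv_gmap (hc : 0 < c) (p : Sp n) : ginv c (gmap c p) = p := by
  have hp := gam_pos c p
  rw [ginv, sqrt_one_sub_gmap hc, gmap_eq, smul_smul]
  field_simp
  simp

theorem gmap_neg (c : ℝ) (p : Sp n) : gmap c (-p) = -gmap c p := by simp [gmap]

theorem ginv_neg (c : ℝ) (p : Sp n) : ginv c (-p) = -ginv c p := by simp [ginv]

theorem continuousAt_ginv (hv : ‖v‖ < c) : ContinuousAt (ginv c : Sp n → Sp n) v := by
  unfold ginv
  have := (Real.sqrt_pos.2 (one_sub_sq_pos hv)).ne'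
  fun_prop (disch := assumption)

/-- The derivative of `gmap` at the impulse of velocity `v`. -/
noncomputable def Dmap (c : ℝ) (v : Sp n) : Sp n →L[ℝ] Sp n :=
  √(1 - ‖v‖ ^ 2 / c ^ 2) •
    (ContinuousLinearMap.id ℝ (Sp n) - (1 / c ^ 2) • (innerSL ℝ v).smulRight v)

theorem Dmap_apply (c : ℝ) (v k : Sp n) :
    Dmap c v k = √(1 - ‖v‖ ^ 2 / c ^ 2) • (k - (inner ℝ v k / c ^ 2) • v) := by
  simp [Dmap, smul_smul]
  ring_nf

theorem hasFDerivAt_gmap (hc : 0 < c) (p : Sp n) :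
    HasFDerivAt (gmap c) (Dmap c (gmap c p)) p := by
  have hp := gam_pos c p
  have h1 : HasFDerivAt (fun p : Sp n => 1 + ‖p‖ ^ 2 / c ^ 2)
      ((1 / c ^ 2) • ((2 : ℝ) • innerSL ℝ p)) p := by
    have := ((hasStrictFDerivAt_norm_sq p).hasFDerivAt.mul_const (1 / c ^ 2)).const_add 1
    simpa [div_eq_mul_inv, two_smul] using this
  have h2 : HasFDerivAt (gam c : Sp n → ℝ) ((1 / (2 * gam c p)) •
      ((1 / c ^ 2) • ((2 : ℝ) • innerSL ℝ p))) p := h1.sqrt (by positivity)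
  have h3 : HasFDerivAt (fun p : Sp n => 1 / gam c p) (-(1 / gam c p ^ 2) • ((1 / (2 * gam c p)) •
      ((1 / c ^ 2) • ((2 : ℝ) • innerSL ℝ p)))) p := by
    have := (hasDerivAt_inv hp.ne').comp_hasFDerivAt p h2
    simpa [Function.comp_def] using this
  have h4 := h3.smul (hasFDerivAt_id p)
  refine h4.congr_fderiv ?_
  ext1 k
  rw [Dmap_apply, sqrt_one_sub_gmap hc, gmap_eq]
  simp [smul_smul, smul_sub, inner_smul_left]
  rw [sub_eq_add_neg, ← neg_smul]
  congr 2
  field_simp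
  rw [neg_smul]

theorem contDiff_gmap (c : ℝ) : ContDiff ℝ 2 (gmap c : Sp n → Sp n) := by
  unfold gmap
  refine ContDiff.smul (contDiff_const.div (ContDiff.sqrt ?_ ?_) ?_) contDiff_id
  · exact contDiff_const.add ((contDiff_id.norm_sq ℝ).div_const _)
  · intro x; positivity
  · intro x; positivity

theorem norm_Dmap_sub_le (hc : 0 < c) (p q : Sp n) :
    ‖Dmap c (gmap c p) - Dmap c (gmap c q)‖ ≤ 6 / (c * gam c p * gam c q) * ‖p - q‖ := by
  have hp := gam_pos c p
  have hq := gam_pos c q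
  refine ContinuousLinearMap.opNorm_le_bound _ (by positivity) fun k => ?_
  have hv := (norm_gmap_lt hc p).le
  have hw := (norm_gmap_lt hc q).le
  have hvw := norm_gmap_sub_le hc q p
  rw [norm_sub_rev, norm_sub_rev q] at hvw
  rw [_root_.sub_apply, Dmap_apply, Dmap_apply, sqrt_one_sub_gmap hc,
    sqrt_one_sub_gmap hc]
  generalize gmap c p = v at *
  generalize gmap c q = w at *
  have h : (1 / gam c p) • (k - (inner ℝ v k / c ^ 2) • v) - (1 / gam c q) • (k - (inner ℝ w k / c ^ 2) • w)
      = (1 / gam c p - 1 / gam c q) • (k - (inner ℝ v k / c ^ 2) • v)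
        - (1 / gam c q) • ((inner ℝ v k / c ^ 2) • (v - w) + (inner ℝ (v - w) k / c ^ 2) • w) := by
    rw [inner_sub_left, sub_div]
    module
  have hi : ∀ u : Sp n, ∀ r, ‖u‖ ≤ r → ∀ y : Sp n, ‖(inner ℝ u k / c ^ 2) • y‖ ≤ r * ‖k‖ / c ^ 2 * ‖y‖ := by
    intro u r hu y
    rw [norm_smul, norm_div, Real.norm_of_nonneg (show 0 ≤ c ^ 2 by positivity)]
    gcongr
    exact (norm_inner_le_norm u k).trans (by gcongr)
  have a1 : ‖k - (inner ℝ v k / c ^ 2) • v‖ ≤ 2 * ‖k‖ := by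
    refine (norm_sub_le _ _).trans ?_
    have : ‖(inner ℝ v k / c ^ 2) • v‖ ≤ c * ‖k‖ / c ^ 2 * c := (hi v c hv v).trans (by gcongr)
    have e : c * ‖k‖ / c ^ 2 * c = ‖k‖ := by field_simp
    linarith
  have a2 : ‖(inner ℝ v k / c ^ 2) • (v - w) + (inner ℝ (v - w) k / c ^ 2) • w‖
      ≤ 2 / c * ‖v - w‖ * ‖k‖ := by
    refine (norm_add_le _ _).trans ?_
    have b1 := hi v c hv (v - w)
    have b2 : ‖(inner ℝ (v - w) k / c ^ 2) • w‖ ≤ ‖v - w‖ * ‖k‖ / c ^ 2 * c :=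
      (hi (v - w) _ le_rfl w).trans (by gcongr)
    refine (add_le_add b1 b2).trans_eq ?_
    field_simp
    ring
  rw [h]
  refine (norm_sub_le _ _).trans ?_
  rw [norm_smul, norm_smul, Real.norm_eq_abs, Real.norm_of_nonneg (show 0 ≤ 1 / gam c q by positivity)]
  calc _ ≤ ‖p - q‖ / (c * gam c p * gam c q) * (2 * ‖k‖)
        + 1 / gam c q * (2 / c * (2 / gam c p * ‖p - q‖) * ‖k‖) := by
        gcongr
        · exact abs_inv_gam_sub_le hc p q
        · exact a2.trans (by gcongr)
    _ = _ := by
        field_simp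
        ring

theorem half_gam_le {p₀ P : Sp n} (h : ‖P - p₀‖ ≤ ‖p₀‖ / 2) : gam c p₀ / 2 ≤ gam c P := by
  rw [gam, gam]
  have h1 : ‖p₀‖ / 2 ≤ ‖P‖ := by
    have := norm_sub_norm_le p₀ P
    rw [norm_sub_rev] at this
    linarith
  refine Real.le_sqrt_of_sq_le ?_
  rw [div_pow, Real.sq_sqrt (by positivity)]
  have h2 : ‖p₀‖ ^ 2 / c ^ 2 / 4 ≤ ‖P‖ ^ 2 / c ^ 2 := by
    rw [div_right_comm]
    gcongr
    nlinarith [norm_nonneg p₀]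
  linarith

/-- `gmap` contracts near a large impulse. -/
theorem norm_gmap_sub_le_of_near (hv : ‖v‖ < c) (h : ‖q - ginv c v‖ ≤ ‖ginv c v‖ / 2) :
    ‖gmap c p - gmap c q‖ ≤ 4 * √(1 - ‖v‖ ^ 2 / c ^ 2) * ‖p - q‖ := by
  have hc : 0 < c := (norm_nonneg v).trans_lt hv
  refine (norm_gmap_sub_le hc p q).trans ?_
  gcongr
  have h1 := half_gam_le (c := c) h
  rw [gam_ginv hv] at h1
  have hs := Real.sqrt_pos.2 (one_sub_sq_pos hv)
  rw [div_le_iff₀ (gam_pos c q)]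
  generalize √(1 - ‖v‖ ^ 2 / c ^ 2) = s at *
  calc (2 : ℝ) = 4 * s * (1 / s / 2) := by field_simp; norm_num
    _ ≤ _ := by gcongr

theorem norm_gmap_sub_velocity_le (hv : ‖v‖ < c) (p : Sp n) :
    ‖gmap c p - v‖ ≤ 2 * √(1 - ‖v‖ ^ 2 / c ^ 2) * ‖p - ginv c v‖ := by
  have hc : 0 < c := (norm_nonneg v).trans_lt hv
  have := norm_gmap_sub_le hc p (ginv c v)
  rwa [gmap_ginv hv, gam_ginv hv, div_div_eq_mul_div, div_one] at this

/-- Linearization of `gmap` near the impulse of velocity `v`, with error quadratic in the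
deviation from that impulse. -/
theorem norm_gmap_sub_sub_Dmap_le (hv : ‖v‖ < c) {R : ℝ} (hR : R ≤ ‖ginv c v‖ / 2)
    (hp : ‖p - ginv c v‖ ≤ R) (hq : ‖q - ginv c v‖ ≤ R) :
    ‖gmap c p - gmap c q - Dmap c v (p - q)‖
      ≤ 12 * (1 - ‖v‖ ^ 2 / c ^ 2) / c * R * ‖p - q‖ := by
  have hc : 0 < c := (norm_nonneg v).trans_lt hv
  have hs := one_sub_sq_pos hv
  refine (convex_closedBall (ginv c v) R).norm_image_sub_le_of_norm_hasFDerivWithin_le'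
    (fun y _ => (hasFDerivAt_gmap hc y).hasFDerivWithinAt) (fun y hy => ?_) (x := q) (y := p)
    (by simpa [dist_eq_norm] using hq) (by simpa [dist_eq_norm] using hp)
  rw [mem_closedBall_iff_norm] at hy
  have h1 := norm_Dmap_sub_le hc y (ginv c v)
  rw [gmap_ginv hv] at h1
  refine h1.trans ?_
  have h2 := half_gam_le (c := c) (hy.trans hR)
  rw [gam_ginv hv] at h2 ⊢
  refine mul_le_mul ?_ hy (norm_nonneg _) (by positivity)
  have hs' := Real.sqrt_pos.2 hs
  have hss := Real.sq_sqrt hs.le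
  generalize √(1 - ‖v‖ ^ 2 / c ^ 2) = s at *
  rw [← hss]
  calc 6 / (c * gam c y * (1 / s)) ≤ 6 / (c * (1 / s / 2) * (1 / s)) := by gcongr
    _ = 12 * s ^ 2 / c := by field_simp; norm_num

theorem norm_Dmap_le (hv : ‖v‖ < c) (k : Sp n) :
    ‖Dmap c v k‖ ≤ 2 * √(1 - ‖v‖ ^ 2 / c ^ 2) * ‖k‖ := by
  have hc : 0 < c := (norm_nonneg v).trans_lt hv
  rw [Dmap_apply, norm_smul, Real.norm_of_nonneg (by positivity), mul_right_comm, mul_comm]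
  gcongr
  refine (norm_sub_le _ _).trans ?_
  have : ‖(inner ℝ v k / c ^ 2) • v‖ ≤ c * ‖k‖ / c ^ 2 * c := by
    rw [norm_smul, norm_div, Real.norm_of_nonneg (show 0 ≤ c ^ 2 by positivity)]
    gcongr
    exact (norm_inner_le_norm v k).trans (by gcongr)
  have e : c * ‖k‖ / c ^ 2 * c = ‖k‖ := by field_simp
  linarith

end Momentum

/-! ### Bounds for the forces -/

section Coordinates

variable {n : ℕ}

theorem norm_le_of_abs_coord_le {y : Sp n} {K : ℝ} (hK : 0 ≤ K) (h : ∀ i, |y i| ≤ K) :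
    ‖y‖ ≤ n * K := by
  refine (sq_le_sq₀ (norm_nonneg _) (by positivity)).1 ?_
  rw [EuclideanSpace.real_norm_sq_eq]
  have h1 : ∑ i, y i ^ 2 ≤ ∑ _i : Fin n, K ^ 2 :=
    Finset.sum_le_sum fun i _ => sq_le_sq.2 (by rw [abs_of_nonneg hK]; exact h i)
  rw [Finset.sum_const, Finset.card_univ, Fintype.card_fin, nsmul_eq_mul] at h1
  refine h1.trans ?_
  rw [mul_pow]
  gcongr
  rcases Nat.eq_zero_or_pos n with h | h
  · simp [h]
  · have : (1 : ℝ) ≤ n := by exact_mod_cast h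
    nlinarith

theorem abs_coord_le_norm (y : Sp n) (i : Fin n) : |y i| ≤ ‖y‖ := by
  simpa using PiLp.norm_apply_le y i

theorem norm_mulVec_le {M : Matrix (Fin n) (Fin n) ℝ} {e : ℝ} (he : 0 ≤ e)
    (h : ∀ i k, |M i k| ≤ e) (v : Sp n) :
    ‖(WithLp.toLp 2 (M.mulVec (WithLp.ofLp v)) : Sp n)‖ ≤ n * e * ‖v‖ := by
  refine (sq_le_sq₀ (norm_nonneg _) (by positivity)).1 ?_
  rw [EuclideanSpace.real_norm_sq_eq, mul_pow, EuclideanSpace.real_norm_sq_eq v, mul_pow]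
  have h1 : ∀ i : Fin n, (M.mulVec (WithLp.ofLp v)) i ^ 2 ≤ (n * e ^ 2) * ∑ k : Fin n, v k ^ 2 := fun i => by
    refine (Finset.sum_mul_sq_le_sq_mul_sq Finset.univ (fun k => M i k) fun k => v k).trans ?_
    refine mul_le_mul_of_nonneg_right ?_ (Finset.sum_nonneg fun k _ => sq_nonneg _)
    have : ∑ k, M i k ^ 2 ≤ ∑ _k : Fin n, e ^ 2 :=
      Finset.sum_le_sum fun k _ => sq_le_sq.2 (by rw [abs_of_nonneg he]; exact h i k)
    simpa using this
  refine (Finset.sum_le_sum fun i _ => h1 i).trans_eq ?_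
  simp
  ring

theorem norm_clm_le_of_single {L : Sp n →L[ℝ] ℝ} {C : ℝ} (hC : 0 ≤ C)
    (h : ∀ k, |L (EuclideanSpace.single k 1)| ≤ C) : ‖L‖ ≤ n * C := by
  refine L.opNorm_le_bound (by positivity) fun y => ?_
  have hy : y = ∑ k, y k • EuclideanSpace.single k (1 : ℝ) := by
    ext i
    simp [Finset.sum_apply, Pi.single_apply]
  calc ‖L y‖ = ‖∑ k, y k * L (EuclideanSpace.single k 1)‖ := by
        conv_lhs => rw [hy]
        simp
    _ ≤ ∑ k, ‖y k * L (EuclideanSpace.single k 1)‖ := norm_sum_le _ _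
    _ ≤ ∑ _k : Fin n, ‖y‖ * C := by
        refine Finset.sum_le_sum fun k _ => ?_
        rw [norm_mul]
        exact mul_le_mul (abs_coord_le_norm y k) (h k) (norm_nonneg _) (norm_nonneg _)
    _ = _ := by simp; ring

theorem abs_sub_le_of_partials {f : Sp n → ℝ} (hf : Differentiable ℝ f) {K : Set (Sp n)}
    (hK : Convex ℝ K) {C : ℝ} (hC : 0 ≤ C)
    (h : ∀ y ∈ K, ∀ k, |fderiv ℝ f y (EuclideanSpace.single k 1)| ≤ C) {x x' : Sp n}
    (hx : x ∈ K) (hx' : x' ∈ K) : |f x - f x'| ≤ n * C * ‖x - x'‖ :=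
  hK.norm_image_sub_le_of_norm_fderiv_le (fun y _ => hf y)
    (fun y hy => norm_clm_le_of_single hC (h y hy)) hx' hx

theorem gradient_coord (f : Sp n → ℝ) (x : Sp n) (i : Fin n) :
    gradient f x i = fderiv ℝ f x (EuclideanSpace.single i 1) := by
  have h : inner ℝ (gradient f x) (EuclideanSpace.single i (1 : ℝ))
      = fderiv ℝ f x (EuclideanSpace.single i 1) := by
    rw [gradient, InnerProductSpace.toDual_symm_apply]
  rw [← h, EuclideanSpace.inner_single_right]
  simp

end Coordinates

/-- The bounds on a force `G` which enter the scattering theory: decay of order `b` of the force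
and of order `b + 1` of its gradient, for velocities up to twice the speed of light. -/
structure ForceDecay {n : ℕ} (G : Sp n → Sp n → Sp n) (c b L N : ℝ) : Prop where
  cont : Continuous fun q : Sp n × Sp n => G q.1 q.2
  bound : ∀ x v, ‖v‖ ≤ 2 * c → ‖G x v‖ ≤ 3 * L * (1 + ‖x‖) ^ (-b)
  lip : ∀ K : Set (Sp n), Convex ℝ K → ∀ m : ℝ, 0 < m → (∀ y ∈ K, m ≤ 1 + ‖y‖) →
    ∀ x ∈ K, ∀ x' ∈ K, ∀ v v', ‖v‖ ≤ 2 * c → ‖v'‖ ≤ 2 * c →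
      ‖G x v - G x' v'‖ ≤ 3 * N * m ^ (-(b + 1)) * ‖x - x'‖ + N / c * m ^ (-b) * ‖v - v'‖

section Force

variable {n : ℕ}

theorem EMField.continuous_gradient (f : EMField n) : Continuous (gradient f.V) := by
  unfold gradient
  exact (LinearIsometryEquiv.continuous _).comp (f.contDiff_V.continuous_fderiv (by norm_num))

theorem EMField.continuous_B (f : EMField n) : Continuous f.B :=
  continuous_pi fun i => continuous_pi fun k => (f.contDiff_B i k).continuous

theorem EMField.continuous_force (f : EMField n) (c : ℝ) :
    Continuous fun q : Sp n × Sp n => f.force c q.1 q.2 := by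
  unfold EMField.force
  have h : Continuous fun q : Sp n × Sp n =>
      (WithLp.toLp 2 ((f.B q.1).mulVec (WithLp.ofLp q.2)) : Sp n) := by
    refine (PiLp.continuous_toLp 2 _).comp ?_
    exact (f.continuous_B.comp continuous_fst).matrix_mulVec
      ((PiLp.continuous_ofLp 2 _).comp continuous_snd)
  exact ((f.continuous_gradient.comp continuous_fst).neg).add (h.const_smul (1 / c))

theorem EMField.forceDecay (f : EMField n) {c b β₁ β₂ : ℝ} (hn : 1 ≤ n) (hc : 0 < c) (hb : 0 ≤ b)
    (hβ₁ : 0 ≤ β₁) (hβ₂ : 0 ≤ β₂)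
    (hV₁ : ∀ i x, |pderivs [i] f.V x| ≤ β₁ * (1 + ‖x‖) ^ (-b))
    (hV₂ : ∀ k i x, |pderivs [k, i] f.V x| ≤ β₂ * (1 + ‖x‖) ^ (-(b + 1)))
    (hB₁ : ∀ i k x, |f.B x i k| ≤ β₁ * (1 + ‖x‖) ^ (-b))
    (hB₂ : ∀ i k j x, |pderivs [j] (fun y => f.B y i k) x| ≤ β₂ * (1 + ‖x‖) ^ (-(b + 1))) :
    ForceDecay (f.force c) c b (n * β₁) (n ^ 2 * max β₁ β₂) := by
  have hn' : (1 : ℝ) ≤ n := by exact_mod_cast hn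
  have hcinv : ‖(1 / c : ℝ)‖ = 1 / c := Real.norm_of_nonneg (by positivity)
  refine ⟨f.continuous_force c, fun x v hv => ?_, fun K hK m hm hmK x hx x' hx' v v' hv hv' => ?_⟩
  · have hw : 0 ≤ β₁ * (1 + ‖x‖) ^ (-b) := by positivity
    have h1 : ‖gradient f.V x‖ ≤ n * (β₁ * (1 + ‖x‖) ^ (-b)) :=
      norm_le_of_abs_coord_le hw fun i => by rw [gradient_coord]; exact hV₁ i x
    have h2 := norm_mulVec_le hw (fun i k => hB₁ i k x) v
    rw [EMField.force]
    refine (norm_add_le _ _).trans ?_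
    rw [norm_neg, norm_smul, hcinv]
    calc _ ≤ n * (β₁ * (1 + ‖x‖) ^ (-b)) + 1 / c * (n * (β₁ * (1 + ‖x‖) ^ (-b)) * (2 * c)) := by
          gcongr
          exact h2.trans (by gcongr)
      _ = _ := by field_simp; ring
  · have hmono : ∀ y ∈ K, ∀ a : ℝ, 0 ≤ a → (1 + ‖y‖) ^ (-a) ≤ m ^ (-a) := fun y hy a ha =>
      Real.rpow_le_rpow_of_nonpos hm (hmK y hy) (by linarith)
    have hC : 0 ≤ β₂ * m ^ (-(b + 1)) := by positivity
    have hg : ‖gradient f.V x - gradient f.V x'‖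
        ≤ n * (n * (β₂ * m ^ (-(b + 1))) * ‖x - x'‖) := by
      refine norm_le_of_abs_coord_le (by positivity) fun i => ?_
      rw [PiLp.sub_apply, gradient_coord, gradient_coord]
      refine abs_sub_le_of_partials (f := fun y => fderiv ℝ f.V y (EuclideanSpace.single i 1))
        ?_ hK hC (fun y hy k => ?_) hx hx'
      · exact ((f.contDiff_V.fderiv_right (m := 1) (by norm_num)).differentiable
          (by norm_num)).clm_apply (differentiable_const _)
      · exact (hV₂ k i y).trans (mul_le_mul_of_nonneg_left (hmono y hy _ (by linarith)) hβ₂)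
    have hBd : ∀ i k, |(f.B x - f.B x') i k| ≤ n * (β₂ * m ^ (-(b + 1))) * ‖x - x'‖ := fun i k =>
      abs_sub_le_of_partials ((f.contDiff_B i k).differentiable (by norm_num)) hK hC
        (fun y hy j => (hB₂ i k j y).trans (mul_le_mul_of_nonneg_left (hmono y hy _ (by linarith)) hβ₂)) hx hx'
    have hB1 := norm_mulVec_le (by positivity) hBd v
    have hB2 := norm_mulVec_le (by positivity) (fun i k => (hB₁ i k x').trans
      (mul_le_mul_of_nonneg_left (hmono x' hx' b hb) hβ₁)) (v - v')
    have hsplit : f.force c x v - f.force c x' v' = -(gradient f.V x - gradient f.V x')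
        + ((1 / c) • WithLp.toLp 2 ((f.B x - f.B x').mulVec (WithLp.ofLp v))
        + (1 / c) • WithLp.toLp 2 ((f.B x').mulVec (WithLp.ofLp (v - v')))) := by
      simp only [EMField.force, Matrix.sub_mulVec, WithLp.ofLp_sub, Matrix.mulVec_sub,
        WithLp.toLp_sub]
      module
    rw [hsplit]
    refine (norm_add_le _ _).trans ((add_le_add_right (norm_add_le _ _) _).trans ?_)
    rw [norm_neg, norm_smul, norm_smul, hcinv]
    have hnn : (n : ℝ) ≤ n ^ 2 := by nlinarith
    calc _ ≤ n * (n * (β₂ * m ^ (-(b + 1))) * ‖x - x'‖)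
          + (1 / c * (n * (n * (β₂ * m ^ (-(b + 1))) * ‖x - x'‖) * (2 * c))
          + 1 / c * (n * (β₁ * m ^ (-b)) * ‖v - v'‖)) := by
          gcongr
          exact hB1.trans (by gcongr)
      _ = 3 * (n ^ 2 * β₂) * m ^ (-(b + 1)) * ‖x - x'‖ + n * β₁ / c * m ^ (-b) * ‖v - v'‖ := by
          field_simp; ring
      _ ≤ _ := by
          gcongr
          · exact le_max_right _ _
          · exact le_max_left _ _

end Force

namespace Setting

variable {n : ℕ} (S : Setting n)

theorem forceDecay_Fl (hn : 1 ≤ n) : ForceDecay S.Fl S.c (S.α + 1) (n * S.βl 1)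
    (n ^ 2 * max (S.βl 1) (S.βl 2)) := by
  have hα := S.α_pos
  obtain ⟨hV, hB⟩ := S.longRange
  refine S.l.forceDecay hn S.c_pos (by linarith) (S.βl_pos 1 (by norm_num)).le
    (S.βl_pos 2 (by norm_num)).le (fun i x => ?_) (fun k i x => ?_) (fun i k x => ?_)
    (fun i k j x => ?_)
  · simpa using hV [i] (by simp) x
  · have := hV [k, i] (by simp) x
    simp only [List.length_cons, List.length_nil] at this
    convert! this using 3
    push_cast; ring
  · simpa [pderivs] using hB i k [] (by simp) x
  · have := hB i k [j] (by simp) x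
    simpa using this

theorem forceDecay_Fs (hn : 1 ≤ n) : ForceDecay S.Fs S.c (S.α + 2) (n * S.βs 2)
    (n ^ 2 * max (S.βs 2) (S.βs 3)) := by
  have hα := S.α_pos
  obtain ⟨hV, hB⟩ := S.shortRange
  refine S.s.forceDecay hn S.c_pos (by linarith) (S.βs_pos 2 (by norm_num) (by norm_num)).le
    (S.βs_pos 3 (by norm_num) (by norm_num)).le (fun i x => ?_) (fun k i x => ?_)
    (fun i k x => ?_) (fun i k j x => ?_)
  · have := hV [i] (by simp) x
    simp only [List.length_cons, List.length_nil] at this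
    convert! this using 3
    push_cast; ring
  · have := hV [k, i] (by simp) x
    simp only [List.length_cons, List.length_nil] at this
    convert! this using 3
    push_cast; ring
  · simpa [pderivs] using hB i k [] (by simp) x
  · have := hB i k [j] (by simp) x
    simp only [List.length_cons, List.length_nil] at this
    convert! this using 3
    push_cast; ring

end Setting

/-! ### Tubes around straight lines -/

section Tube

variable {n : ℕ}

/-- A neighbourhood, of radius growing linearly in `t`, of the line through `t • v` in the direction
`x`. For `x ⊥ v` its points stay at distance of order `|t|` from the origin, and by convexity so do
the segments between any two of them. -/
def tube (v x : Sp n) (t : ℝ) : Set (Sp n) :=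
  {y | ∃ l : ℝ, ‖y - (t • v + l • x)‖ ≤ (1 + ‖v‖ * |t|) / 8}

theorem convex_tube (v x : Sp n) (t : ℝ) : Convex ℝ (tube v x t) := by
  rintro y ⟨l, hl⟩ y' ⟨l', hl'⟩ a b ha hb hab
  refine ⟨a * l + b * l', ?_⟩
  have h : a • y + b • y' - (t • v + (a * l + b * l') • x)
      = a • (y - (t • v + l • x)) + b • (y' - (t • v + l' • x)) := by
    obtain rfl : b = 1 - a := by linarith
    module
  rw [h]
  refine (norm_add_le _ _).trans ?_
  rw [norm_smul, norm_smul, Real.norm_of_nonneg ha, Real.norm_of_nonneg hb]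
  calc _ ≤ a * ((1 + ‖v‖ * |t|) / 8) + b * ((1 + ‖v‖ * |t|) / 8) := by gcongr
    _ = _ := by rw [← add_mul, hab, one_mul]

theorem le_norm_of_mem_tube {v x y : Sp n} {t : ℝ} (hvx : inner ℝ v x = 0) (hy : y ∈ tube v x t) :
    7 / 8 * (1 + ‖v‖ * |t|) ≤ 1 + ‖y‖ := by
  obtain ⟨l, hl⟩ := hy
  have h1 : ‖v‖ * |t| ≤ ‖t • v + l • x‖ := by
    refine (sq_le_sq₀ (by positivity) (norm_nonneg _)).1 ?_
    rw [norm_add_sq_real, inner_smul_left, inner_smul_right, hvx, norm_smul, norm_smul,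
      Real.norm_eq_abs]
    have := sq_nonneg (‖l‖ * ‖x‖)
    simp only [mul_zero, add_zero]
    nlinarith
  have h2 := norm_sub_norm_le (t • v + l • x) y
  rw [norm_sub_rev] at h2
  linarith

/-- In the tube `1 + ‖y‖` may be smaller than the base `h = 1 + ρ|t|` of the weight by the factor
`7 / 8`; for the exponents in question this costs at most a factor `2`. -/
theorem rpow_seven_eighths_le {b h : ℝ} (hb4 : b ≤ 4) (hh : 1 ≤ h) :
    (7 / 8 * h) ^ (-b) ≤ 2 * h ^ (-b) := by
  rw [Real.mul_rpow (by norm_num) (by linarith)]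
  have h1 : ((7 : ℝ) / 8) ^ (-b) ≤ 2 := by
    calc ((7 : ℝ) / 8) ^ (-b) ≤ (7 / 8 : ℝ) ^ (-4 : ℝ) :=
          Real.rpow_le_rpow_of_exponent_ge (by norm_num) (by norm_num) (by linarith)
      _ = ((7 / 8 : ℝ) ^ (4 : ℕ))⁻¹ := by
          rw [Real.rpow_neg (by norm_num), ← Real.rpow_natCast]; norm_num
      _ ≤ 2 := by norm_num
  gcongr

namespace ForceDecay

variable {G : Sp n → Sp n → Sp n} {c b L N ρ : ℝ}

theorem mono (h : ForceDecay G c b L N) {L' N' : ℝ} (hc : 0 < c) (hL : L ≤ L') (hN : N ≤ N') :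
    ForceDecay G c b L' N' where
  cont := h.cont
  bound x v hv := (h.bound x v hv).trans (by gcongr)
  lip K hK m hm hmK x hx x' hx' v v' hv hv' :=
    (h.lip K hK m hm hmK x hx x' hx' v v' hv hv').trans (by gcongr)

theorem continuous_along (h : ForceDecay G c b L N) {X w : ℝ → Sp n} (hX : Continuous X)
    (hw : Continuous w) : Continuous fun τ => G (X τ) (w τ) :=
  h.cont.comp (hX.prodMk hw)

theorem tube_bound (h : ForceDecay G c b L N) (hL : 0 ≤ L) (hb : 0 ≤ b) (hb4 : b ≤ 4)
    {v x y w : Sp n} {t : ℝ} (hρ : ‖v‖ = ρ) (hvx : inner ℝ v x = 0) (hy : y ∈ tube v x t)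
    (hw : ‖w‖ ≤ 2 * c) : ‖G y w‖ ≤ 6 * L * wt ρ b t := by
  subst hρ
  have h1 := one_le_base (norm_nonneg v) t
  calc ‖G y w‖ ≤ 3 * L * (1 + ‖y‖) ^ (-b) := h.bound y w hw
    _ ≤ 3 * L * (2 * (1 + ‖v‖ * |t|) ^ (-b)) := by
        gcongr
        refine le_trans ?_ (rpow_seven_eighths_le hb4 h1)
        exact Real.rpow_le_rpow_of_nonpos (by positivity) (le_norm_of_mem_tube hvx hy)
          (by linarith)
    _ = _ := by rw [wt]; ring

theorem tube_lip (h : ForceDecay G c b L N) (hN : 0 ≤ N) (hb4 : b + 1 ≤ 4)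
    {v x y y' w w' : Sp n} {t : ℝ} (hρ : ‖v‖ = ρ) (hρ0 : 0 < ρ) (hρc : ρ ≤ c)
    (hvx : inner ℝ v x = 0) (hy : y ∈ tube v x t) (hy' : y' ∈ tube v x t)
    (hw : ‖w‖ ≤ 2 * c) (hw' : ‖w'‖ ≤ 2 * c) :
    ‖G y w - G y' w'‖
      ≤ 6 * N * wt ρ (b + 1) t * ‖y - y'‖ + 2 * N / ρ * wt ρ b t * ‖w - w'‖ := by
  subst hρ
  have h1 := one_le_base (norm_nonneg v) t
  refine (h.lip _ (convex_tube v x t) (7 / 8 * (1 + ‖v‖ * |t|)) (by positivity)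
    (fun z hz => le_norm_of_mem_tube hvx hz) y hy y' hy' w w' hw hw').trans ?_
  calc _ ≤ 3 * N * (2 * (1 + ‖v‖ * |t|) ^ (-(b + 1))) * ‖y - y'‖
        + N / ‖v‖ * (2 * (1 + ‖v‖ * |t|) ^ (-b)) * ‖w - w'‖ := by
        gcongr
        · exact rpow_seven_eighths_le hb4 h1
        · exact rpow_seven_eighths_le (by linarith) h1
    _ = _ := by rw [wt, wt]; ring

end ForceDecay

end Tube

/-! ### Trajectories and their integral equation -/

section Trajectory

variable {n : ℕ} {c : ℝ} {G : Sp n → Sp n → Sp n} {X : ℝ → Sp n}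

theorem tendsto_ginv_deriv {v : Sp n} {e : Filter ℝ} (hv : ‖v‖ < c)
    (hlim : Tendsto (deriv X) e (𝓝 v)) :
    Tendsto (fun t => ginv c (deriv X t)) e (𝓝 (ginv c v)) :=
  (continuousAt_ginv hv).tendsto.comp hlim

namespace IsTrajectory

theorem hasDerivAt (h : IsTrajectory c G X) (t : ℝ) : HasDerivAt X (deriv X t) t :=
  ((h.1.differentiable (by norm_num)) t).hasDerivAt

theorem continuous (h : IsTrajectory c G X) : Continuous X := h.1.continuous

theorem continuous_deriv (h : IsTrajectory c G X) : Continuous (deriv X) :=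
  h.1.continuous_deriv (by norm_num)

theorem c_pos (h : IsTrajectory c G X) : 0 < c := (norm_nonneg _).trans_lt (h.2.1 0)

theorem norm_deriv_le (h : IsTrajectory c G X) (t : ℝ) : ‖deriv X t‖ ≤ 2 * c := by
  have := h.2.1 t
  have := h.c_pos
  linarith

theorem gmap_ginv_deriv (h : IsTrajectory c G X) (t : ℝ) :
    gmap c (ginv c (deriv X t)) = deriv X t := gmap_ginv (h.2.1 t)

theorem ginv_eq (h : IsTrajectory c G X) {v : Sp n} (hv : ‖v‖ < c)
    (hlim : Tendsto (deriv X) atBot (𝓝 v)) {t : ℝ}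
    (hi : IntegrableOn (fun τ => G (X τ) (deriv X τ)) (Iic t)) :
    ginv c (deriv X t) = ginv c v + ∫ τ in Iic t, G (X τ) (deriv X τ) := by
  rw [integral_Iic_of_hasDerivAt_of_tendsto' (fun τ _ => h.2.2 τ) hi (tendsto_ginv_deriv hv hlim)]
  abel

end IsTrajectory

/-- A solution of the integral equation is a trajectory. -/
theorem isTrajectory_of_integral_eq (hc : 0 < c) (hG : Continuous fun q : Sp n × Sp n => G q.1 q.2)
    {w : ℝ → Sp n} {p : Sp n} (hw : Continuous w) (hX : ∀ t, HasDerivAt X (w t) t)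
    (hi : IntegrableOn (fun τ => G (X τ) (w τ)) (Iic 0))
    (heq : ∀ t, w t = gmap c (p + ∫ τ in Iic t, G (X τ) (w τ))) : IsTrajectory c G X := by
  have hd : deriv X = w := funext fun t => (hX t).deriv
  have hXc : Continuous X := continuous_iff_continuousAt.2 fun t => (hX t).continuousAt
  have hP : ∀ t, HasDerivAt (fun t => p + ∫ τ in Iic t, G (X τ) (w τ)) (G (X t) (w t)) t :=
    fun t => (hasDerivAt_integral_Iic (hG.comp (hXc.prodMk hw)) hi t).const_add p
  have hP1 : ContDiff ℝ 1 (fun t => p + ∫ τ in Iic t, G (X τ) (w τ)) := by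
    rw [contDiff_one_iff_deriv]
    refine ⟨fun t => (hP t).differentiableAt, ?_⟩
    rw [show deriv (fun t => p + ∫ τ in Iic t, G (X τ) (w τ)) = fun t => G (X t) (w t) from
      funext fun t => (hP t).deriv]
    exact hG.comp (hXc.prodMk hw)
  have hw1 : ContDiff ℝ 1 w := by
    rw [show w = _ from funext heq]
    exact ((contDiff_gmap c).of_le (by norm_num)).comp hP1
  refine ⟨?_, fun t => ?_, fun t => ?_⟩
  · rw [show (2 : WithTop ℕ∞) = 1 + 1 by norm_num, contDiff_succ_iff_deriv]
    exact ⟨fun t => (hX t).differentiableAt, by simp, hd ▸ hw1⟩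
  · rw [hd, heq]; exact norm_gmap_lt hc _
  · rw [hd]
    have : (fun τ => ginv c (w τ)) = fun t => p + ∫ τ in Iic t, G (X τ) (w τ) := by
      funext t
      conv_lhs => rw [heq t]
      exact ginv_gmap hc _
    rw [this]
    exact hP t

/-! ### Time reversal -/

theorem deriv_comp_neg' (X : ℝ → Sp n) : deriv (fun t => X (-t)) = fun t => -deriv X (-t) :=
  funext fun t => deriv_comp_neg X t

theorem IsTrajectory.reverse (h : IsTrajectory c G X) :
    IsTrajectory c (fun x v => G x (-v)) fun t => X (-t) := by
  refine ⟨h.1.comp contDiff_neg, fun t => ?_, fun t => ?_⟩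
  · rw [deriv_comp_neg', norm_neg]; exact h.2.1 _
  · simp only [deriv_comp_neg', ginv_neg, neg_neg]
    have := (h.2.2 (-t)).scomp t (hasDerivAt_neg t)
    rw [neg_smul, one_smul] at this
    refine this.neg.congr_deriv (neg_neg _)

/-- The field of the time reversed motion: the magnetic field changes its sign. -/
def EMField.rev (f : EMField n) : EMField n where
  V := f.V
  B := fun x => -f.B x
  contDiff_V := f.contDiff_V
  contDiff_B i k := (f.contDiff_B i k).neg
  antisymm_B x i k := by simp [f.antisymm_B x i k]

theorem EMField.rev_force (f : EMField n) (c : ℝ) (x v : Sp n) :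
    f.rev.force c x v = f.force c x (-v) := by
  simp [EMField.force, EMField.rev, Matrix.neg_mulVec, Matrix.mulVec_neg]

theorem pderivs_neg (f : Sp n → ℝ) (j : List (Fin n)) :
    pderivs j (fun x => -f x) = fun x => -pderivs j f x := by
  induction j with
  | nil => rfl
  | cons i j ih =>
    funext x
    simp [pderivs, ih]

/-- The setting of the time reversed motion. -/
def Setting.rev (S : Setting n) : Setting n :=
  { S with
    l := S.l.rev
    s := S.s.rev
    longRange := ⟨S.longRange.1, fun i k j hj x => by
      have := S.longRange.2 i k j hj x
      simpa [EMField.rev, pderivs_neg] using this⟩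
    shortRange := ⟨S.shortRange.1, fun i k j hj x => by
      have := S.shortRange.2 i k j hj x
      simpa [EMField.rev, pderivs_neg] using this⟩
    closed_B := fun x i k m => by
      have h : ∀ i k m, pderivs [m] (fun y => S.l.rev.B y i k + S.s.rev.B y i k) x
          = -pderivs [m] (fun y => S.l.B y i k + S.s.B y i k) x := fun i k m => by
        have := congrFun (pderivs_neg (fun y => S.l.B y i k + S.s.B y i k) [m]) x
        rw [← this]
        congr 1
        funext y
        simp [EMField.rev]
        ring
      rw [h, h, h]
      have := S.closed_B x i k m
      linarith }

namespace Setting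

variable (S : Setting n)

theorem rev_Fl : S.rev.Fl = fun x v => S.Fl x (-v) := by
  funext x v; exact S.l.rev_force S.c x v

theorem rev_Fs : S.rev.Fs = fun x v => S.Fs x (-v) := by
  funext x v; exact S.s.rev_force S.c x v

theorem rev_F : S.rev.F = fun x v => S.F x (-v) := by
  funext x v; simp only [F, rev_Fl, rev_Fs]

theorem rev_rev : S.rev.rev = S := by
  obtain ⟨c, α, βl, βs, ⟨V, B, _, _, _⟩, ⟨V', B', _, _, _⟩, _, _, _, _, _, _, _, _⟩ := S
  simp [rev, EMField.rev]

theorem isFree_reverse {e : Filter ℝ} {v : Sp n} {z : ℝ → Sp n} (h : S.IsFree e v z) :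
    S.rev.IsFree (map Neg.neg e) (-v) fun t => z (-t) := by
  obtain ⟨h1, h2, h3, h4⟩ := h
  refine ⟨?_, ?_, by simpa using h3, fun t => ?_⟩
  · rw [rev_Fl]; exact h1.reverse
  · rw [deriv_comp_neg', tendsto_map'_iff]
    have := h2.neg
    simp only [neg_zero] at this
    refine this.congr fun t => ?_
    simp
    abel
  · have := h4 (-t)
    rw [abs_neg] at this
    rw [norm_neg, smul_neg, ← neg_smul]
    exact this

theorem isFree_reverse_iff {v : Sp n} {z : ℝ → Sp n} :
    S.IsFree atTop v z ↔ S.rev.IsFree atBot (-v) fun t => z (-t) := by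
  refine ⟨fun h => by simpa using S.isFree_reverse h, fun h => ?_⟩
  have := S.rev.isFree_reverse h
  rw [rev_rev, map_neg_atBot] at this
  simpa using this

end Setting

end Trajectory

/-! ### Solutions for the long range force -/

section Free

variable {n : ℕ} {c α L N ρ : ℝ} {G : Sp n → Sp n → Sp n} {v x : Sp n}

theorem mem_tube_of_norm_sub_le {y : Sp n} {t : ℝ} (l : ℝ)
    (h : ‖y - (t • v + l • x)‖ ≤ (1 + ‖v‖ * |t|) / 8) : y ∈ tube v x t := ⟨l, h⟩

theorem ForceDecay.integrable_along (hG : ForceDecay G c (α + 1) L N) (hα : 0 < α) (hα1 : α ≤ 2)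
    (hL : 0 ≤ L) (hρ : ‖v‖ = ρ) (hρ0 : 0 < ρ) (hvx : inner ℝ v x = 0) {X w : ℝ → Sp n}
    (hX : Continuous X) (hw : Continuous w) {a : ℝ} (hXt : ∀ t ≤ a, X t ∈ tube v x t)
    (hwc : ∀ t, ‖w t‖ ≤ 2 * c) : IntegrableOn (fun τ => G (X τ) (w τ)) (Iic a) := by
  refine integrableOn_Iic_of_wt_bound (K₁ := 6 * L) (K₂ := 0) (hG.continuous_along hX hw) hρ0 hα hα
    fun τ hτ => ?_
  simpa using hG.tube_bound hL (by linarith) (by linarith) hρ hvx (hXt τ hτ) (hwc τ)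

theorem ForceDecay.norm_integral_along_le (hG : ForceDecay G c (α + 1) L N) (hα : 0 < α)
    (hα1 : α ≤ 2) (hL : 0 ≤ L) (hρ : ‖v‖ = ρ) (hρ0 : 0 < ρ) (hvx : inner ℝ v x = 0)
    {X w : ℝ → Sp n} {a : ℝ} (hXt : ∀ t ≤ a, X t ∈ tube v x t)
    (hwc : ∀ t, ‖w t‖ ≤ 2 * c) : ‖∫ τ in Iic a, G (X τ) (w τ)‖ ≤ 12 * L / (α * ρ) := by
  refine (norm_setIntegral_le (K₁ := 6 * L) (K₂ := 0) (Iic a) hρ0 (by positivity) le_rfl hα hα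
    measurableSet_Iic fun τ hτ => ?_).trans_eq (by ring)
  simpa using hG.tube_bound hL (by linarith) (by linarith) hρ hvx (hXt τ hτ) (hwc τ)

/-- Impulses within half the length of `ginv c v` of `ginv c v`. -/
theorem le_half_norm_ginv {K : ℝ} (hv : ‖v‖ < c)
    (hK : 2 * √(1 - ‖v‖ ^ 2 / c ^ 2) * K ≤ ‖v‖) : K ≤ ‖ginv c v‖ / 2 := by
  have hs := Real.sqrt_pos.2 (one_sub_sq_pos hv)
  rw [norm_ginv, div_div, le_div_iff₀ (by positivity)]
  linarith

/-- The map `w ↦ g(g⁻¹(v) + ∫_{-∞}^t G(z, w))`, where `z' = w` and `z(0) = 0`, halves the distance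
between velocities. -/
theorem free_velocity_contraction (hG : ForceDecay G c (α + 1) L N) (hα : 0 < α) (hα1 : α ≤ 1)
    (hL : 0 ≤ L) (hN : 0 ≤ N) (hρ : ‖v‖ = ρ) (hρ0 : 0 < ρ) (hρc : ρ < c)
    (hsL : 24 * √(1 - ρ ^ 2 / c ^ 2) * L ≤ α * ρ ^ 2)
    (hsN : 256 * √(1 - ρ ^ 2 / c ^ 2) * N ≤ α * ρ ^ 2)
    {z z' w w' : ℝ → Sp n} (hz : Continuous z) (hz' : Continuous z') (hw : Continuous w)
    (hw' : Continuous w') (hzt : ∀ t, z t ∈ tube v 0 t) (hzt' : ∀ t, z' t ∈ tube v 0 t)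
    (hwc : ∀ t, ‖w t‖ ≤ 2 * c) (hwc' : ∀ t, ‖w' t‖ ≤ 2 * c) {A : ℝ} (hA : 0 ≤ A)
    (hzz : ∀ t, ‖z t - z' t‖ ≤ A * |t|) (hww : ∀ t, ‖w t - w' t‖ ≤ A) (t : ℝ) :
    ‖gmap c (ginv c v + ∫ τ in Iic t, G (z τ) (w τ))
      - gmap c (ginv c v + ∫ τ in Iic t, G (z' τ) (w' τ))‖ ≤ A / 2 := by
  have hv : ‖v‖ < c := by rw [hρ]; exact hρc
  have hs := Real.sqrt_pos.2 (one_sub_sq_pos hv)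
  rw [hρ] at hs
  set s := √(1 - ρ ^ 2 / c ^ 2) with hsdef
  have h0 : inner ℝ v (0 : Sp n) = 0 := inner_zero_right _
  have hi := hG.integrable_along hα (by linarith) hL hρ hρ0 h0 hz hw (a := t)
    (fun t _ => hzt t) hwc
  have hi' := hG.integrable_along hα (by linarith) hL hρ hρ0 h0 hz' hw' (a := t)
    (fun t _ => hzt' t) hwc'
  have hnear : ‖ginv c v + (∫ τ in Iic t, G (z' τ) (w' τ)) - ginv c v‖ ≤ ‖ginv c v‖ / 2 := by
    rw [add_sub_cancel_left]
    refine (hG.norm_integral_along_le hα (by linarith) hL hρ hρ0 h0 (fun t _ => hzt' t)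
      hwc').trans (le_half_norm_ginv hv ?_)
    rw [hρ, ← hsdef, ← mul_div_assoc, div_le_iff₀ (by positivity)]
    linarith
  refine (norm_gmap_sub_le_of_near hv hnear).trans ?_
  rw [hρ, ← hsdef, add_sub_add_left_eq_sub, ← integral_sub hi hi']
  have hbd : ‖∫ τ in Iic t, (G (z τ) (w τ) - G (z' τ) (w' τ))‖ ≤ 16 * N * A / (α * ρ ^ 2) := by
    refine (norm_setIntegral_le (K₁ := 8 * N * A / ρ) (K₂ := 0) (Iic t) hρ0 (by positivity) le_rfl
      hα hα measurableSet_Iic fun τ _ => ?_).trans_eq (by field_simp; ring)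
    refine (hG.tube_lip hN (by linarith) hρ hρ0 hρc.le h0 (hzt τ) (hzt' τ) (hwc τ)
      (hwc' τ)).trans ?_
    have h1 := abs_mul_wt_le hρ0.le (α + 1) τ
    have h2 := wt_pos hρ0.le (α + 1) τ
    have h3 := wt_pos hρ0.le (α + 1 + 1) τ
    calc _ ≤ 6 * N * wt ρ (α + 1 + 1) τ * (A * |τ|) + 2 * N / ρ * wt ρ (α + 1) τ * A := by
          gcongr
          · exact hzz τ
          · exact hww τ
      _ = 6 * N * A / ρ * (ρ * |τ| * wt ρ (α + 1 + 1) τ) + 2 * N / ρ * wt ρ (α + 1) τ * A := by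
          field_simp
      _ ≤ 6 * N * A / ρ * wt ρ (α + 1) τ + 2 * N / ρ * wt ρ (α + 1) τ * A := by gcongr
      _ = _ := by ring
  calc 4 * s * _ ≤ 4 * s * (16 * N * A / (α * ρ ^ 2)) := by gcongr
    _ = (256 * s * N) * A / (4 * (α * ρ ^ 2)) := by field_simp; ring
    _ ≤ (α * ρ ^ 2) * A / (4 * (α * ρ ^ 2)) := by gcongr
    _ = A / 4 := by field_simp
    _ ≤ A / 2 := by linarith

theorem mem_tube_of_linear {y : Sp n} {t C : ℝ} (hρ : ‖v‖ = ρ) (hC : C ≤ ρ / 8)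
    (h : ‖y - t • v‖ ≤ C * |t|) : y ∈ tube v 0 t := by
  refine mem_tube_of_norm_sub_le 0 ?_
  simp only [smul_zero, add_zero]
  have := abs_nonneg t
  rw [hρ]
  nlinarith

/-- Existence and uniqueness of the trajectory through the origin with velocity `v` at `-∞`, among
those which stay in a linearly growing neighbourhood of the straight line. -/
theorem existsUnique_free (hG : ForceDecay G c (α + 1) L N) (hα : 0 < α) (hα1 : α ≤ 1)
    (hL : 0 ≤ L) (hN : 0 ≤ N) (hρ : ‖v‖ = ρ) (hρ0 : 0 < ρ) (hρc : ρ < c)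
    (hsN : 256 * √(1 - ρ ^ 2 / c ^ 2) * N ≤ α * ρ ^ 2) {C : ℝ}
    (hC : 24 * √(1 - ρ ^ 2 / c ^ 2) * L / (α * ρ) ≤ C) (hCρ : C ≤ ρ / 8) :
    ∃! z : ℝ → Sp n, IsTrajectory c G z ∧ Tendsto (fun t => deriv z t - v) atBot (𝓝 0) ∧
      z 0 = 0 ∧ ∀ t, ‖z t - t • v‖ ≤ C * |t| := by
  have hv : ‖v‖ < c := by rw [hρ]; exact hρc
  have hc : 0 < c := hρ0.trans hρc
  have hs := Real.sqrt_pos.2 (one_sub_sq_pos hv)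
  have h0 : inner ℝ v (0 : Sp n) = 0 := inner_zero_right _
  have hsL : 24 * √(1 - ρ ^ 2 / c ^ 2) * L ≤ α * ρ ^ 2 := by
    have := hC.trans hCρ
    rw [div_le_iff₀ (by positivity)] at this
    nlinarith [show 0 < α * ρ ^ 2 by positivity]
  have hC0 : 0 ≤ C := le_trans (by positivity) hC
  refine existsUnique_of_exists_of_unique ?_ ?_
  · -- the unknown is the deviation `u` of the velocity from `v`
    set zz : (ℝ → Sp n) → ℝ → Sp n := fun u t => t • v + ∫ τ in (0 : ℝ)..t, u τ with hzz
    have hzd : ∀ u, Continuous u → ∀ t, HasDerivAt (zz u) (v + u t) t := fun u hu t => by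
      have h1 : HasDerivAt (fun t : ℝ => t • v) v t := by
        simpa using (hasDerivAt_id t).smul_const v
      exact h1.add (intervalIntegral.integral_hasDerivAt_right (hu.intervalIntegrable _ _)
        (hu.stronglyMeasurableAtFilter _ _) hu.continuousAt)
    have hzc : ∀ u, Continuous u → Continuous (zz u) := fun u hu =>
      continuous_iff_continuousAt.2 fun t => (hzd u hu t).continuousAt
    have hzb : ∀ u, (∀ t, ‖u t‖ ≤ C) → ∀ t, ‖zz u t - t • v‖ ≤ C * |t| := fun u hu t => by
      have := intervalIntegral.norm_integral_le_of_norm_le_const (f := u) (a := 0) (b := t)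
        fun τ _ => hu τ
      simpa [hzz] using this
    have hzt : ∀ u, (∀ t, ‖u t‖ ≤ C) → ∀ t, zz u t ∈ tube v 0 t := fun u hu t =>
      mem_tube_of_linear hρ hCρ (hzb u hu t)
    have hwc : ∀ u : ℝ → Sp n, (∀ t, ‖u t‖ ≤ C) → ∀ t, ‖v + u t‖ ≤ 2 * c := fun u hu t => by
      have := norm_add_le v (u t)
      have := hu t
      linarith
    obtain ⟨u, huc, hub, hfix⟩ := exists_fixedPoint_weighted (φ := fun _ => 1) (m := fun _ => C)
      (B := C) continuous_const (fun _ => one_pos) (fun _ => hC0) (fun _ => by simp)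
      (fun u t => gmap c (ginv c v + ∫ τ in Iic t, G (zz u τ) (v + u τ)) - v)
      (fun u hu hub => by
        constructor
        · have hi := hG.integrable_along hα (by linarith) hL hρ hρ0 h0 (hzc u hu)
            (continuous_const.add hu) (a := 0) (fun t _ => hzt u hub t) (hwc u hub)
          refine (((contDiff_gmap c).continuous).comp (continuous_const.add ?_)).sub
            continuous_const
          exact continuous_iff_continuousAt.2 fun t => (hasDerivAt_integral_Iic
            (hG.continuous_along (hzc u hu) (continuous_const.add hu)) hi t).continuousAt
        · intro t
          refine (norm_gmap_sub_velocity_le hv _).trans (le_trans ?_ hC)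
          rw [add_sub_cancel_left, hρ]
          have := hG.norm_integral_along_le hα (by linarith) hL hρ hρ0 h0 (a := t)
            (fun t _ => hzt u hub t) (hwc u hub)
          calc _ ≤ 2 * √(1 - ρ ^ 2 / c ^ 2) * (12 * L / (α * ρ)) := by gcongr
            _ = _ := by ring)
      (fun u u' hu hub hu' hub' Δ hΔ hd t => by
        simp only [mul_one] at hd
        rw [sub_sub_sub_cancel_right, mul_one]
        refine free_velocity_contraction hG hα hα1 hL hN hρ hρ0 hρc hsL hsN (hzc u hu) (hzc u' hu')
          (continuous_const.add hu) (continuous_const.add hu') (hzt u hub) (hzt u' hub')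
          (hwc u hub) (hwc u' hub') hΔ (fun τ => ?_) (fun τ => by simpa using hd τ) t
        have h1 := intervalIntegral.norm_integral_le_of_norm_le_const (a := 0) (b := τ)
          (f := fun τ => u τ - u' τ) fun τ _ => hd τ
        rw [intervalIntegral.integral_sub (hu.intervalIntegrable _ _)
          (hu'.intervalIntegrable _ _), sub_zero] at h1
        simpa [hzz] using h1)
    have hi := hG.integrable_along hα (by linarith) hL hρ hρ0 h0 (hzc u huc)
      (continuous_const.add huc) (a := 0) (fun t _ => hzt u hub t) (hwc u hub)
    have hu : ∀ t, v + u t = gmap c (ginv c v + ∫ τ in Iic t, G (zz u τ) (v + u τ)) := fun t => by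
      conv_lhs => rw [← hfix]
      exact add_sub_cancel v _
    refine ⟨zz u, isTrajectory_of_integral_eq hc hG.cont (continuous_const.add huc) (hzd u huc) hi hu,
      ?_, by simp [hzz], hzb u hub⟩
    have h1 : ∀ t, deriv (zz u) t - v
        = gmap c (ginv c v + ∫ τ in Iic t, G (zz u τ) (v + u τ)) - v := fun t => by
      rw [(hzd u huc t).deriv, hu]
    simp only [h1]
    have h2 := (tendsto_integral_Iic_atBot fun τ => G (zz u τ) (v + u τ)).const_add (ginv c v)
    rw [add_zero] at h2
    have h3 := (((contDiff_gmap c).continuous.tendsto (ginv c v)).comp h2).sub_const v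
    rwa [gmap_ginv hv, sub_self] at h3
  · rintro z z' ⟨hz, hlim, hz0, hzb⟩ ⟨hz', hlim', hz0', hzb'⟩
    have hzt := fun t => mem_tube_of_linear hρ hCρ (hzb t)
    have hzt' := fun t => mem_tube_of_linear hρ hCρ (hzb' t)
    have hint : ∀ {z : ℝ → Sp n}, IsTrajectory c G z → (∀ t, z t ∈ tube v 0 t) →
        Tendsto (fun t => deriv z t - v) atBot (𝓝 0) → ∀ t,
        deriv z t = gmap c (ginv c v + ∫ τ in Iic t, G (z τ) (deriv z τ)) := by
      intro z hz hzt hlim t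
      rw [← hz.gmap_ginv_deriv t, hz.ginv_eq hv (tendsto_sub_nhds_zero_iff.1 hlim)
        (hG.integrable_along hα (by linarith) hL hρ hρ0 h0 hz.continuous hz.continuous_deriv
          (fun t _ => hzt t) hz.norm_deriv_le)]
    have hzz : ∀ A, (∀ t, ‖deriv z t - deriv z' t‖ ≤ A) → ∀ t, ‖z t - z' t‖ ≤ A * |t| := by
      intro A hA t
      have := convex_univ.norm_image_sub_le_of_norm_hasDerivWithin_le
        (f := fun t => z t - z' t) (fun τ _ => ((hz.hasDerivAt τ).sub
          (hz'.hasDerivAt τ)).hasDerivWithinAt) (fun τ _ => hA τ) (mem_univ 0) (mem_univ t)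
      simpa [hz0, hz0'] using this
    have hA := le_of_improving_bound (s := univ) (u := fun t => ‖deriv z t - deriv z' t‖)
      (ψ := fun _ => (1 : ℝ)) (A₀ := 0) (A₁ := 2 * c) le_rfl (by positivity)
      (fun _ _ => zero_le_one) (fun t _ => by
        have := norm_sub_le (deriv z t) (deriv z' t)
        have := hz.2.1 t
        have := hz'.2.1 t
        simp only [mul_one]
        linarith) (fun A hA hAb t _ => by
        simp only [mul_one, mem_univ, true_implies, zero_add] at hAb ⊢
        rw [hint hz hzt hlim, hint hz' hzt' hlim']
        exact free_velocity_contraction hG hα hα1 hL hN hρ hρ0 hρc hsL hsN hz.continuous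
          hz'.continuous hz.continuous_deriv hz'.continuous_deriv hzt hzt' hz.norm_deriv_le
          hz'.norm_deriv_le hA (hzz A hAb) hAb t)
    have h1 := hzz 0 fun t => by simpa using hA t (mem_univ t)
    funext t
    have := h1 t
    rw [zero_mul] at this
    exact sub_eq_zero.1 (norm_le_zero_iff.1 this)

end Free

/-! ### The high energy regime -/

/-- The assumptions on the forces, the velocity `v` and the impact parameter `x` under which the
scattering problem is a perturbation of the free motion. -/
structure Regime {n : ℕ} (Gl Gs : Sp n → Sp n → Sp n) (c α L N : ℝ) (v x : Sp n) : Prop where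
  long : ForceDecay Gl c (α + 1) L N
  short : ForceDecay Gs c (α + 2) L N
  α_pos : 0 < α
  α_le : α ≤ 1
  L_nonneg : 0 ≤ L
  L_le : L ≤ N
  v_pos : 0 < ‖v‖
  v_lt : ‖v‖ < c
  orth : inner ℝ v x = 0
  small : 1728 * (√(1 - ‖v‖ ^ 2 / c ^ 2) * N * (1 + ‖x‖)) ≤ α * ‖v‖ ^ 2

/-- The small parameter of the perturbation theory. -/
noncomputable def smallness {n : ℕ} (c α N : ℝ) (v x : Sp n) : ℝ :=
  √(1 - ‖v‖ ^ 2 / c ^ 2) * N * (1 + ‖x‖) / (α * ‖v‖ ^ 2)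

namespace Regime

variable {n : ℕ} {c α L N : ℝ} {Gl Gs : Sp n → Sp n → Sp n} {v x : Sp n}

theorem c_pos (R : Regime Gl Gs c α L N v x) : 0 < c := R.v_pos.trans R.v_lt

theorem N_nonneg (R : Regime Gl Gs c α L N v x) : 0 ≤ N := R.L_nonneg.trans R.L_le

theorem s_pos (R : Regime Gl Gs c α L N v x) : 0 < √(1 - ‖v‖ ^ 2 / c ^ 2) :=
  Real.sqrt_pos.2 (one_sub_sq_pos R.v_lt)

theorem eps_nonneg (R : Regime Gl Gs c α L N v x) : 0 ≤ smallness c α N v x := by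
  have := R.N_nonneg
  have := R.α_pos
  unfold smallness
  positivity

theorem eps_le (R : Regime Gl Gs c α L N v x) : smallness c α N v x ≤ 1 / 1728 := by
  have := R.α_pos
  have := R.v_pos
  rw [smallness, div_le_div_iff₀ (by positivity) (by norm_num)]
  linarith [R.small]

theorem eps_mul (R : Regime Gl Gs c α L N v x) :
    √(1 - ‖v‖ ^ 2 / c ^ 2) * N * (1 + ‖x‖) = smallness c α N v x * (α * ‖v‖ ^ 2) := by
  have := R.α_pos
  have := R.v_pos
  rw [smallness, div_mul_cancel₀ _ (by positivity)]

theorem sN_le (R : Regime Gl Gs c α L N v x) :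
    √(1 - ‖v‖ ^ 2 / c ^ 2) * N ≤ smallness c α N v x * (α * ‖v‖ ^ 2) := by
  rw [← R.eps_mul]
  have := R.s_pos
  have := R.N_nonneg
  have h : 0 ≤ √(1 - ‖v‖ ^ 2 / c ^ 2) * N := by positivity
  nlinarith [norm_nonneg x]

theorem continuous_force (R : Regime Gl Gs c α L N v x) :
    Continuous fun q : Sp n × Sp n => Gl q.1 q.2 + Gs q.1 q.2 := R.long.cont.add R.short.cont

theorem norm_long_le (R : Regime Gl Gs c α L N v x) {y w : Sp n} {t : ℝ} (hy : y ∈ tube v x t)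
    (hw : ‖w‖ ≤ 2 * c) : ‖Gl y w‖ ≤ 6 * L * wt ‖v‖ (α + 1) t :=
  R.long.tube_bound R.L_nonneg (by linarith [R.α_pos]) (by linarith [R.α_le]) rfl R.orth hy hw

theorem norm_short_le (R : Regime Gl Gs c α L N v x) {y w : Sp n} {t : ℝ} (hy : y ∈ tube v x t)
    (hw : ‖w‖ ≤ 2 * c) : ‖Gs y w‖ ≤ 6 * L * wt ‖v‖ (α + 1 + 1) t := by
  have := R.short.tube_bound R.L_nonneg (by linarith [R.α_pos]) (by linarith [R.α_le]) rfl R.orth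
    hy hw
  rwa [show α + 2 = α + 1 + 1 by ring] at this

theorem norm_force_le (R : Regime Gl Gs c α L N v x) {y w : Sp n} {t : ℝ} (hy : y ∈ tube v x t)
    (hw : ‖w‖ ≤ 2 * c) : ‖Gl y w + Gs y w‖ ≤ 12 * L * wt ‖v‖ (α + 1) t := by
  refine (norm_add_le _ _).trans ((add_le_add (R.norm_long_le hy hw) (R.norm_short_le hy hw)).trans ?_)
  have := wt_le_wt R.v_pos.le (show α + 1 ≤ α + 1 + 1 by linarith) t
  have := R.L_nonneg
  nlinarith

theorem norm_long_sub_le (R : Regime Gl Gs c α L N v x) {y y' w w' : Sp n} {t : ℝ}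
    (hy : y ∈ tube v x t) (hy' : y' ∈ tube v x t) (hw : ‖w‖ ≤ 2 * c) (hw' : ‖w'‖ ≤ 2 * c) :
    ‖Gl y w - Gl y' w'‖ ≤ 6 * N * wt ‖v‖ (α + 1 + 1) t * ‖y - y'‖
      + 2 * N / ‖v‖ * wt ‖v‖ (α + 1) t * ‖w - w'‖ :=
  R.long.tube_lip R.N_nonneg (by linarith [R.α_le]) rfl R.v_pos R.v_lt.le R.orth hy hy' hw hw'

theorem norm_short_sub_le (R : Regime Gl Gs c α L N v x) {y y' w w' : Sp n} {t : ℝ}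
    (hy : y ∈ tube v x t) (hy' : y' ∈ tube v x t) (hw : ‖w‖ ≤ 2 * c) (hw' : ‖w'‖ ≤ 2 * c) :
    ‖Gs y w - Gs y' w'‖ ≤ 6 * N * wt ‖v‖ (α + 1 + 1 + 1) t * ‖y - y'‖
      + 2 * N / ‖v‖ * wt ‖v‖ (α + 1 + 1) t * ‖w - w'‖ := by
  have := R.short.tube_lip R.N_nonneg (by linarith [R.α_le]) rfl R.v_pos R.v_lt.le R.orth hy hy'
    hw hw'
  rwa [show α + 2 = α + 1 + 1 by ring] at this

theorem norm_force_sub_le (R : Regime Gl Gs c α L N v x) {y y' w w' : Sp n} {t : ℝ}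
    (hy : y ∈ tube v x t) (hy' : y' ∈ tube v x t) (hw : ‖w‖ ≤ 2 * c) (hw' : ‖w'‖ ≤ 2 * c) :
    ‖(Gl y w + Gs y w) - (Gl y' w' + Gs y' w')‖ ≤ 12 * N * wt ‖v‖ (α + 1 + 1) t * ‖y - y'‖
      + 4 * N / ‖v‖ * wt ‖v‖ (α + 1) t * ‖w - w'‖ := by
  rw [add_sub_add_comm]
  refine (norm_add_le _ _).trans ((add_le_add (R.norm_long_sub_le hy hy' hw hw')
    (R.norm_short_sub_le hy hy' hw hw')).trans ?_)
  have h1 := wt_le_wt R.v_pos.le (show α + 1 ≤ α + 1 + 1 by linarith) t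
  have h2 := wt_le_wt R.v_pos.le (show α + 1 + 1 ≤ α + 1 + 1 + 1 by linarith) t
  have := R.N_nonneg
  have := R.v_pos
  calc _ ≤ 6 * N * wt ‖v‖ (α + 1 + 1) t * ‖y - y'‖ + 2 * N / ‖v‖ * wt ‖v‖ (α + 1) t * ‖w - w'‖
        + (6 * N * wt ‖v‖ (α + 1 + 1) t * ‖y - y'‖
          + 2 * N / ‖v‖ * wt ‖v‖ (α + 1) t * ‖w - w'‖) := by gcongr
    _ = _ := by ring

/-- The force along a perturbed trajectory against the long range force along the free one. -/
theorem norm_force_sub_long_le (R : Regime Gl Gs c α L N v x) {y z d w u : Sp n} {t : ℝ}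
    (hy : y ∈ tube v x t) (hz : z ∈ tube v x t) (hd : y = z + x + d) (hw : ‖w‖ ≤ 2 * c)
    (hu : ‖u‖ ≤ 2 * c) :
    ‖(Gl y w + Gs y w) - Gl z u‖ ≤ 6 * N * (1 + ‖x‖ + ‖d‖) * wt ‖v‖ (α + 1 + 1) t
      + 2 * N / ‖v‖ * wt ‖v‖ (α + 1) t * ‖w - u‖ := by
  have h1 := R.norm_long_sub_le hy hz hw hu
  have h2 := R.norm_short_le hy hw
  have h3 : ‖y - z‖ ≤ ‖x‖ + ‖d‖ := by
    rw [hd, show z + x + d - z = x + d by abel]; exact norm_add_le _ _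
  have h4 := wt_pos R.v_pos.le (α + 1 + 1) t
  have := R.N_nonneg
  rw [add_sub_right_comm]
  calc _ ≤ ‖Gl y w - Gl z u‖ + ‖Gs y w‖ := norm_add_le _ _
    _ ≤ (6 * N * wt ‖v‖ (α + 1 + 1) t * (‖x‖ + ‖d‖) + 2 * N / ‖v‖ * wt ‖v‖ (α + 1) t * ‖w - u‖)
        + 6 * N * wt ‖v‖ (α + 1 + 1) t := by
        refine add_le_add (h1.trans ?_) (h2.trans ?_)
        · gcongr
        · have := R.L_le
          gcongr
    _ = _ := by ring

section Curves

variable {X w : ℝ → Sp n} {a : ℝ}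

theorem integrable_long (R : Regime Gl Gs c α L N v x) (hX : Continuous X) (hw : Continuous w)
    (hXt : ∀ t ≤ a, X t ∈ tube v x t) (hwc : ∀ t, ‖w t‖ ≤ 2 * c) :
    IntegrableOn (fun τ => Gl (X τ) (w τ)) (Iic a) :=
  R.long.integrable_along R.α_pos (by linarith [R.α_le]) R.L_nonneg rfl R.v_pos R.orth hX hw hXt hwc

theorem norm_integral_long_le (R : Regime Gl Gs c α L N v x)
    (hXt : ∀ t ≤ a, X t ∈ tube v x t) (hwc : ∀ t, ‖w t‖ ≤ 2 * c) :
    ‖∫ τ in Iic a, Gl (X τ) (w τ)‖ ≤ 12 * L / (α * ‖v‖) :=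
  R.long.norm_integral_along_le R.α_pos (by linarith [R.α_le]) R.L_nonneg rfl R.v_pos R.orth hXt hwc

theorem integrable_force (R : Regime Gl Gs c α L N v x) (hX : Continuous X) (hw : Continuous w)
    (hXt : ∀ t ≤ a, X t ∈ tube v x t) (hwc : ∀ t, ‖w t‖ ≤ 2 * c) :
    IntegrableOn (fun τ => Gl (X τ) (w τ) + Gs (X τ) (w τ)) (Iic a) := by
  refine integrableOn_Iic_of_wt_bound (K₁ := 12 * L) (K₂ := 0)
    (R.continuous_force.comp (hX.prodMk hw)) R.v_pos R.α_pos R.α_pos fun τ hτ => ?_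
  simpa using R.norm_force_le (hXt τ hτ) (hwc τ)

theorem norm_integral_force_le (R : Regime Gl Gs c α L N v x)
    (hXt : ∀ t ≤ a, X t ∈ tube v x t) (hwc : ∀ t, ‖w t‖ ≤ 2 * c) :
    ‖∫ τ in Iic a, (Gl (X τ) (w τ) + Gs (X τ) (w τ))‖ ≤ 24 * L / (α * ‖v‖) := by
  have := R.L_nonneg
  refine (norm_setIntegral_le (K₁ := 12 * L) (K₂ := 0) (Iic a) R.v_pos (by positivity) le_rfl
    R.α_pos R.α_pos measurableSet_Iic fun τ hτ => ?_).trans_eq (by ring)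
  simpa using R.norm_force_le (hXt τ hτ) (hwc τ)

end Curves

/-- Impulses which differ from that of `v` by forces acting along curves in the tube. The bound on `k`
is chosen so that `2 k ≤ 1728`, the reciprocal of the bound on the smallness parameter. -/
theorem near (R : Regime Gl Gs c α L N v x) {P : Sp n} {k : ℝ} (hk : k ≤ 800)
    (h : ‖P - ginv c v‖ ≤ k * L / (α * ‖v‖)) : ‖P - ginv c v‖ ≤ ‖ginv c v‖ / 2 := by
  refine h.trans (le_half_norm_ginv R.v_lt ?_)
  have := R.α_pos
  have := R.v_pos
  have h1 := R.sN_le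
  have h2 := R.eps_le
  have h3 := R.s_pos
  have h4 := R.L_le
  have h5 := R.L_nonneg
  rw [← mul_div_assoc, div_le_iff₀ (by positivity)]
  calc 2 * √(1 - ‖v‖ ^ 2 / c ^ 2) * (k * L) ≤ 2 * √(1 - ‖v‖ ^ 2 / c ^ 2) * (800 * N) := by gcongr
    _ = 1600 * (√(1 - ‖v‖ ^ 2 / c ^ 2) * N) := by ring
    _ ≤ 1600 * (1 / 1728 * (α * ‖v‖ ^ 2)) := by
        refine mul_le_mul_of_nonneg_left (h1.trans ?_) (by norm_num)
        gcongr
    _ ≤ ‖v‖ * (α * ‖v‖) := by nlinarith [show 0 < α * ‖v‖ ^ 2 by positivity]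

theorem norm_gmap_sub_le (R : Regime Gl Gs c α L N v x) {P Q : Sp n} {k : ℝ}
    (hk : k ≤ 800) (h : ‖Q - ginv c v‖ ≤ k * L / (α * ‖v‖)) :
    ‖gmap c P - gmap c Q‖ ≤ 4 * √(1 - ‖v‖ ^ 2 / c ^ 2) * ‖P - Q‖ :=
  norm_gmap_sub_le_of_near R.v_lt (R.near hk h)

end Regime

/-! ### Trajectories with given incoming data -/

namespace Regime

variable {n : ℕ} {c α L N : ℝ} {Gl Gs : Sp n → Sp n → Sp n} {v x : Sp n}

theorem sN_mul_le (R : Regime Gl Gs c α L N v x) {A : ℝ} (hA : 0 ≤ A) :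
    √(1 - ‖v‖ ^ 2 / c ^ 2) * N * A / (α * ‖v‖ ^ 2) ≤ smallness c α N v x * A := by
  have := R.α_pos
  have := R.v_pos
  rw [div_le_iff₀ (by positivity)]
  calc _ ≤ smallness c α N v x * (α * ‖v‖ ^ 2) * A := mul_le_mul_of_nonneg_right R.sN_le hA
    _ = _ := by ring

section Existence

variable {z : ℝ → Sp n}

/-- The perturbed curve `z + x + ∫_{-∞}^t w`. -/
noncomputable def perturbed (z : ℝ → Sp n) (x : Sp n) (w : ℝ → Sp n) (t : ℝ) : Sp n :=
  z t + x + ∫ τ in Iic t, w τ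

/-- The bound for the perturbation of the velocity: integrable at `-∞`, with a small integral. Since
`gmap` is `4 √(1 - |v|²/c²)`-Lipschitz near the impulse of `v`, an effective force of size
`7 N (1 + |x|) wt ‖v‖ (α + 2)` gives the constant `28 = 4 * 7` before time `0` and twice this value
afterwards, where `60 ≥ 56 + 3840 / 1728` leaves room for the linear growth of the displacement. -/
noncomputable def velocityBound (c α N : ℝ) (v x : Sp n) (t : ℝ) : ℝ :=
  if t ≤ 0 then 28 * smallness c α N v x * α * ‖v‖ * wt ‖v‖ (α + 1) t
  else 60 * smallness c α N v x * ‖v‖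

theorem velocityBound_nonneg (R : Regime Gl Gs c α L N v x) (t : ℝ) :
    0 ≤ velocityBound c α N v x t := by
  have := R.eps_nonneg
  have := R.α_pos
  have := wt_pos R.v_pos.le (α + 1) t
  unfold velocityBound
  split_ifs <;> positivity

theorem velocityBound_le (R : Regime Gl Gs c α L N v x) (t : ℝ) :
    velocityBound c α N v x t
      ≤ 60 * smallness c α N v x * ‖v‖ * wt ‖v‖ (α + 1) (min t 0) := by
  have := R.eps_nonneg
  have := R.α_pos
  have := R.α_le
  have := wt_pos R.v_pos.le (α + 1) t
  unfold velocityBound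
  split_ifs with h
  · rw [min_eq_left h]
    gcongr ?_ * _
    have : 0 ≤ smallness c α N v x * ‖v‖ := by positivity
    nlinarith
  · rw [min_eq_right (by linarith)]
    simp [wt]

theorem velocityBound_le_const (R : Regime Gl Gs c α L N v x) (t : ℝ) :
    velocityBound c α N v x t ≤ 60 * smallness c α N v x * ‖v‖ := by
  have := R.eps_nonneg
  have h := wt_le_one R.v_pos.le (show 0 ≤ α + 1 by linarith [R.α_pos]) (min t 0)
  refine (R.velocityBound_le t).trans (mul_le_of_le_one_right (by positivity) h)

variable {w : ℝ → Sp n}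

theorem integrable_of_velocityBound (R : Regime Gl Gs c α L N v x) (hw : Continuous w)
    (hb : ∀ t, ‖w t‖ ≤ velocityBound c α N v x t) : IntegrableOn w (Iic 0) := by
  refine integrableOn_Iic_of_wt_bound (K₁ := 28 * smallness c α N v x * α * ‖v‖) (K₂ := 0)
    hw R.v_pos R.α_pos R.α_pos fun τ hτ => ?_
  have := hb τ
  rw [velocityBound, if_pos hτ] at this
  simpa using this

theorem norm_integral_velocity_le_of_nonpos (R : Regime Gl Gs c α L N v x)
    (hb : ∀ t, ‖w t‖ ≤ velocityBound c α N v x t) {t : ℝ} (ht : t ≤ 0) :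
    ‖∫ τ in Iic t, w τ‖ ≤ 28 * smallness c α N v x := by
  have hα := R.α_pos
  have hv := R.v_pos
  have h := norm_integral_Iic_le (f := w) (K₁ := 28 * smallness c α N v x * α * ‖v‖) (K₂ := 0)
    R.v_pos R.α_pos R.α_pos ht fun τ hτ => by
      have := hb τ
      rw [velocityBound, if_pos (hτ.trans ht)] at this
      simpa using this
  refine h.trans ?_
  have h1 := wt_le_one hv.le hα.le t
  have := R.eps_nonneg
  rw [zero_div, zero_mul, add_zero,
    show 28 * smallness c α N v x * α * ‖v‖ / (α * ‖v‖) = 28 * smallness c α N v x by field_simp]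
  exact mul_le_of_le_one_right (by positivity) h1

theorem norm_integral_velocity_le (R : Regime Gl Gs c α L N v x) (hw : Continuous w)
    (hb : ∀ t, ‖w t‖ ≤ velocityBound c α N v x t) (t : ℝ) :
    ‖∫ τ in Iic t, w τ‖ ≤ 28 * smallness c α N v x + 60 * smallness c α N v x * ‖v‖ * |t| := by
  have := R.eps_nonneg
  have hv := R.v_pos
  rcases le_total t 0 with ht | ht
  · have := R.norm_integral_velocity_le_of_nonpos hb ht
    have : 0 ≤ 60 * smallness c α N v x * ‖v‖ * |t| := by positivity
    linarith
  · have h0 := R.norm_integral_velocity_le_of_nonpos hb (le_refl 0)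
    have hi := R.integrable_of_velocityBound hw hb
    have h1 := intervalIntegral.integral_Iic_sub_Iic hi (integrableOn_Iic_of_continuous hw hi t)
    rw [sub_eq_iff_eq_add] at h1
    rw [h1, add_comm]
    have h2 := intervalIntegral.norm_integral_le_of_norm_le_const (f := w) (a := 0) (b := t)
        fun τ _ => (hb τ).trans (R.velocityBound_le_const τ)
    rw [sub_zero] at h2
    exact (norm_add_le _ _).trans (add_le_add h0 h2)

theorem hasDerivAt_perturbed (R : Regime Gl Gs c α L N v x) (hz : IsTrajectory c Gl z)
    (hw : Continuous w) (hb : ∀ t, ‖w t‖ ≤ velocityBound c α N v x t) (t : ℝ) :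
    HasDerivAt (perturbed z x w) (deriv z t + w t) t :=
  ((hz.hasDerivAt t).add_const x).add
    (hasDerivAt_integral_Iic hw (R.integrable_of_velocityBound hw hb) t)

theorem continuous_perturbed (R : Regime Gl Gs c α L N v x) (hz : IsTrajectory c Gl z)
    (hw : Continuous w) (hb : ∀ t, ‖w t‖ ≤ velocityBound c α N v x t) :
    Continuous (perturbed z x w) :=
  continuous_iff_continuousAt.2 fun t => (R.hasDerivAt_perturbed hz hw hb t).continuousAt

theorem free_mem_tube (hzb : ∀ t, ‖z t - t • v‖ ≤ ‖v‖ / 16 * |t|) (t : ℝ) : z t ∈ tube v x t := by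
  refine mem_tube_of_norm_sub_le 0 ?_
  have := hzb t
  have : 0 ≤ ‖v‖ * |t| := by positivity
  simp only [zero_smul, add_zero]
  linarith

theorem perturbed_mem_tube (R : Regime Gl Gs c α L N v x)
    (hzb : ∀ t, ‖z t - t • v‖ ≤ ‖v‖ / 16 * |t|) (hw : Continuous w)
    (hb : ∀ t, ‖w t‖ ≤ velocityBound c α N v x t) (t : ℝ) : perturbed z x w t ∈ tube v x t := by
  refine mem_tube_of_norm_sub_le 1 ?_
  have h1 := hzb t
  have h2 := R.norm_integral_velocity_le hw hb t
  have h3 := R.eps_le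
  have h4 : 0 ≤ ‖v‖ * |t| := by positivity
  rw [show perturbed z x w t - (t • v + (1 : ℝ) • x) = (z t - t • v) + ∫ τ in Iic t, w τ by
    rw [perturbed, one_smul]; abel]
  refine (norm_add_le _ _).trans ?_
  nlinarith

theorem norm_perturbed_velocity_le (R : Regime Gl Gs c α L N v x) (hz : IsTrajectory c Gl z)
    (hb : ∀ t, ‖w t‖ ≤ velocityBound c α N v x t) (t : ℝ) : ‖deriv z t + w t‖ ≤ 2 * c := by
  have h1 := norm_add_le (deriv z t) (w t)
  have h2 := hz.2.1 t
  have h3 := (hb t).trans (R.velocityBound_le_const t)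
  have h4 := R.eps_le
  have h5 := R.v_lt
  have h6 := R.v_pos
  nlinarith

/-- The impulse of the free trajectory is close to the one at `-∞`. -/
theorem norm_ginv_free_sub_le (R : Regime Gl Gs c α L N v x) (hz : IsTrajectory c Gl z)
    (hlim : Tendsto (deriv z) atBot (𝓝 v)) (hzt : ∀ t, z t ∈ tube v x t) (t : ℝ) :
    ‖ginv c (deriv z t) - ginv c v‖ ≤ 12 * L / (α * ‖v‖) := by
  rw [hz.ginv_eq R.v_lt hlim (R.integrable_long hz.continuous hz.continuous_deriv
    (fun t _ => hzt t) hz.norm_deriv_le), add_sub_cancel_left]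
  exact R.norm_integral_long_le (fun t _ => hzt t) hz.norm_deriv_le

/-- The map whose fixed point is the perturbation of the velocity maps the class of curves bounded
by `velocityBound` to itself. -/
theorem norm_velocity_map_le (R : Regime Gl Gs c α L N v x) (hz : IsTrajectory c Gl z)
    (hlim : Tendsto (deriv z) atBot (𝓝 v)) (hzb : ∀ t, ‖z t - t • v‖ ≤ ‖v‖ / 16 * |t|)
    (hw : Continuous w) (hb : ∀ t, ‖w t‖ ≤ velocityBound c α N v x t) (t : ℝ) :
    ‖gmap c (ginv c v + ∫ τ in Iic t, (Gl (perturbed z x w τ) (deriv z τ + w τ)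
      + Gs (perturbed z x w τ) (deriv z τ + w τ))) - deriv z t‖ ≤ velocityBound c α N v x t := by
  have hα := R.α_pos
  have hα1 := R.α_le
  have hv := R.v_pos
  have hN := R.N_nonneg
  have hs := R.s_pos
  have hε := R.eps_nonneg
  have hε1 := R.eps_le
  have hzt := free_mem_tube (x := x) hzb
  have hXt := R.perturbed_mem_tube hzb hw hb
  have hwc := R.norm_perturbed_velocity_le hz hb
  have hXc := R.continuous_perturbed hz hw hb
  have hwc' : Continuous fun t => deriv z t + w t := hz.continuous_deriv.add hw
  have hi := R.integrable_force hXc hwc' (a := t) (fun t _ => hXt t) hwc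
  have hi' := R.integrable_long hz.continuous hz.continuous_deriv (a := t)
    (fun t _ => hzt t) hz.norm_deriv_le
  have hq := hz.ginv_eq R.v_lt hlim hi'
  have h1 : ∀ τ, ‖(Gl (perturbed z x w τ) (deriv z τ + w τ)
      + Gs (perturbed z x w τ) (deriv z τ + w τ)) - Gl (z τ) (deriv z τ)‖
      ≤ 6 * N * (1 + ‖x‖ + ‖∫ τ in Iic τ, w τ‖) * wt ‖v‖ (α + 1 + 1) τ
        + 2 * N / ‖v‖ * wt ‖v‖ (α + 1) τ * ‖w τ‖ := fun τ => by
    have := R.norm_force_sub_long_le (hXt τ) (hzt τ) rfl (hwc τ) (hz.norm_deriv_le τ)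
    rwa [add_sub_cancel_left] at this
  have h2 : ‖gmap c (ginv c v + ∫ τ in Iic t, (Gl (perturbed z x w τ) (deriv z τ + w τ)
      + Gs (perturbed z x w τ) (deriv z τ + w τ))) - deriv z t‖
      ≤ 4 * √(1 - ‖v‖ ^ 2 / c ^ 2) * ‖∫ τ in Iic t, ((Gl (perturbed z x w τ) (deriv z τ + w τ)
      + Gs (perturbed z x w τ) (deriv z τ + w τ)) - Gl (z τ) (deriv z τ))‖ := by
    rw [← hz.gmap_ginv_deriv t]
    refine (R.norm_gmap_sub_le (k := 12) (by norm_num)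
      (R.norm_ginv_free_sub_le hz hlim hzt t)).trans_eq ?_
    rw [hq, add_sub_add_left_eq_sub, integral_sub hi hi']
  refine h2.trans ?_
  have hx := norm_nonneg x
  have hεN : 0 ≤ smallness c α N v x * N := by positivity
  have hNx : N ≤ N * (1 + ‖x‖) := by nlinarith
  rw [velocityBound]
  split_ifs with ht
  · have h3 : ‖∫ τ in Iic t, ((Gl (perturbed z x w τ) (deriv z τ + w τ)
      + Gs (perturbed z x w τ) (deriv z τ + w τ)) - Gl (z τ) (deriv z τ))‖
        ≤ 7 * N * (1 + ‖x‖) / ((α + 1) * ‖v‖) * wt ‖v‖ (α + 1) t := by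
      have := norm_integral_Iic_le (K₁ := 7 * N * (1 + ‖x‖)) (K₂ := 0) (b₁ := α + 1) (b₂ := 1)
        (ρ := ‖v‖) (t := t) hv (by linarith) one_pos ht (f := fun τ =>
        ((Gl (perturbed z x w τ) (deriv z τ + w τ)
      + Gs (perturbed z x w τ) (deriv z τ + w τ)) - Gl (z τ) (deriv z τ))) fun τ hτ => ?_
      · simpa using this
      refine (h1 τ).trans ?_
      have a1 := R.norm_integral_velocity_le_of_nonpos hb (hτ.trans ht)
      have a2 := hb τ
      rw [velocityBound, if_pos (hτ.trans ht)] at a2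
      have w1 := wt_pos hv.le (α + 1) τ
      have w2 := wt_pos hv.le (α + 1 + 1) τ
      have a3 : wt ‖v‖ (α + 1) τ * wt ‖v‖ (α + 1) τ ≤ wt ‖v‖ (α + 1 + 1) τ := by
        rw [← wt_add hv.le]; exact wt_le_wt hv.le (by linarith) τ
      calc _ ≤ 6 * N * (1 + ‖x‖ + 28 * smallness c α N v x) * wt ‖v‖ (α + 1 + 1) τ
            + 2 * N / ‖v‖ * wt ‖v‖ (α + 1) τ
              * (28 * smallness c α N v x * α * ‖v‖ * wt ‖v‖ (α + 1) τ) := by gcongr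
        _ = 6 * N * (1 + ‖x‖ + 28 * smallness c α N v x) * wt ‖v‖ (α + 1 + 1) τ
            + 56 * (smallness c α N v x * N) * α * (wt ‖v‖ (α + 1) τ * wt ‖v‖ (α + 1) τ) := by
            field_simp; ring
        _ ≤ 6 * N * (1 + ‖x‖ + 28 * smallness c α N v x) * wt ‖v‖ (α + 1 + 1) τ
            + 56 * (smallness c α N v x * N) * 1 * wt ‖v‖ (α + 1 + 1) τ := by gcongr
        _ = (6 * (N * (1 + ‖x‖)) + 224 * (smallness c α N v x * N)) * wt ‖v‖ (α + 1 + 1) τ := by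
            ring
        _ ≤ (7 * (N * (1 + ‖x‖))) * wt ‖v‖ (α + 1 + 1) τ := by
            gcongr
            nlinarith
        _ = _ := by ring
    have w1 := wt_pos hv.le (α + 1) t
    calc _ ≤ 4 * √(1 - ‖v‖ ^ 2 / c ^ 2)
          * (7 * N * (1 + ‖x‖) / ((α + 1) * ‖v‖) * wt ‖v‖ (α + 1) t) := by gcongr
      _ = 28 * (√(1 - ‖v‖ ^ 2 / c ^ 2) * N * (1 + ‖x‖)) / ((α + 1) * ‖v‖) * wt ‖v‖ (α + 1) t := by
          ring
      _ = 28 * smallness c α N v x * α * ‖v‖ / (α + 1) * wt ‖v‖ (α + 1) t := by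
          rw [R.eps_mul]; field_simp
      _ ≤ _ := by
          gcongr
          exact div_le_self (by positivity) (by linarith)
  · have h3 : ‖∫ τ in Iic t, ((Gl (perturbed z x w τ) (deriv z τ + w τ)
      + Gs (perturbed z x w τ) (deriv z τ + w τ)) - Gl (z τ) (deriv z τ))‖
        ≤ 2 * (7 * N * (1 + ‖x‖)) / ((α + 1) * ‖v‖)
          + 2 * (480 * N * smallness c α N v x) / (α * ‖v‖) := by
      refine norm_setIntegral_le (b₁ := α + 1) (b₂ := α) (Iic t) hv (by positivity)
        (by positivity) (by linarith) hα measurableSet_Iic fun τ _ => ?_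
      refine (h1 τ).trans ?_
      have a1 := R.norm_integral_velocity_le hw hb τ
      have a2 := (hb τ).trans (R.velocityBound_le_const τ)
      have w1 := wt_pos hv.le (α + 1) τ
      have w2 := wt_pos hv.le (α + 1 + 1) τ
      have a3 := abs_mul_wt_le hv.le (α + 1) τ
      calc _ ≤ 6 * N * (1 + ‖x‖ + (28 * smallness c α N v x
              + 60 * smallness c α N v x * ‖v‖ * |τ|)) * wt ‖v‖ (α + 1 + 1) τ
            + 2 * N / ‖v‖ * wt ‖v‖ (α + 1) τ * (60 * smallness c α N v x * ‖v‖) := by gcongr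
        _ = (6 * (N * (1 + ‖x‖)) + 168 * (smallness c α N v x * N)) * wt ‖v‖ (α + 1 + 1) τ
            + 360 * (smallness c α N v x * N) * (‖v‖ * |τ| * wt ‖v‖ (α + 1 + 1) τ)
            + 120 * (smallness c α N v x * N) * wt ‖v‖ (α + 1) τ := by
            field_simp; ring
        _ ≤ (7 * (N * (1 + ‖x‖))) * wt ‖v‖ (α + 1 + 1) τ
            + 360 * (smallness c α N v x * N) * wt ‖v‖ (α + 1) τ
            + 120 * (smallness c α N v x * N) * wt ‖v‖ (α + 1) τ := by
            gcongr
            nlinarith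
        _ = _ := by ring
    have h5 := R.sN_mul_le hε
    calc _ ≤ 4 * √(1 - ‖v‖ ^ 2 / c ^ 2) * (2 * (7 * N * (1 + ‖x‖)) / ((α + 1) * ‖v‖)
          + 2 * (480 * N * smallness c α N v x) / (α * ‖v‖)) := by gcongr
      _ = 56 * (√(1 - ‖v‖ ^ 2 / c ^ 2) * N * (1 + ‖x‖)) / ((α + 1) * ‖v‖)
          + 3840 * ‖v‖ * (√(1 - ‖v‖ ^ 2 / c ^ 2) * N * smallness c α N v x / (α * ‖v‖ ^ 2)) := by
          field_simp; ring
      _ = 56 * smallness c α N v x * ‖v‖ * (α / (α + 1))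
          + 3840 * ‖v‖ * (√(1 - ‖v‖ ^ 2 / c ^ 2) * N * smallness c α N v x / (α * ‖v‖ ^ 2)) := by
          rw [R.eps_mul]; field_simp
      _ ≤ 56 * smallness c α N v x * ‖v‖ * 1
          + 3840 * ‖v‖ * (smallness c α N v x * (1 / 1728)) := by
          gcongr
          · rw [div_le_one (by linarith)]; linarith
          · exact h5.trans (by gcongr)
      _ ≤ _ := by nlinarith [mul_nonneg hε hv.le]

/-- The map whose fixed point is the perturbation of the velocity is a contraction. -/
theorem velocity_map_contraction (R : Regime Gl Gs c α L N v x) (hz : IsTrajectory c Gl z)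
    (hzb : ∀ t, ‖z t - t • v‖ ≤ ‖v‖ / 16 * |t|) {w' : ℝ → Sp n}
    (hw : Continuous w) (hb : ∀ t, ‖w t‖ ≤ velocityBound c α N v x t) (hw' : Continuous w')
    (hb' : ∀ t, ‖w' t‖ ≤ velocityBound c α N v x t) {Δ : ℝ} (hΔ : 0 ≤ Δ)
    (hd : ∀ t, ‖w t - w' t‖ ≤ Δ * wt ‖v‖ (α + 1) (min t 0)) (t : ℝ) :
    ‖gmap c (ginv c v + ∫ τ in Iic t, (Gl (perturbed z x w τ) (deriv z τ + w τ)
        + Gs (perturbed z x w τ) (deriv z τ + w τ)))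
      - gmap c (ginv c v + ∫ τ in Iic t, (Gl (perturbed z x w' τ) (deriv z τ + w' τ)
        + Gs (perturbed z x w' τ) (deriv z τ + w' τ)))‖
      ≤ Δ / 2 * wt ‖v‖ (α + 1) (min t 0) := by
  have hα := R.α_pos
  have hα1 := R.α_le
  have hv := R.v_pos
  have hN := R.N_nonneg
  have hs := R.s_pos
  have hε1 := R.eps_le
  have hXt := R.perturbed_mem_tube hzb hw hb
  have hXt' := R.perturbed_mem_tube hzb hw' hb'
  have hwc := R.norm_perturbed_velocity_le hz hb
  have hwc' := R.norm_perturbed_velocity_le hz hb'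
  have hwcont : Continuous fun t => deriv z t + w t := hz.continuous_deriv.add hw
  have hwcont' : Continuous fun t => deriv z t + w' t := hz.continuous_deriv.add hw'
  have hi := R.integrable_force (R.continuous_perturbed hz hw hb) hwcont (a := t) (fun t _ => hXt t) hwc
  have hi' := R.integrable_force (R.continuous_perturbed hz hw' hb') hwcont' (a := t) (fun t _ => hXt' t) hwc'
  have hwi := R.integrable_of_velocityBound hw hb
  have hwi' := R.integrable_of_velocityBound hw' hb'
  have hΔ0 : ∀ τ ≤ 0, ‖(∫ σ in Iic τ, w σ) - ∫ σ in Iic τ, w' σ‖ ≤ Δ / (α * ‖v‖) := by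
    intro τ hτ
    rw [← integral_sub (hwi.mono_set (Iic_subset_Iic.2 hτ)) (hwi'.mono_set (Iic_subset_Iic.2 hτ))]
    refine (norm_integral_Iic_le (K₁ := Δ) (K₂ := 0) hv hα hα hτ fun σ hσ => ?_).trans ?_
    · have := hd σ
      rw [min_eq_left (hσ.trans hτ)] at this
      simpa using this
    · have := wt_le_one hv.le hα.le τ
      rw [zero_div, zero_mul, add_zero]
      exact mul_le_of_le_one_right (by positivity) this
  have hdc : ∀ τ, ‖w τ - w' τ‖ ≤ Δ := fun τ => (hd τ).trans
    (mul_le_of_le_one_right hΔ (wt_le_one hv.le (by linarith) _))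
  have hΔ1 : ∀ τ, ‖(∫ σ in Iic τ, w σ) - ∫ σ in Iic τ, w' σ‖ ≤ Δ / (α * ‖v‖) + Δ * |τ| := by
    intro τ
    rcases le_total τ 0 with h | h
    · have := hΔ0 τ h
      have : 0 ≤ Δ * |τ| := by positivity
      linarith
    · have e1 := intervalIntegral.integral_Iic_sub_Iic hwi (integrableOn_Iic_of_continuous hw hwi τ)
      have e2 := intervalIntegral.integral_Iic_sub_Iic hwi'
        (integrableOn_Iic_of_continuous hw' hwi' τ)
      have e3 : (∫ σ in Iic τ, w σ) - ∫ σ in Iic τ, w' σ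
          = ((∫ σ in Iic 0, w σ) - ∫ σ in Iic 0, w' σ) + ∫ σ in (0 : ℝ)..τ, (w σ - w' σ) := by
        rw [intervalIntegral.integral_sub (hw.intervalIntegrable _ _)
          (hw'.intervalIntegrable _ _), ← e1, ← e2]
        abel
      have h2 := intervalIntegral.norm_integral_le_of_norm_le_const (f := fun σ => w σ - w' σ)
        (a := 0) (b := τ) fun σ _ => hdc σ
      rw [sub_zero] at h2
      rw [e3]
      exact (norm_add_le _ _).trans (add_le_add (hΔ0 0 le_rfl) h2)
  have h1 : ∀ τ, ‖(Gl (perturbed z x w τ) (deriv z τ + w τ)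
        + Gs (perturbed z x w τ) (deriv z τ + w τ))
        - (Gl (perturbed z x w' τ) (deriv z τ + w' τ)
        + Gs (perturbed z x w' τ) (deriv z τ + w' τ))‖
      ≤ 12 * N * wt ‖v‖ (α + 1 + 1) τ * ‖(∫ σ in Iic τ, w σ) - ∫ σ in Iic τ, w' σ‖
        + 4 * N / ‖v‖ * wt ‖v‖ (α + 1) τ * ‖w τ - w' τ‖ := fun τ => by
    have := R.norm_force_sub_le (hXt τ) (hXt' τ) (hwc τ) (hwc' τ)
    rwa [perturbed, perturbed, add_sub_add_left_eq_sub, add_sub_add_left_eq_sub] at this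
  have h2 : ‖gmap c (ginv c v + ∫ τ in Iic t, (Gl (perturbed z x w τ) (deriv z τ + w τ)
        + Gs (perturbed z x w τ) (deriv z τ + w τ)))
      - gmap c (ginv c v + ∫ τ in Iic t, (Gl (perturbed z x w' τ) (deriv z τ + w' τ)
        + Gs (perturbed z x w' τ) (deriv z τ + w' τ)))‖
      ≤ 4 * √(1 - ‖v‖ ^ 2 / c ^ 2) * ‖∫ τ in Iic t, ((Gl (perturbed z x w τ) (deriv z τ + w τ)
        + Gs (perturbed z x w τ) (deriv z τ + w τ))
        - (Gl (perturbed z x w' τ) (deriv z τ + w' τ)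
        + Gs (perturbed z x w' τ) (deriv z τ + w' τ)))‖ := by
    refine (R.norm_gmap_sub_le (k := 24) (by norm_num) ?_).trans_eq ?_
    · rw [add_sub_cancel_left]
      exact R.norm_integral_force_le (fun t _ => hXt' t) hwc'
    · rw [add_sub_add_left_eq_sub, integral_sub hi hi']
  refine h2.trans ?_
  have h5 : √(1 - ‖v‖ ^ 2 / c ^ 2) * N * Δ / (α * ‖v‖ ^ 2) ≤ 1 / 1728 * Δ :=
    (R.sN_mul_le hΔ).trans (by gcongr)
  rcases le_total t 0 with ht | ht
  · rw [min_eq_left ht]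
    have w1 := wt_pos hv.le (α + 1) t
    have h3 : ‖∫ τ in Iic t, ((Gl (perturbed z x w τ) (deriv z τ + w τ)
        + Gs (perturbed z x w τ) (deriv z τ + w τ))
        - (Gl (perturbed z x w' τ) (deriv z τ + w' τ)
        + Gs (perturbed z x w' τ) (deriv z τ + w' τ)))‖
        ≤ 16 * N * Δ / (α * ‖v‖) / ((α + 1) * ‖v‖) * wt ‖v‖ (α + 1) t := by
      have := norm_integral_Iic_le (K₁ := 16 * N * Δ / (α * ‖v‖)) (K₂ := 0) (b₁ := α + 1) (b₂ := 1)
        (ρ := ‖v‖) (t := t) hv (by linarith) one_pos ht (f := fun τ =>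
        ((Gl (perturbed z x w τ) (deriv z τ + w τ)
        + Gs (perturbed z x w τ) (deriv z τ + w τ))
        - (Gl (perturbed z x w' τ) (deriv z τ + w' τ)
        + Gs (perturbed z x w' τ) (deriv z τ + w' τ)))) fun τ hτ => ?_
      · simpa using this
      refine (h1 τ).trans ?_
      have a1 := hΔ0 τ (hτ.trans ht)
      have a2 := hd τ
      rw [min_eq_left (hτ.trans ht)] at a2
      have w1 := wt_pos hv.le (α + 1) τ
      have w2 := wt_pos hv.le (α + 1 + 1) τ
      have a3 : wt ‖v‖ (α + 1) τ * wt ‖v‖ (α + 1) τ ≤ wt ‖v‖ (α + 1 + 1) τ := by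
        rw [← wt_add hv.le]; exact wt_le_wt hv.le (by linarith) τ
      calc _ ≤ 12 * N * wt ‖v‖ (α + 1 + 1) τ * (Δ / (α * ‖v‖))
            + 4 * N / ‖v‖ * wt ‖v‖ (α + 1) τ * (Δ * wt ‖v‖ (α + 1) τ) := by gcongr
        _ = 12 * N * Δ / (α * ‖v‖) * wt ‖v‖ (α + 1 + 1) τ
            + 4 * N * Δ / (α * ‖v‖) * α * (wt ‖v‖ (α + 1) τ * wt ‖v‖ (α + 1) τ) := by
            field_simp
        _ ≤ 12 * N * Δ / (α * ‖v‖) * wt ‖v‖ (α + 1 + 1) τ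
            + 4 * N * Δ / (α * ‖v‖) * 1 * wt ‖v‖ (α + 1 + 1) τ := by gcongr
        _ = _ := by ring
    calc _ ≤ 4 * √(1 - ‖v‖ ^ 2 / c ^ 2) * (16 * N * Δ / (α * ‖v‖) / ((α + 1) * ‖v‖)
          * wt ‖v‖ (α + 1) t) := by gcongr
      _ = 64 * (√(1 - ‖v‖ ^ 2 / c ^ 2) * N * Δ / (α * ‖v‖ ^ 2)) * (1 / (α + 1))
          * wt ‖v‖ (α + 1) t := by field_simp; ring
      _ ≤ 64 * (1 / 1728 * Δ) * 1 * wt ‖v‖ (α + 1) t := by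
          gcongr
          rw [div_le_one (by linarith)]; linarith
      _ ≤ _ := by gcongr; linarith
  · rw [min_eq_right ht, show wt ‖v‖ (α + 1) 0 = 1 by simp [wt], mul_one]
    have h3 : ‖∫ τ in Iic t, ((Gl (perturbed z x w τ) (deriv z τ + w τ)
        + Gs (perturbed z x w τ) (deriv z τ + w τ))
        - (Gl (perturbed z x w' τ) (deriv z τ + w' τ)
        + Gs (perturbed z x w' τ) (deriv z τ + w' τ)))‖
        ≤ 2 * (12 * N * Δ / (α * ‖v‖)) / ((α + 1) * ‖v‖) + 2 * (16 * N * Δ / ‖v‖) / (α * ‖v‖) := by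
      refine norm_setIntegral_le (b₁ := α + 1) (b₂ := α) (Iic t) hv (by positivity)
        (by positivity) (by linarith) hα measurableSet_Iic fun τ _ => ?_
      refine (h1 τ).trans ?_
      have a1 := hΔ1 τ
      have a2 := hdc τ
      have w1 := wt_pos hv.le (α + 1) τ
      have w2 := wt_pos hv.le (α + 1 + 1) τ
      have a3 := abs_mul_wt_le hv.le (α + 1) τ
      calc _ ≤ 12 * N * wt ‖v‖ (α + 1 + 1) τ * (Δ / (α * ‖v‖) + Δ * |τ|)
            + 4 * N / ‖v‖ * wt ‖v‖ (α + 1) τ * Δ := by gcongr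
        _ = 12 * N * Δ / (α * ‖v‖) * wt ‖v‖ (α + 1 + 1) τ
            + 12 * N * Δ / ‖v‖ * (‖v‖ * |τ| * wt ‖v‖ (α + 1 + 1) τ)
            + 4 * N * Δ / ‖v‖ * wt ‖v‖ (α + 1) τ := by
            field_simp
        _ ≤ 12 * N * Δ / (α * ‖v‖) * wt ‖v‖ (α + 1 + 1) τ
            + 12 * N * Δ / ‖v‖ * wt ‖v‖ (α + 1) τ
            + 4 * N * Δ / ‖v‖ * wt ‖v‖ (α + 1) τ := by gcongr
        _ = _ := by ring
    calc _ ≤ 4 * √(1 - ‖v‖ ^ 2 / c ^ 2) * (2 * (12 * N * Δ / (α * ‖v‖)) / ((α + 1) * ‖v‖)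
          + 2 * (16 * N * Δ / ‖v‖) / (α * ‖v‖)) := by gcongr
      _ = 96 * (√(1 - ‖v‖ ^ 2 / c ^ 2) * N * Δ / (α * ‖v‖ ^ 2)) * (1 / (α + 1))
          + 128 * (√(1 - ‖v‖ ^ 2 / c ^ 2) * N * Δ / (α * ‖v‖ ^ 2)) := by field_simp; ring
      _ ≤ 96 * (1 / 1728 * Δ) * 1 + 128 * (1 / 1728 * Δ) := by
          gcongr
          rw [div_le_one (by linarith)]; linarith
      _ ≤ _ := by linarith

/-- Existence of the trajectory with the incoming data `(v, x)`. -/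
theorem exists_incoming (R : Regime Gl Gs c α L N v x) (hz : IsTrajectory c Gl z)
    (hlim : Tendsto (deriv z) atBot (𝓝 v)) (hz0 : z 0 = 0)
    (hzb : ∀ t, ‖z t - t • v‖ ≤ ‖v‖ / 16 * |t|) :
    ∃ X, IsTrajectory c (fun x v => Gl x v + Gs x v) X ∧ (∀ t, X t ∈ tube v x t) ∧
      ‖X 0 - x‖ ≤ 28 * smallness c α N v x ∧
      Tendsto (fun t => ‖deriv X t - deriv z t‖ + ‖X t - (z t + x)‖) atBot (𝓝 0) := by
  have hα := R.α_pos
  have hv := R.v_pos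
  have hwtc := continuous_wt hv.le (α + 1)
  obtain ⟨w, hw, hb, hfix⟩ := exists_fixedPoint_weighted
    (φ := fun t => wt ‖v‖ (α + 1) (min t 0)) (m := velocityBound c α N v x)
    (B := 60 * smallness c α N v x * ‖v‖)
    (hwtc.comp (continuous_id.min continuous_const)) (fun t => wt_pos hv.le _ _)
    R.velocityBound_nonneg R.velocityBound_le
    (fun w t => gmap c (ginv c v + ∫ τ in Iic t, (Gl (perturbed z x w τ) (deriv z τ + w τ)
        + Gs (perturbed z x w τ) (deriv z τ + w τ))) - deriv z t)
    (fun w hw hb => by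
      refine ⟨?_, R.norm_velocity_map_le hz hlim hzb hw hb⟩
      have hXc := R.continuous_perturbed hz hw hb
      have hwc' : Continuous fun t => deriv z t + w t := hz.continuous_deriv.add hw
      have hi := R.integrable_force hXc hwc' (a := 0)
        (fun t _ => R.perturbed_mem_tube hzb hw hb t) (R.norm_perturbed_velocity_le hz hb)
      refine (((contDiff_gmap c).continuous).comp (continuous_const.add ?_)).sub
        hz.continuous_deriv
      exact continuous_iff_continuousAt.2 fun t => (hasDerivAt_integral_Iic
        (R.continuous_force.comp (hXc.prodMk hwc')) hi t).continuousAt)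
    (fun w w' hw hb hw' hb' Δ hΔ hd t => by
      simp only [sub_sub_sub_cancel_right]
      exact R.velocity_map_contraction hz hzb hw hb hw' hb' hΔ hd t)
  have hXd := R.hasDerivAt_perturbed hz hw hb
  have hXt := R.perturbed_mem_tube hzb hw hb
  have hwc' : Continuous fun t => deriv z t + w t := hz.continuous_deriv.add hw
  have hi := R.integrable_force (R.continuous_perturbed hz hw hb) hwc' (a := 0)
    (fun t _ => hXt t) (R.norm_perturbed_velocity_le hz hb)
  refine ⟨perturbed z x w, isTrajectory_of_integral_eq R.c_pos R.continuous_force hwc' hXd hi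
    (p := ginv c v) fun t => ?_, hXt, ?_, ?_⟩
  · conv_lhs => rw [← hfix]
    exact add_sub_cancel (deriv z t) _
  · rw [perturbed, hz0, zero_add, add_sub_cancel_left]
    exact R.norm_integral_velocity_le_of_nonpos hb le_rfl
  · have h1 : ∀ t, ‖deriv (perturbed z x w) t - deriv z t‖ + ‖perturbed z x w t - (z t + x)‖
        = ‖w t‖ + ‖∫ τ in Iic t, w τ‖ := fun t => by
      rw [(hXd t).deriv, perturbed, add_sub_cancel_left, add_sub_cancel_left]
    simp only [h1]
    have h2 : Tendsto (fun t => ‖w t‖) atBot (𝓝 0) := by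
      refine squeeze_zero' (Eventually.of_forall fun _ => norm_nonneg _)
        (g := fun t => 60 * smallness c α N v x * ‖v‖ * wt ‖v‖ (α + 1) t) ?_ ?_
      · filter_upwards [eventually_le_atBot 0] with t ht
        have := (hb t).trans (R.velocityBound_le t)
        rwa [min_eq_left ht] at this
      · simpa using (tendsto_wt_atBot hv (by linarith : 0 < α + 1)).const_mul
          (60 * smallness c α N v x * ‖v‖)
    simpa using h2.add (tendsto_integral_Iic_atBot w).norm

end Existence

end Regime

/-! ### Decay of velocity differences and uniqueness -/

/-- A bound with weight `ψ + δ`, where `ψ` decays at `-∞`, holds for bounded functions with some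
constant. If it always improves, then `δ` can be removed. -/
theorem le_of_improving_decay {u ψ : ℝ → ℝ} {A₀ C T : ℝ} (hA₀ : 0 ≤ A₀) (hC : 0 ≤ C)
    (hψ : ∀ t, 0 ≤ ψ t) (hu : ∀ t ≤ T, u t ≤ C)
    (step : ∀ δ, 0 < δ → ∀ A, 0 ≤ A → (∀ t ≤ T, u t ≤ A * (ψ t + δ)) →
      ∀ t ≤ T, u t ≤ (A₀ + A / 2) * (ψ t + δ)) :
    ∀ t ≤ T, u t ≤ 2 * A₀ * ψ t := by
  intro t ht
  have h : ∀ δ, 0 < δ → u t ≤ 2 * A₀ * (ψ t + δ) := fun δ hδ =>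
    le_of_improving_bound (s := Iic T) (u := u) (ψ := fun t => ψ t + δ) (A₁ := C / δ) hA₀
      (by positivity) (fun t _ => by have := hψ t; positivity) (fun t ht => by
        refine (hu t ht).trans ?_
        have := hψ t
        rw [div_mul_eq_mul_div, le_div_iff₀ hδ]
        nlinarith) (step δ hδ) t ht
  have hlim : Tendsto (fun δ => 2 * A₀ * (ψ t + δ)) (𝓝[>] 0) (𝓝 (2 * A₀ * (ψ t + 0))) :=
    ((tendsto_id.mono_left nhdsWithin_le_nhds).const_add _).const_mul _
  rw [add_zero] at hlim
  exact ge_of_tendsto hlim (eventually_mem_nhdsWithin.mono h)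

/-- The first part `A * wt` of the bound of the velocity contributes a bounded displacement, the
constant part one that is linear in time. -/
theorem norm_sub_le_of_wt_velocity {E : Type*} [NormedAddCommGroup E] [NormedSpace ℝ E]
    [CompleteSpace E] {d d' : ℝ → E} {ρ α A δ t : ℝ} (hρ : 0 < ρ) (hα : 0 < α)
    (hA : 0 ≤ A) (hd : ∀ t, HasDerivAt d (d' t) t) (hc : Continuous d')
    (hb : ∀ t ≤ 0, ‖d' t‖ ≤ A * (wt ρ (α + 1) t + δ)) (ht : t ≤ 0) :
    ‖d t - d 0‖ ≤ A / (α * ρ) + A * δ * |t| := by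
  have h1 : d 0 - d t = ∫ τ in t..0, d' τ :=
    (intervalIntegral.integral_eq_sub_of_hasDerivAt (fun τ _ => hd τ)
      (hc.intervalIntegrable _ _)).symm
  have hwc := continuous_wt hρ.le (α + 1)
  have hI := wt_integrable_and_integral hρ hα (le_refl (0 : ℝ))
  rw [norm_sub_rev, h1]
  calc ‖∫ τ in t..0, d' τ‖ ≤ ∫ τ in t..0, A * (wt ρ (α + 1) τ + δ) :=
        intervalIntegral.norm_integral_le_of_norm_le ht
          (ae_of_all _ fun τ hτ => hb τ hτ.2)
          (((hwc.add continuous_const).const_smul A).intervalIntegrable _ _)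
    _ = A * (∫ τ in t..0, wt ρ (α + 1) τ) + A * δ * |t| := by
        rw [intervalIntegral.integral_const_mul, intervalIntegral.integral_add
          (hwc.intervalIntegrable _ _) (continuous_const.intervalIntegrable _ _),
          intervalIntegral.integral_const, abs_of_nonpos ht, smul_eq_mul]
        ring
    _ ≤ A * (1 / (α * ρ)) + A * δ * |t| := by
        gcongr
        rw [intervalIntegral.integral_of_le ht]
        have h0 : ∫ τ in Iic 0, wt ρ (α + 1) τ = 1 / (α * ρ) := by rw [hI.2]; simp [wt]
        rw [← h0]
        exact setIntegral_mono_set hI.1 (ae_of_all _ fun τ => (wt_pos hρ.le _ _).le)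
          (Ioc_subset_Iic_self (a := t) (b := (0 : ℝ))).eventuallyLE
    _ = _ := by ring

namespace Regime

variable {n : ℕ} {c α L N : ℝ} {Gl Gs : Sp n → Sp n → Sp n} {v x : Sp n}

/-- The impulse along a trajectory in the tube stays close to the impulse at `-∞`. -/
theorem norm_ginv_sub_le (R : Regime Gl Gs c α L N v x) {X : ℝ → Sp n} {v' : Sp n} {a : ℝ}
    (hX : IsTrajectory c (fun x v => Gl x v + Gs x v) X) (hv' : ‖v'‖ < c)
    (hlim : Tendsto (deriv X) atBot (𝓝 v')) (hXt : ∀ t ≤ a, X t ∈ tube v x t) {t : ℝ}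
    (ht : t ≤ a) : ‖ginv c (deriv X t) - ginv c v'‖ ≤ 24 * L / (α * ‖v‖) := by
  rw [hX.ginv_eq hv' hlim (R.integrable_force hX.continuous hX.continuous_deriv
    (fun τ hτ => hXt τ (hτ.trans ht)) hX.norm_deriv_le), add_sub_cancel_left]
  exact R.norm_integral_force_le (fun τ hτ => hXt τ (hτ.trans ht)) hX.norm_deriv_le

/-- The long range and the perturbed trajectory with the same velocity at `-∞` have velocities
whose difference is integrable at `-∞`. -/
theorem norm_deriv_sub_deriv_le (R : Regime Gl Gs c α L N v x) {X z : ℝ → Sp n} {v' : Sp n}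
    (hX : IsTrajectory c (fun x v => Gl x v + Gs x v) X) (hz : IsTrajectory c Gl z)
    (hv' : ‖v'‖ < c) (hnear : ‖ginv c v' - ginv c v‖ ≤ 24 * L / (α * ‖v‖))
    (hXlim : Tendsto (deriv X) atBot (𝓝 v')) (hzlim : Tendsto (deriv z) atBot (𝓝 v'))
    (hXt : ∀ t ≤ 0, X t ∈ tube v x t) (hzt : ∀ t ≤ 0, z t ∈ tube v x t) (hz0 : z 0 = 0)
    (hX0 : ‖X 0 - x‖ ≤ 1) :
    ∀ t ≤ 0, ‖deriv X t - deriv z t‖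
      ≤ 96 * smallness c α N v x * α * ‖v‖ * wt ‖v‖ (α + 1) t := by
  have hα := R.α_pos
  have hα1 := R.α_le
  have hv := R.v_pos
  have hN := R.N_nonneg
  have hs := R.s_pos
  have hε := R.eps_nonneg
  have hε1 := R.eps_le
  have key := le_of_improving_decay (u := fun t => ‖deriv X t - deriv z t‖)
    (ψ := wt ‖v‖ (α + 1)) (A₀ := 48 * smallness c α N v x * α * ‖v‖) (C := 2 * c) (T := 0)
    (by positivity) (by have := R.c_pos; positivity) (fun t => (wt_pos hv.le _ _).le)
    (fun t _ => by
      have := norm_sub_le (deriv X t) (deriv z t)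
      have := hX.2.1 t
      have := hz.2.1 t
      linarith) ?_
  · intro t ht
    exact (key t ht).trans_eq (by ring)
  intro δ hδ A hA hb t ht
  have hXt' : ∀ τ ≤ t, X τ ∈ tube v x τ := fun τ hτ => hXt τ (hτ.trans ht)
  have hzt' : ∀ τ ≤ t, z τ ∈ tube v x τ := fun τ hτ => hzt τ (hτ.trans ht)
  have hi := R.integrable_force hX.continuous hX.continuous_deriv hXt' hX.norm_deriv_le
  have hi' := R.integrable_long hz.continuous hz.continuous_deriv hzt' hz.norm_deriv_le
  have e1 := hX.ginv_eq hv' hXlim hi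
  have e2 := hz.ginv_eq hv' hzlim hi'
  have h1 : ‖deriv X t - deriv z t‖ ≤ 4 * √(1 - ‖v‖ ^ 2 / c ^ 2) * ‖∫ τ in Iic t,
      ((Gl (X τ) (deriv X τ) + Gs (X τ) (deriv X τ)) - Gl (z τ) (deriv z τ))‖ := by
    rw [← hX.gmap_ginv_deriv t, ← hz.gmap_ginv_deriv t]
    refine (R.norm_gmap_sub_le (k := 36) (by norm_num) ?_).trans_eq ?_
    · rw [e2, add_sub_right_comm]
      refine (norm_add_le _ _).trans ((add_le_add hnear
        (R.norm_integral_long_le hzt' hz.norm_deriv_le)).trans_eq (by ring))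
    · rw [e1, e2, add_sub_add_left_eq_sub, integral_sub hi hi']
  have h2 : ∀ τ ≤ t, ‖(Gl (X τ) (deriv X τ) + Gs (X τ) (deriv X τ)) - Gl (z τ) (deriv z τ)‖
      ≤ (12 * N * (1 + ‖x‖) + 8 * N * A / (α * ‖v‖)) * wt ‖v‖ (α + 1 + 1) τ
        + 8 * N * A * δ / ‖v‖ * wt ‖v‖ (α + 1) τ := by
    intro τ hτ
    have hτ0 := hτ.trans ht
    have a1 : ‖X τ - z τ - x‖ ≤ 1 + (A / (α * ‖v‖) + A * δ * |τ|) := by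
      have := norm_sub_le_of_wt_velocity (d := fun t => X t - z t - x) hv hα hA
        (fun t => ((hX.hasDerivAt t).sub (hz.hasDerivAt t)).sub_const x)
        (hX.continuous_deriv.sub hz.continuous_deriv) hb hτ0
      have h3 := norm_sub_norm_le (X τ - z τ - x) (X 0 - z 0 - x)
      rw [hz0, sub_zero] at h3 this
      linarith
    have a2 := hb τ hτ0
    have w1 := wt_pos hv.le (α + 1) τ
    have w2 := wt_pos hv.le (α + 1 + 1) τ
    have a3 := abs_mul_wt_le hv.le (α + 1) τ
    have a4 : wt ‖v‖ (α + 1) τ * wt ‖v‖ (α + 1) τ ≤ wt ‖v‖ (α + 1 + 1) τ := by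
      rw [← wt_add hv.le]; exact wt_le_wt hv.le (by linarith) τ
    have hx := norm_nonneg x
    calc _ ≤ 6 * N * (1 + ‖x‖ + ‖X τ - z τ - x‖) * wt ‖v‖ (α + 1 + 1) τ
          + 2 * N / ‖v‖ * wt ‖v‖ (α + 1) τ * ‖deriv X τ - deriv z τ‖ :=
          R.norm_force_sub_long_le (hXt' τ hτ) (hzt' τ hτ) (by abel) (hX.norm_deriv_le τ)
            (hz.norm_deriv_le τ)
      _ ≤ 6 * N * (1 + ‖x‖ + (1 + (A / (α * ‖v‖) + A * δ * |τ|))) * wt ‖v‖ (α + 1 + 1) τ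
          + 2 * N / ‖v‖ * wt ‖v‖ (α + 1) τ * (A * (wt ‖v‖ (α + 1) τ + δ)) := by gcongr
      _ = 6 * N * (2 + ‖x‖) * wt ‖v‖ (α + 1 + 1) τ
          + 6 * N * A / (α * ‖v‖) * wt ‖v‖ (α + 1 + 1) τ
          + 6 * N * A * δ / ‖v‖ * (‖v‖ * |τ| * wt ‖v‖ (α + 1 + 1) τ)
          + 2 * N * A / (α * ‖v‖) * α * (wt ‖v‖ (α + 1) τ * wt ‖v‖ (α + 1) τ)
          + 2 * N * A * δ / ‖v‖ * wt ‖v‖ (α + 1) τ := by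
          field_simp; ring
      _ ≤ 6 * N * (2 * (1 + ‖x‖)) * wt ‖v‖ (α + 1 + 1) τ
          + 6 * N * A / (α * ‖v‖) * wt ‖v‖ (α + 1 + 1) τ
          + 6 * N * A * δ / ‖v‖ * wt ‖v‖ (α + 1) τ
          + 2 * N * A / (α * ‖v‖) * 1 * wt ‖v‖ (α + 1 + 1) τ
          + 2 * N * A * δ / ‖v‖ * wt ‖v‖ (α + 1) τ := by
          gcongr
          linarith
      _ = _ := by ring
  have h3 := norm_integral_Iic_le hv (by linarith : 0 < α + 1) hα ht h2
  have w1 := wt_pos hv.le (α + 1) t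
  have w3 := wt_le_one hv.le hα.le t
  have w4 := (wt_pos hv.le α t).le
  have h5 := R.sN_mul_le hA
  have hα2 : 1 / (α + 1) ≤ 1 := by rw [div_le_one (by linarith)]; linarith
  calc _ ≤ 4 * √(1 - ‖v‖ ^ 2 / c ^ 2) * ((12 * N * (1 + ‖x‖) + 8 * N * A / (α * ‖v‖))
        / ((α + 1) * ‖v‖) * wt ‖v‖ (α + 1) t
        + 8 * N * A * δ / ‖v‖ / (α * ‖v‖) * wt ‖v‖ α t) := h1.trans (by gcongr)
    _ = 48 * (√(1 - ‖v‖ ^ 2 / c ^ 2) * N * (1 + ‖x‖)) / ‖v‖ * (1 / (α + 1)) * wt ‖v‖ (α + 1) t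
        + 32 * (√(1 - ‖v‖ ^ 2 / c ^ 2) * N * A / (α * ‖v‖ ^ 2)) * (1 / (α + 1))
          * wt ‖v‖ (α + 1) t
        + 32 * (√(1 - ‖v‖ ^ 2 / c ^ 2) * N * A / (α * ‖v‖ ^ 2)) * δ * wt ‖v‖ α t := by
        field_simp; ring
    _ ≤ 48 * (√(1 - ‖v‖ ^ 2 / c ^ 2) * N * (1 + ‖x‖)) / ‖v‖ * 1 * wt ‖v‖ (α + 1) t
        + 32 * (1 / 1728 * A) * 1 * wt ‖v‖ (α + 1) t + 32 * (1 / 1728 * A) * δ * 1 := by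
        have := norm_nonneg x
        have h6 : √(1 - ‖v‖ ^ 2 / c ^ 2) * N * A / (α * ‖v‖ ^ 2) ≤ 1 / 1728 * A :=
          h5.trans (by gcongr)
        gcongr
    _ = 48 * smallness c α N v x * α * ‖v‖ * wt ‖v‖ (α + 1) t
        + 32 * (1 / 1728 * A) * (wt ‖v‖ (α + 1) t + δ) := by
        rw [R.eps_mul]; field_simp; ring
    _ ≤ 48 * smallness c α N v x * α * ‖v‖ * (wt ‖v‖ (α + 1) t + δ)
        + A / 2 * (wt ‖v‖ (α + 1) t + δ) := by
        gcongr
        · linarith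
        · linarith
    _ = _ := by ring

theorem eventually_mem_tube (R : Regime Gl Gs c α L N v x) {X z : ℝ → Sp n}
    (hzb : ∀ t, ‖z t - t • v‖ ≤ ‖v‖ / 16 * |t|)
    (hX : Tendsto (fun t => ‖deriv X t - deriv z t‖ + ‖X t - (z t + x)‖) atBot (𝓝 0)) :
    ∀ᶠ t in atBot, X t ∈ tube v x t ∧ ‖X t - (z t + x)‖ ≤ 1 := by
  have := R.v_pos
  filter_upwards [hX.eventually (gt_mem_nhds (show (0 : ℝ) < 1 / 16 by norm_num))] with t ht
  have h1 := norm_nonneg (deriv X t - deriv z t)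
  refine ⟨mem_tube_of_norm_sub_le 1 ?_, by linarith⟩
  rw [show X t - (t • v + (1 : ℝ) • x) = (z t - t • v) + (X t - (z t + x)) by
    rw [one_smul]; abel]
  refine (norm_add_le _ _).trans ?_
  have := hzb t
  have : 0 ≤ ‖v‖ * |t| := by positivity
  linarith

/-- Two trajectories with the same asymptotics at `-∞` coincide near `-∞`. -/
theorem incoming_eq_near_atBot (R : Regime Gl Gs c α L N v x) {X X' : ℝ → Sp n}
    (hX : IsTrajectory c (fun x v => Gl x v + Gs x v) X)
    (hX' : IsTrajectory c (fun x v => Gl x v + Gs x v) X')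
    (hlim : Tendsto (deriv X) atBot (𝓝 v)) (hlim' : Tendsto (deriv X') atBot (𝓝 v)) {T C : ℝ}
    (hT : T ≤ 0) (hXt : ∀ t ≤ T, X t ∈ tube v x t) (hXt' : ∀ t ≤ T, X' t ∈ tube v x t)
    (hC : 0 ≤ C) (hb : ∀ t ≤ T, ‖X t - X' t‖ ≤ C)
    (h0 : Tendsto (fun t => X t - X' t) atBot (𝓝 0)) :
    X T = X' T ∧ deriv X T = deriv X' T := by
  have hα := R.α_pos
  have hα1 := R.α_le
  have hv := R.v_pos
  have hN := R.N_nonneg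
  have hs := R.s_pos
  have hε := R.eps_nonneg
  have hε1 := R.eps_le
  have hvel : ∀ B, 0 ≤ B → (∀ t ≤ T, ‖X t - X' t‖ ≤ B) → ∀ t ≤ T, ‖deriv X t - deriv X' t‖
      ≤ 2 * (48 * √(1 - ‖v‖ ^ 2 / c ^ 2) * N * B / ‖v‖) * wt ‖v‖ (α + 1) t := by
    intro B hB hXB
    refine le_of_improving_decay (u := fun t => ‖deriv X t - deriv X' t‖) (C := 2 * c)
      (by positivity) (by have := R.c_pos; positivity) (fun t => (wt_pos hv.le _ _).le)
      (fun t _ => by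
        have := norm_sub_le (deriv X t) (deriv X' t)
        have := hX.2.1 t
        have := hX'.2.1 t
        linarith) ?_
    intro δ hδ A hA hb t ht
    have ht0 := ht.trans hT
    have hXs : ∀ τ ≤ t, X τ ∈ tube v x τ := fun τ hτ => hXt τ (hτ.trans ht)
    have hXs' : ∀ τ ≤ t, X' τ ∈ tube v x τ := fun τ hτ => hXt' τ (hτ.trans ht)
    have hi := R.integrable_force hX.continuous hX.continuous_deriv hXs hX.norm_deriv_le
    have hi' := R.integrable_force hX'.continuous hX'.continuous_deriv hXs' hX'.norm_deriv_le
    have e1 := hX.ginv_eq R.v_lt hlim hi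
    have e2 := hX'.ginv_eq R.v_lt hlim' hi'
    have h1 : ‖deriv X t - deriv X' t‖ ≤ 4 * √(1 - ‖v‖ ^ 2 / c ^ 2) * ‖∫ τ in Iic t,
        ((Gl (X τ) (deriv X τ) + Gs (X τ) (deriv X τ))
          - (Gl (X' τ) (deriv X' τ) + Gs (X' τ) (deriv X' τ)))‖ := by
      rw [← hX.gmap_ginv_deriv t, ← hX'.gmap_ginv_deriv t]
      refine (R.norm_gmap_sub_le (k := 24) (by norm_num)
        (R.norm_ginv_sub_le hX' R.v_lt hlim' hXt' ht)).trans_eq ?_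
      rw [e1, e2, add_sub_add_left_eq_sub, integral_sub hi hi']
    have h2 : ∀ τ ≤ t, ‖(Gl (X τ) (deriv X τ) + Gs (X τ) (deriv X τ))
          - (Gl (X' τ) (deriv X' τ) + Gs (X' τ) (deriv X' τ))‖
        ≤ (12 * N * B + 4 * N * A / (α * ‖v‖)) * wt ‖v‖ (α + 1 + 1) τ
          + 4 * N * A * δ / ‖v‖ * wt ‖v‖ (α + 1) τ := by
      intro τ hτ
      have a1 := hXB τ (hτ.trans ht)
      have a2 := hb τ (hτ.trans ht)
      have w1 := wt_pos hv.le (α + 1) τ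
      have w2 := wt_pos hv.le (α + 1 + 1) τ
      have a4 : wt ‖v‖ (α + 1) τ * wt ‖v‖ (α + 1) τ ≤ wt ‖v‖ (α + 1 + 1) τ := by
        rw [← wt_add hv.le]; exact wt_le_wt hv.le (by linarith) τ
      calc _ ≤ 12 * N * wt ‖v‖ (α + 1 + 1) τ * ‖X τ - X' τ‖
            + 4 * N / ‖v‖ * wt ‖v‖ (α + 1) τ * ‖deriv X τ - deriv X' τ‖ :=
            R.norm_force_sub_le (hXs τ hτ) (hXs' τ hτ) (hX.norm_deriv_le τ) (hX'.norm_deriv_le τ)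
        _ ≤ 12 * N * wt ‖v‖ (α + 1 + 1) τ * B
            + 4 * N / ‖v‖ * wt ‖v‖ (α + 1) τ * (A * (wt ‖v‖ (α + 1) τ + δ)) := by gcongr
        _ = 12 * N * B * wt ‖v‖ (α + 1 + 1) τ
            + 4 * N * A / (α * ‖v‖) * α * (wt ‖v‖ (α + 1) τ * wt ‖v‖ (α + 1) τ)
            + 4 * N * A * δ / ‖v‖ * wt ‖v‖ (α + 1) τ := by field_simp; ring
        _ ≤ 12 * N * B * wt ‖v‖ (α + 1 + 1) τ
            + 4 * N * A / (α * ‖v‖) * 1 * wt ‖v‖ (α + 1 + 1) τ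
            + 4 * N * A * δ / ‖v‖ * wt ‖v‖ (α + 1) τ := by gcongr
        _ = _ := by ring
    have h3 := norm_integral_Iic_le hv (by linarith : 0 < α + 1) hα ht0 h2
    have w1 := wt_pos hv.le (α + 1) t
    have w3 := wt_le_one hv.le hα.le t
    have w4 := (wt_pos hv.le α t).le
    have h6 : √(1 - ‖v‖ ^ 2 / c ^ 2) * N * A / (α * ‖v‖ ^ 2) ≤ 1 / 1728 * A :=
      (R.sN_mul_le hA).trans (by gcongr)
    have hα2 : 1 / (α + 1) ≤ 1 := by rw [div_le_one (by linarith)]; linarith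
    calc _ ≤ 4 * √(1 - ‖v‖ ^ 2 / c ^ 2) * ((12 * N * B + 4 * N * A / (α * ‖v‖))
          / ((α + 1) * ‖v‖) * wt ‖v‖ (α + 1) t
          + 4 * N * A * δ / ‖v‖ / (α * ‖v‖) * wt ‖v‖ α t) := h1.trans (by gcongr)
      _ = 48 * √(1 - ‖v‖ ^ 2 / c ^ 2) * N * B / ‖v‖ * (1 / (α + 1)) * wt ‖v‖ (α + 1) t
          + 16 * (√(1 - ‖v‖ ^ 2 / c ^ 2) * N * A / (α * ‖v‖ ^ 2)) * (1 / (α + 1))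
            * wt ‖v‖ (α + 1) t
          + 16 * (√(1 - ‖v‖ ^ 2 / c ^ 2) * N * A / (α * ‖v‖ ^ 2)) * δ * wt ‖v‖ α t := by
          field_simp; ring
      _ ≤ 48 * √(1 - ‖v‖ ^ 2 / c ^ 2) * N * B / ‖v‖ * 1 * wt ‖v‖ (α + 1) t
          + 16 * (1 / 1728 * A) * 1 * wt ‖v‖ (α + 1) t + 16 * (1 / 1728 * A) * δ * 1 := by
          gcongr
      _ = 48 * √(1 - ‖v‖ ^ 2 / c ^ 2) * N * B / ‖v‖ * wt ‖v‖ (α + 1) t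
          + 16 * (1 / 1728 * A) * (wt ‖v‖ (α + 1) t + δ) := by ring
      _ ≤ 48 * √(1 - ‖v‖ ^ 2 / c ^ 2) * N * B / ‖v‖ * (wt ‖v‖ (α + 1) t + δ)
          + A / 2 * (wt ‖v‖ (α + 1) t + δ) := by
          gcongr
          · linarith
          · linarith
      _ = _ := by ring
  have hpos : ∀ t ∈ Iic T, ‖X t - X' t‖ ≤ 2 * 0 * (1 : ℝ) := by
    refine le_of_improving_bound (s := Iic T) (u := fun t => ‖X t - X' t‖) (ψ := fun _ => 1)
      (A₁ := C) le_rfl hC (fun _ _ => zero_le_one) (fun t ht => by simpa using hb t ht) ?_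
    intro B hB hXB t ht
    simp only [mul_one, mem_Iic, zero_add] at hXB ⊢
    have ht0 := le_trans ht hT
    have hbd := hvel B hB hXB
    have hi : IntegrableOn (fun τ => deriv X τ - deriv X' τ) (Iic t) :=
      integrableOn_Iic_of_wt_bound (K₂ := 0) (hX.continuous_deriv.sub hX'.continuous_deriv)
        hv hα hα fun τ hτ => by simpa using hbd τ (hτ.trans ht)
    have h1 := integral_Iic_of_hasDerivAt_of_tendsto'
      (fun τ _ => (hX.hasDerivAt τ).sub (hX'.hasDerivAt τ)) hi h0
    rw [sub_zero] at h1
    have h2 := norm_integral_Iic_le (K₂ := 0) (f := fun τ => deriv X τ - deriv X' τ) hv hα hα ht0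
      fun τ hτ => by simpa using hbd τ (hτ.trans ht)
    rw [h1] at h2
    have w3 := wt_le_one hv.le hα.le t
    have w4 := (wt_pos hv.le α t).le
    have h6 : √(1 - ‖v‖ ^ 2 / c ^ 2) * N * B / (α * ‖v‖ ^ 2) ≤ 1 / 1728 * B :=
      (R.sN_mul_le hB).trans (by gcongr)
    calc _ ≤ _ := h2
      _ = 96 * (√(1 - ‖v‖ ^ 2 / c ^ 2) * N * B / (α * ‖v‖ ^ 2)) * wt ‖v‖ α t := by
          field_simp; ring
      _ ≤ 96 * (1 / 1728 * B) * 1 := by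
          have := wt_pos hv.le α t
          gcongr
      _ ≤ B / 2 := by linarith
  have hz : ∀ t ≤ T, ‖X t - X' t‖ ≤ 0 := fun t ht => by simpa using hpos t ht
  refine ⟨sub_eq_zero.1 (norm_le_zero_iff.1 (hz T le_rfl)), ?_⟩
  have := hvel 0 le_rfl hz T le_rfl
  simp only [mul_zero, zero_div, zero_mul] at this
  exact sub_eq_zero.1 (norm_le_zero_iff.1 this)

/-- Trajectories are determined by their position and velocity at one time. -/
theorem trajectory_eq (R : Regime Gl Gs c α L N v x) {X X' : ℝ → Sp n}
    (hX : IsTrajectory c (fun x v => Gl x v + Gs x v) X)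
    (hX' : IsTrajectory c (fun x v => Gl x v + Gs x v) X') {T : ℝ} (h : X T = X' T)
    (hd : deriv X T = deriv X' T) : X = X' := by
  have hc := R.c_pos
  have hN := R.N_nonneg
  set V : Sp n × Sp n → Sp n × Sp n := fun q =>
    (gmap c q.2, Gl q.1 (gmap c q.2) + Gs q.1 (gmap c q.2)) with hV
  have hg : ∀ p q : Sp n, ‖gmap c p - gmap c q‖ ≤ 2 * ‖p - q‖ := fun p q => by
    refine (RelScattering.norm_gmap_sub_le hc p q).trans ?_
    gcongr
    exact div_le_self (by norm_num) (one_le_gam c q)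
  have hgc : ∀ p : Sp n, ‖gmap c p‖ ≤ 2 * c := fun p => by
    have := norm_gmap_lt hc p
    linarith
  have hlip : LipschitzWith (2 + 6 * N + 4 * N / c).toNNReal V := by
    refine LipschitzWith.of_dist_le_mul fun q q' => ?_
    rw [Real.coe_toNNReal _ (by positivity), dist_eq_norm, dist_eq_norm, Prod.norm_def]
    have h1 : ‖q.1 - q'.1‖ ≤ ‖q - q'‖ := norm_fst_le (q - q')
    have h2 : ‖q.2 - q'.2‖ ≤ ‖q - q'‖ := norm_snd_le (q - q')
    have h3 := (hg q.2 q'.2).trans (mul_le_mul_of_nonneg_left h2 zero_le_two)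
    refine max_le ?_ ?_
    · refine h3.trans ?_
      gcongr
      have : 0 ≤ 6 * N + 4 * N / c := by positivity
      linarith
    · have hone : ∀ y ∈ (univ : Set (Sp n)), (1 : ℝ) ≤ 1 + ‖y‖ := fun y _ => by
        linarith [norm_nonneg y]
      have e1 := R.long.lip univ convex_univ 1 one_pos hone q.1 (mem_univ _) q'.1 (mem_univ _)
        _ _ (hgc q.2) (hgc q'.2)
      have e2 := R.short.lip univ convex_univ 1 one_pos hone q.1 (mem_univ _) q'.1 (mem_univ _)
        _ _ (hgc q.2) (hgc q'.2)
      simp only [Real.one_rpow, mul_one] at e1 e2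
      have e3 : (V q - V q').2 = (Gl q.1 (gmap c q.2) - Gl q'.1 (gmap c q'.2))
          + (Gs q.1 (gmap c q.2) - Gs q'.1 (gmap c q'.2)) := by
        simp only [hV, Prod.snd_sub]
        abel
      rw [e3]
      calc _ ≤ _ := norm_add_le _ _
        _ ≤ (3 * N * ‖q.1 - q'.1‖ + N / c * ‖gmap c q.2 - gmap c q'.2‖)
            + (3 * N * ‖q.1 - q'.1‖ + N / c * ‖gmap c q.2 - gmap c q'.2‖) := add_le_add e1 e2
        _ ≤ (3 * N * ‖q - q'‖ + N / c * (2 * ‖q - q'‖))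
            + (3 * N * ‖q - q'‖ + N / c * (2 * ‖q - q'‖)) := by gcongr
        _ = (0 + 6 * N + 4 * N / c) * ‖q - q'‖ := by ring
        _ ≤ _ := by gcongr; norm_num
  have hsol : ∀ {X : ℝ → Sp n}, IsTrajectory c (fun x v => Gl x v + Gs x v) X → ∀ t,
      HasDerivAt (fun t => (X t, ginv c (deriv X t))) (V (X t, ginv c (deriv X t))) t := by
    intro X hX t
    have := (hX.hasDerivAt t).prodMk (hX.2.2 t)
    simpa only [hV, hX.gmap_ginv_deriv] using this
  have := ODE_solution_unique_univ (v := fun _ => V) (s := fun _ => univ) (t₀ := T)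
    (fun t => hlip.lipschitzOnWith) (fun t => ⟨hsol hX t, mem_univ _⟩)
    (fun t => ⟨hsol hX' t, mem_univ _⟩) (by rw [h, hd])
  exact funext fun t => congrArg Prod.fst (congrFun this t)

/-- Uniqueness of the trajectory with the incoming data `(v, x)`. -/
theorem incoming_unique (R : Regime Gl Gs c α L N v x) {X X' z : ℝ → Sp n}
    (hX : IsTrajectory c (fun x v => Gl x v + Gs x v) X)
    (hX' : IsTrajectory c (fun x v => Gl x v + Gs x v) X')
    (hzlim : Tendsto (deriv z) atBot (𝓝 v)) (hzb : ∀ t, ‖z t - t • v‖ ≤ ‖v‖ / 16 * |t|)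
    (h : Tendsto (fun t => ‖deriv X t - deriv z t‖ + ‖X t - (z t + x)‖) atBot (𝓝 0))
    (h' : Tendsto (fun t => ‖deriv X' t - deriv z t‖ + ‖X' t - (z t + x)‖) atBot (𝓝 0)) :
    X = X' := by
  have hparts : ∀ {X : ℝ → Sp n},
      Tendsto (fun t => ‖deriv X t - deriv z t‖ + ‖X t - (z t + x)‖) atBot (𝓝 0) →
      Tendsto (deriv X) atBot (𝓝 v) ∧ Tendsto (fun t => X t - (z t + x)) atBot (𝓝 0) := by
    intro X h
    constructor
    · have h1 : Tendsto (fun t => deriv X t - deriv z t) atBot (𝓝 0) :=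
        squeeze_zero_norm (fun t => le_add_of_nonneg_right (norm_nonneg _)) h
      simpa using h1.add hzlim
    · exact squeeze_zero_norm (fun t => le_add_of_nonneg_left (norm_nonneg _)) h
  obtain ⟨T, hT⟩ := eventually_atBot.1 (((R.eventually_mem_tube hzb h).and
    (R.eventually_mem_tube hzb h')).and (eventually_le_atBot 0))
  have hxx : ∀ t, X t - X' t = (X t - (z t + x)) - (X' t - (z t + x)) := fun t => by abel
  have h0 : Tendsto (fun t => X t - X' t) atBot (𝓝 0) := by
    have := (hparts h).2.sub (hparts h').2
    rw [sub_zero] at this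
    exact this.congr fun t => (hxx t).symm
  obtain ⟨e1, e2⟩ := R.incoming_eq_near_atBot hX hX' (hparts h).1 (hparts h').1 (hT T le_rfl).2
    (fun t ht => (hT t ht).1.1.1) (fun t ht => (hT t ht).1.2.1) (C := 2) (by norm_num)
    (fun t ht => by
      rw [hxx]
      refine (norm_sub_le _ _).trans ?_
      have := (hT t ht).1.1.2
      have := (hT t ht).1.2.2
      linarith) h0
  exact R.trajectory_eq hX hX' e1 e2

end Regime

/-! ### The asymptotics on a half line -/

section SingleWeight

variable {E : Type*} [NormedAddCommGroup E] {f : ℝ → E} {ρ b K t : ℝ}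

theorem integrableOn_Iic_of_norm_le_wt (hf : Continuous f) (hρ : 0 < ρ) (hb : 0 < b)
    (h : ∀ τ ≤ t, ‖f τ‖ ≤ K * wt ρ (b + 1) τ) : IntegrableOn f (Iic t) :=
  integrableOn_Iic_of_wt_bound (K₂ := 0) hf hρ hb hb fun τ hτ => by simpa using h τ hτ

theorem norm_integral_Iic_le_wt [NormedSpace ℝ E] (hρ : 0 < ρ) (hb : 0 < b) (ht : t ≤ 0)
    (h : ∀ τ ≤ t, ‖f τ‖ ≤ K * wt ρ (b + 1) τ) :
    ‖∫ τ in Iic t, f τ‖ ≤ K / (b * ρ) * wt ρ b t := by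
  simpa using norm_integral_Iic_le (K₂ := 0) hρ hb hb ht fun τ hτ => by simpa using h τ hτ

theorem wt_zero (ρ b : ℝ) : wt ρ b 0 = 1 := by simp [wt]

theorem continuous_integral_Iic [NormedSpace ℝ E] [CompleteSpace E] (hf : Continuous f) {a : ℝ}
    (hi : IntegrableOn f (Iic a)) : Continuous fun s => ∫ τ in Iic s, f τ :=
  continuous_iff_continuousAt.2 fun t => (hasDerivAt_integral_Iic hf hi t).continuousAt

end SingleWeight

theorem line_mem_tube {n : ℕ} (v x : Sp n) (t : ℝ) : t • v + x ∈ tube v x t := by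
  refine mem_tube_of_norm_sub_le 1 ?_
  rw [one_smul, sub_self, norm_zero]
  positivity

theorem Regime.norm_gmap_sub_velocity_le {n : ℕ} {c α L N : ℝ} {Gl Gs : Sp n → Sp n → Sp n}
    {v x p : Sp n} (R : Regime Gl Gs c α L N v x)
    (h : ‖p - ginv c v‖ ≤ 24 * L / (α * ‖v‖)) :
    ‖gmap c p - v‖ ≤ 48 * smallness c α N v x * ‖v‖ := by
  have hα := R.α_pos
  have hv := R.v_pos
  have hs := R.s_pos
  have h1 := R.sN_le
  have h2 := R.L_le
  calc _ ≤ 2 * √(1 - ‖v‖ ^ 2 / c ^ 2) * (24 * L / (α * ‖v‖)) :=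
        (RelScattering.norm_gmap_sub_velocity_le R.v_lt p).trans (by gcongr)
    _ = 48 * (√(1 - ‖v‖ ^ 2 / c ^ 2) * L) / (α * ‖v‖) := by ring
    _ ≤ 48 * (smallness c α N v x * (α * ‖v‖ ^ 2)) / (α * ‖v‖) := by
        refine div_le_div_of_nonneg_right (mul_le_mul_of_nonneg_left ?_ (by norm_num))
          (by positivity)
        exact (mul_le_mul_of_nonneg_left h2 hs.le).trans h1
    _ = _ := by field_simp

/-- A trajectory `X` of the full force and a trajectory `z` of the long range force which have the
same velocity `v'` at `-∞`, both close to the uniform motion with velocity `v` for `t ≤ 0`. The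
impulse of `X` is compared with that of `v`, not of `v'`: for the motion after the collision, read
backwards in time, these velocities differ. -/
structure Incoming {n : ℕ} (Gl Gs : Sp n → Sp n → Sp n) (c α L N : ℝ) (v x v' : Sp n)
    (X z : ℝ → Sp n) : Prop where
  regime : Regime Gl Gs c α L N v x
  traj : IsTrajectory c (fun x v => Gl x v + Gs x v) X
  free : IsTrajectory c Gl z
  lt : ‖v'‖ < c
  lim_traj : Tendsto (deriv X) atBot (𝓝 v')
  lim_free : Tendsto (deriv z) atBot (𝓝 v')
  traj_mem : ∀ t ≤ 0, X t ∈ tube v x t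
  free_near : ∀ t ≤ 0, ‖z t - t • v‖ ≤ ‖v‖ / 8 * |t|
  free_zero : z 0 = 0
  traj_zero : ‖X 0 - x‖ ≤ 28 * smallness c α N v x
  impulse : ∀ t ≤ 0, ‖ginv c (deriv X t) - ginv c v‖ ≤ 24 * L / (α * ‖v‖)

/-- The velocity obtained from `v'` under the long range force along the translate of the free
trajectory `z` by `x`. -/
noncomputable def shiftedVelocity {n : ℕ} (Gl : Sp n → Sp n → Sp n) (c : ℝ) (v' x : Sp n)
    (z : ℝ → Sp n) (t : ℝ) : Sp n :=
  gmap c (ginv c v' + ∫ τ in Iic t, Gl (z τ + x) (deriv z τ))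

namespace Incoming

variable {n : ℕ} {c α L N : ℝ} {Gl Gs : Sp n → Sp n → Sp n} {v x v' : Sp n} {X z : ℝ → Sp n}

/-- The velocity at `-∞` obeys the same bound as the velocities at finite times. -/
theorem impulse_limit (H : Incoming Gl Gs c α L N v x v' X z) :
    ‖ginv c v' - ginv c v‖ ≤ 24 * L / (α * ‖v‖) :=
  le_of_tendsto ((tendsto_ginv_deriv H.lt H.lim_traj).sub_const _).norm
    ((eventually_le_atBot 0).mono fun t ht => H.impulse t ht)

theorem add_mem_tube (H : Incoming Gl Gs c α L N v x v' X z) (l : ℝ) {t : ℝ} (ht : t ≤ 0) :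
    z t + l • x ∈ tube v x t := by
  refine mem_tube_of_norm_sub_le l ?_
  have := H.free_near t ht
  rw [show z t + l • x - (t • v + l • x) = z t - t • v by abel]
  linarith

theorem free_mem (H : Incoming Gl Gs c α L N v x v' X z) {t : ℝ} (ht : t ≤ 0) :
    z t ∈ tube v x t := by
  simpa using H.add_mem_tube 0 ht

theorem shift_mem (H : Incoming Gl Gs c α L N v x v' X z) {t : ℝ} (ht : t ≤ 0) :
    z t + x ∈ tube v x t := by
  simpa using H.add_mem_tube 1 ht

theorem norm_velocity_le (H : Incoming Gl Gs c α L N v x v' X z) : ‖v‖ ≤ 2 * c := by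
  have := H.regime.v_lt
  have := H.regime.c_pos
  linarith

theorem norm_deriv_sub_le (H : Incoming Gl Gs c α L N v x v' X z) {t : ℝ} (ht : t ≤ 0) :
    ‖deriv X t - v‖ ≤ 48 * smallness c α N v x * ‖v‖ := by
  simpa only [H.traj.gmap_ginv_deriv] using H.regime.norm_gmap_sub_velocity_le (H.impulse t ht)

theorem norm_sub_line_le (H : Incoming Gl Gs c α L N v x v' X z) {t : ℝ} (ht : t ≤ 0) :
    ‖X t - (t • v + x)‖ ≤ 48 * smallness c α N v x * (1 + ‖v‖ * |t|) := by
  have hε := H.regime.eps_nonneg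
  have hd : ∀ τ : ℝ, HasDerivAt (fun t => X t - (t • v + x)) (deriv X τ - v) τ := fun τ => by
    have := (H.traj.hasDerivAt τ).sub (((hasDerivAt_id τ).smul_const v).add_const x)
    rwa [one_smul] at this
  have h := (convex_Iic (0 : ℝ)).norm_image_sub_le_of_norm_hasDerivWithin_le
    (fun τ _ => (hd τ).hasDerivWithinAt) (fun τ hτ => H.norm_deriv_sub_le hτ)
    (mem_Iic.2 le_rfl) (mem_Iic.2 ht)
  simp only [zero_smul, zero_add, sub_zero, Real.norm_eq_abs] at h
  have h1 := norm_le_norm_add_norm_sub' (X t - (t • v + x)) (X 0 - x)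
  have h2 := H.traj_zero
  nlinarith

theorem norm_deriv_sub_deriv_le (H : Incoming Gl Gs c α L N v x v' X z) {t : ℝ} (ht : t ≤ 0) :
    ‖deriv X t - deriv z t‖ ≤ 96 * smallness c α N v x * α * ‖v‖ * wt ‖v‖ (α + 1) t :=
  H.regime.norm_deriv_sub_deriv_le H.traj H.free H.lt H.impulse_limit H.lim_traj H.lim_free
    H.traj_mem (fun _ h => H.free_mem h) H.free_zero
    (H.traj_zero.trans (by linarith [H.regime.eps_le])) t ht

/-- On the half line `t ≤ 0` the trajectory stays at a bounded, small distance from the translated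
free trajectory; the distance from the straight line is only controlled linearly in `t`. -/
theorem norm_sub_shift_le (H : Incoming Gl Gs c α L N v x v' X z) {t : ℝ} (ht : t ≤ 0) :
    ‖X t - (z t + x)‖ ≤ 124 * smallness c α N v x := by
  have R := H.regime
  have hα := R.α_pos
  have hv := R.v_pos
  have hε := R.eps_nonneg
  have h := norm_sub_le_of_wt_velocity (d := fun t => X t - z t - x) (δ := 0)
    (A := 96 * smallness c α N v x * α * ‖v‖) hv hα (by positivity)
    (fun t => ((H.traj.hasDerivAt t).sub (H.free.hasDerivAt t)).sub_const x)
    (H.traj.continuous_deriv.sub H.free.continuous_deriv)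
    (fun t ht => by simpa using H.norm_deriv_sub_deriv_le ht) ht
  rw [show 96 * smallness c α N v x * α * ‖v‖ / (α * ‖v‖) = 96 * smallness c α N v x by
    field_simp] at h
  rw [H.free_zero, sub_zero, mul_zero, zero_mul, add_zero] at h
  rw [← sub_sub]
  have h1 := norm_le_norm_add_norm_sub' (X t - z t - x) (X 0 - x)
  have h2 := H.traj_zero
  linarith

theorem norm_long_sub_shift_le (H : Incoming Gl Gs c α L N v x v' X z) {t : ℝ} (ht : t ≤ 0) :
    ‖Gl (X t) (deriv X t) - Gl (z t + x) (deriv z t)‖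
      ≤ 936 * N * smallness c α N v x * wt ‖v‖ (α + 1 + 1) t := by
  have R := H.regime
  have hα := R.α_pos
  have hα1 := R.α_le
  have hv := R.v_pos
  have hε := R.eps_nonneg
  have hN := R.N_nonneg
  have w1 := wt_pos hv.le (α + 1) t
  have w2 := wt_pos hv.le (α + 1 + 1) t
  have w3 : wt ‖v‖ (α + 1) t * wt ‖v‖ (α + 1) t ≤ wt ‖v‖ (α + 1 + 1) t := by
    rw [← wt_add hv.le]; exact wt_le_wt hv.le (by linarith) t
  calc _ ≤ 6 * N * wt ‖v‖ (α + 1 + 1) t * ‖X t - (z t + x)‖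
        + 2 * N / ‖v‖ * wt ‖v‖ (α + 1) t * ‖deriv X t - deriv z t‖ :=
        R.norm_long_sub_le (H.traj_mem t ht) (H.shift_mem ht) (H.traj.norm_deriv_le t)
          (H.free.norm_deriv_le t)
    _ ≤ 6 * N * wt ‖v‖ (α + 1 + 1) t * (124 * smallness c α N v x)
        + 2 * N / ‖v‖ * wt ‖v‖ (α + 1) t
          * (96 * smallness c α N v x * α * ‖v‖ * wt ‖v‖ (α + 1) t) := by
        gcongr
        · exact H.norm_sub_shift_le ht
        · exact H.norm_deriv_sub_deriv_le ht
    _ = 744 * N * smallness c α N v x * wt ‖v‖ (α + 1 + 1) t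
        + 192 * N * smallness c α N v x * α * (wt ‖v‖ (α + 1) t * wt ‖v‖ (α + 1) t) := by
        field_simp; ring
    _ ≤ 744 * N * smallness c α N v x * wt ‖v‖ (α + 1 + 1) t
        + 192 * N * smallness c α N v x * 1 * wt ‖v‖ (α + 1 + 1) t := by gcongr
    _ = _ := by ring

theorem norm_short_sub_line_le (H : Incoming Gl Gs c α L N v x v' X z) {t : ℝ} (ht : t ≤ 0) :
    ‖Gs (X t) (deriv X t) - Gs (t • v + x) v‖
      ≤ 384 * N * smallness c α N v x * wt ‖v‖ (α + 1 + 1) t := by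
  have R := H.regime
  have hv := R.v_pos
  have hN := R.N_nonneg
  have w2 := wt_pos hv.le (α + 1 + 1) t
  have w3 := wt_pos hv.le (α + 1 + 1 + 1) t
  calc _ ≤ 6 * N * wt ‖v‖ (α + 1 + 1 + 1) t * ‖X t - (t • v + x)‖
        + 2 * N / ‖v‖ * wt ‖v‖ (α + 1 + 1) t * ‖deriv X t - v‖ :=
        R.norm_short_sub_le (H.traj_mem t ht) (line_mem_tube v x t) (H.traj.norm_deriv_le t)
          H.norm_velocity_le
    _ ≤ 6 * N * wt ‖v‖ (α + 1 + 1 + 1) t * (48 * smallness c α N v x * (1 + ‖v‖ * |t|))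
        + 2 * N / ‖v‖ * wt ‖v‖ (α + 1 + 1) t * (48 * smallness c α N v x * ‖v‖) := by
        gcongr
        · exact H.norm_sub_line_le ht
        · exact H.norm_deriv_sub_le ht
    _ = 288 * N * smallness c α N v x * ((1 + ‖v‖ * |t|) * wt ‖v‖ (α + 1 + 1 + 1) t)
        + 96 * N * smallness c α N v x * wt ‖v‖ (α + 1 + 1) t := by field_simp; ring
    _ = _ := by rw [base_mul_wt hv.le]; ring

theorem norm_force_sub_line_le (H : Incoming Gl Gs c α L N v x v' X z) {t : ℝ} (ht : t ≤ 0) :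
    ‖(Gl (X t) (deriv X t) + Gs (X t) (deriv X t)) - (Gl (t • v + x) v + Gs (t • v + x) v)‖
      ≤ 768 * N * smallness c α N v x * wt ‖v‖ (α + 1) t := by
  have R := H.regime
  have hv := R.v_pos
  have hN := R.N_nonneg
  have w2 := wt_pos hv.le (α + 1) t
  have w3 := wt_pos hv.le (α + 1 + 1) t
  calc _ ≤ 12 * N * wt ‖v‖ (α + 1 + 1) t * ‖X t - (t • v + x)‖
        + 4 * N / ‖v‖ * wt ‖v‖ (α + 1) t * ‖deriv X t - v‖ :=
        R.norm_force_sub_le (H.traj_mem t ht) (line_mem_tube v x t) (H.traj.norm_deriv_le t)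
          H.norm_velocity_le
    _ ≤ 12 * N * wt ‖v‖ (α + 1 + 1) t * (48 * smallness c α N v x * (1 + ‖v‖ * |t|))
        + 4 * N / ‖v‖ * wt ‖v‖ (α + 1) t * (48 * smallness c α N v x * ‖v‖) := by
        gcongr
        · exact H.norm_sub_line_le ht
        · exact H.norm_deriv_sub_le ht
    _ = 576 * N * smallness c α N v x * ((1 + ‖v‖ * |t|) * wt ‖v‖ (α + 1 + 1) t)
        + 192 * N * smallness c α N v x * wt ‖v‖ (α + 1) t := by field_simp; ring
    _ = _ := by rw [base_mul_wt hv.le]; ring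

theorem continuous_line (v x : Sp n) : Continuous fun t : ℝ => t • v + x := by fun_prop

theorem continuous_long_shift (H : Incoming Gl Gs c α L N v x v' X z) :
    Continuous fun τ => Gl (z τ + x) (deriv z τ) :=
  H.regime.long.continuous_along (H.free.continuous.add continuous_const) H.free.continuous_deriv

theorem continuous_short_line (H : Incoming Gl Gs c α L N v x v' X z) :
    Continuous fun τ : ℝ => Gs (τ • v + x) v :=
  H.regime.short.continuous_along (continuous_line v x) continuous_const

theorem integrable_force_traj (H : Incoming Gl Gs c α L N v x v' X z) :
    IntegrableOn (fun τ => Gl (X τ) (deriv X τ) + Gs (X τ) (deriv X τ)) (Iic 0) :=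
  H.regime.integrable_force H.traj.continuous H.traj.continuous_deriv H.traj_mem
    H.traj.norm_deriv_le

theorem integrable_long_shift (H : Incoming Gl Gs c α L N v x v' X z) :
    IntegrableOn (fun τ => Gl (z τ + x) (deriv z τ)) (Iic 0) :=
  H.regime.integrable_long (H.free.continuous.add continuous_const) H.free.continuous_deriv
    (fun _ h => H.shift_mem h) H.free.norm_deriv_le

theorem integrable_long_free (H : Incoming Gl Gs c α L N v x v' X z) :
    IntegrableOn (fun τ => Gl (z τ) (deriv z τ)) (Iic 0) :=
  H.regime.integrable_long H.free.continuous H.free.continuous_deriv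
    (fun _ h => H.free_mem h) H.free.norm_deriv_le

theorem integrable_force_line (H : Incoming Gl Gs c α L N v x v' X z) :
    IntegrableOn (fun τ : ℝ => Gl (τ • v + x) v + Gs (τ • v + x) v) (Iic 0) :=
  H.regime.integrable_force (continuous_line v x) continuous_const (fun t _ => line_mem_tube v x t)
    fun _ => H.norm_velocity_le

theorem norm_short_line_le (H : Incoming Gl Gs c α L N v x v' X z) (t : ℝ) :
    ‖Gs (t • v + x) v‖ ≤ 6 * L * wt ‖v‖ (α + 1 + 1) t :=
  H.regime.norm_short_le (line_mem_tube v x t) H.norm_velocity_le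

theorem integrable_short_line (H : Incoming Gl Gs c α L N v x v' X z) :
    IntegrableOn (fun τ : ℝ => Gs (τ • v + x) v) (Iic 0) :=
  integrableOn_Iic_of_norm_le_wt H.continuous_short_line H.regime.v_pos
    (by linarith [H.regime.α_pos]) fun τ _ => H.norm_short_line_le τ

theorem norm_integral_short_line_le (H : Incoming Gl Gs c α L N v x v' X z) {t : ℝ}
    (ht : t ≤ 0) : ‖∫ τ in Iic t, Gs (τ • v + x) v‖
      ≤ 6 * L / ((α + 1) * ‖v‖) * wt ‖v‖ (α + 1) t :=
  norm_integral_Iic_le_wt H.regime.v_pos (by linarith [H.regime.α_pos]) ht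
    fun τ _ => H.norm_short_line_le τ

theorem integrable_integral_short_line (H : Incoming Gl Gs c α L N v x v' X z) :
    IntegrableOn (fun t : ℝ => ∫ τ in Iic t, Gs (τ • v + x) v) (Iic 0) :=
  integrableOn_Iic_of_norm_le_wt
    (continuous_integral_Iic H.continuous_short_line H.integrable_short_line) H.regime.v_pos
    H.regime.α_pos fun _ ht => H.norm_integral_short_line_le ht

/-- The total force on a half line against the force along the line of uniform motion. -/
theorem norm_integral_force_sub_line_le (H : Incoming Gl Gs c α L N v x v' X z) :
    ‖(∫ τ in Iic 0, (Gl (X τ) (deriv X τ) + Gs (X τ) (deriv X τ)))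
        - ∫ τ in Iic (0 : ℝ), (Gl (τ • v + x) v + Gs (τ • v + x) v)‖
      ≤ 768 * N * smallness c α N v x / (α * ‖v‖) := by
  rw [← integral_sub H.integrable_force_traj H.integrable_force_line]
  refine (norm_integral_Iic_le_wt H.regime.v_pos H.regime.α_pos le_rfl
    fun τ hτ => H.norm_force_sub_line_le hτ).trans_eq ?_
  rw [wt_zero, mul_one]

theorem integrable_deriv_sub (H : Incoming Gl Gs c α L N v x v' X z) :
    IntegrableOn (fun τ => deriv X τ - deriv z τ) (Iic 0) :=
  integrableOn_Iic_of_norm_le_wt (H.traj.continuous_deriv.sub H.free.continuous_deriv)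
    H.regime.v_pos H.regime.α_pos fun _ hτ => H.norm_deriv_sub_deriv_le hτ

theorem continuous_shiftedVelocity (H : Incoming Gl Gs c α L N v x v' X z) :
    Continuous (shiftedVelocity Gl c v' x z) :=
  (contDiff_gmap c).continuous.comp (continuous_const.add
    (continuous_integral_Iic H.continuous_long_shift H.integrable_long_shift))

/-- The impulse of the trajectory minus the impulse obtained along the translated free trajectory
is the impulse transferred by the short range force along the line, up to a small error. -/
theorem norm_impulse_sub_sub_le (H : Incoming Gl Gs c α L N v x v' X z) {t : ℝ} (ht : t ≤ 0) :
    ‖ginv c (deriv X t) - (ginv c v' + ∫ τ in Iic t, Gl (z τ + x) (deriv z τ))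
        - ∫ τ in Iic t, Gs (τ • v + x) v‖
      ≤ 1320 * N * smallness c α N v x / ((α + 1) * ‖v‖) * wt ‖v‖ (α + 1) t := by
  have R := H.regime
  have hi1 := H.integrable_force_traj.mono_set (Iic_subset_Iic.2 ht)
  have hi2 := H.integrable_long_shift.mono_set (Iic_subset_Iic.2 ht)
  have hi3 := H.integrable_short_line.mono_set (Iic_subset_Iic.2 ht)
  rw [H.traj.ginv_eq H.lt H.lim_traj hi1, add_sub_add_left_eq_sub, ← integral_sub hi1 hi2,
    ← integral_sub (by exact hi1.sub hi2) hi3]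
  refine norm_integral_Iic_le_wt R.v_pos (by linarith [R.α_pos]) ht fun τ hτ => ?_
  have h1 := H.norm_long_sub_shift_le (hτ.trans ht)
  have h2 := H.norm_short_sub_line_le (hτ.trans ht)
  rw [show Gl (X τ) (deriv X τ) + Gs (X τ) (deriv X τ) - Gl (z τ + x) (deriv z τ)
      - Gs (τ • v + x) v = (Gl (X τ) (deriv X τ) - Gl (z τ + x) (deriv z τ))
      + (Gs (X τ) (deriv X τ) - Gs (τ • v + x) v) by abel]
  refine (norm_add_le _ _).trans ((add_le_add h1 h2).trans_eq (by ring))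

/-- The velocity of the trajectory minus the velocity obtained along the translated free trajectory
is the linear response to the impulse of the short range force along the line, up to an error which
is quadratic in the forces. -/
theorem norm_deriv_sub_shiftedVelocity_sub_le (H : Incoming Gl Gs c α L N v x v' X z) {t : ℝ}
    (ht : t ≤ 0) :
    ‖deriv X t - shiftedVelocity Gl c v' x z t - Dmap c v (∫ τ in Iic t, Gs (τ • v + x) v)‖
      ≤ 5664 * √(1 - ‖v‖ ^ 2 / c ^ 2) * N * smallness c α N v x / ((α + 1) * ‖v‖)
        * wt ‖v‖ (α + 1) t := by
  have R := H.regime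
  have hα := R.α_pos
  have hv := R.v_pos
  have hs := R.s_pos
  have hN := R.N_nonneg
  have hL := R.L_nonneg
  have hLN := R.L_le
  have hε := R.eps_nonneg
  have hε1 := R.eps_le
  have w1 := wt_pos hv.le (α + 1) t
  have hc := R.c_pos
  have h1 := H.norm_impulse_sub_sub_le ht
  have h2 := H.norm_integral_short_line_le ht
  have hlim := H.impulse_limit
  have hP := H.impulse t ht
  have hPeq := H.traj.gmap_ginv_deriv t
  have hl := R.norm_integral_long_le (fun τ (hτ : τ ≤ t) => H.shift_mem (hτ.trans ht))
    H.free.norm_deriv_le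
  have hsq : 1 - ‖v‖ ^ 2 / c ^ 2 = √(1 - ‖v‖ ^ 2 / c ^ 2) ^ 2 :=
    (Real.sq_sqrt (one_sub_sq_pos R.v_lt).le).symm
  have hsN := R.sN_le
  unfold shiftedVelocity
  generalize ginv c (deriv X t) = P at *
  generalize (∫ τ in Iic t, Gl (z τ + x) (deriv z τ)) = I at *
  generalize (∫ τ in Iic t, Gs (τ • v + x) v) = J at *
  -- `36 = 24 + 12`: the impulse at `-∞` differs from that of `v`, and the long range force adds `I`
  have hQ : ‖ginv c v' + I - ginv c v‖ ≤ 36 * L / (α * ‖v‖) := by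
    rw [add_sub_right_comm]
    exact (norm_add_le _ _).trans ((add_le_add hlim hl).trans_eq (by ring))
  have hP' : ‖P - ginv c v‖ ≤ 36 * L / (α * ‖v‖) := hP.trans (by gcongr; norm_num)
  have hR : 36 * L / (α * ‖v‖) ≤ ‖ginv c v‖ / 2 := by
    refine le_half_norm_ginv R.v_lt ?_
    rw [← mul_div_assoc, div_le_iff₀ (by positivity)]
    calc 2 * √(1 - ‖v‖ ^ 2 / c ^ 2) * (36 * L) ≤ 2 * √(1 - ‖v‖ ^ 2 / c ^ 2) * (36 * N) := by gcongr
      _ = 72 * (√(1 - ‖v‖ ^ 2 / c ^ 2) * N) := by ring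
      _ ≤ 72 * (1 / 1728 * (α * ‖v‖ ^ 2)) :=
          mul_le_mul_of_nonneg_left (hsN.trans (by gcongr)) (by norm_num)
      _ ≤ ‖v‖ * (α * ‖v‖) := by nlinarith [show 0 < α * ‖v‖ ^ 2 by positivity]
  -- the impulse `J` is of order `6 N`; the quadratic remainder stays below `1320 N / 1728 ≤ N`
  have hδ : ‖P - (ginv c v' + I)‖ ≤ 7 * N / ((α + 1) * ‖v‖) * wt ‖v‖ (α + 1) t := by
    have h3 := norm_le_norm_add_norm_sub' (P - (ginv c v' + I)) J
    calc _ ≤ 6 * N / ((α + 1) * ‖v‖) * wt ‖v‖ (α + 1) t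
          + 1320 * N * (1 / 1728) / ((α + 1) * ‖v‖) * wt ‖v‖ (α + 1) t := by
          refine h3.trans (add_le_add (h2.trans ?_) (h1.trans ?_)) <;> gcongr
      _ = (6 + 1320 / 1728) * N / ((α + 1) * ‖v‖) * wt ‖v‖ (α + 1) t := by ring
      _ ≤ _ := by gcongr; norm_num
  have hlin := norm_gmap_sub_sub_Dmap_le R.v_lt hR hP' hQ
  rw [hPeq] at hlin
  have hD := norm_Dmap_le R.v_lt (P - (ginv c v' + I) - J)
  rw [map_sub] at hD
  have hfin := norm_add_le (deriv X t - gmap c (ginv c v' + I) - Dmap c v (P - (ginv c v' + I)))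
    (Dmap c v (P - (ginv c v' + I)) - Dmap c v J)
  rw [sub_add_sub_cancel] at hfin
  rw [hsq] at hlin
  generalize √(1 - ‖v‖ ^ 2 / c ^ 2) = s at *
  generalize smallness c α N v x = ε at *
  -- `3024 = 12 * 36 * 7` from the curvature of `gmap`, `2640 = 2 * 1320` from the impulse
  calc _ ≤ 12 * s ^ 2 / c * (36 * L / (α * ‖v‖)) * (7 * N / ((α + 1) * ‖v‖) * wt ‖v‖ (α + 1) t)
        + 2 * s * (1320 * N * ε / ((α + 1) * ‖v‖) * wt ‖v‖ (α + 1) t) := by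
        refine hfin.trans (add_le_add (hlin.trans ?_) (hD.trans ?_)) <;> gcongr
    _ ≤ 12 * s ^ 2 / ‖v‖ * (36 * N / (α * ‖v‖)) * (7 * N / ((α + 1) * ‖v‖) * wt ‖v‖ (α + 1) t)
        + 2 * s * (1320 * N * ε / ((α + 1) * ‖v‖) * wt ‖v‖ (α + 1) t) := by
        have := R.v_lt.le
        gcongr
    _ = 3024 * s * N * (s * N) / (α * ‖v‖ ^ 2) / ((α + 1) * ‖v‖) * wt ‖v‖ (α + 1) t
        + 2640 * s * N * ε / ((α + 1) * ‖v‖) * wt ‖v‖ (α + 1) t := by field_simp; ring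
    _ ≤ 3024 * s * N * (ε * (α * ‖v‖ ^ 2)) / (α * ‖v‖ ^ 2) / ((α + 1) * ‖v‖) * wt ‖v‖ (α + 1) t
        + 2640 * s * N * ε / ((α + 1) * ‖v‖) * wt ‖v‖ (α + 1) t := by gcongr
    _ = _ := by field_simp; ring

theorem integrable_Dmap_short (H : Incoming Gl Gs c α L N v x v' X z) :
    IntegrableOn (fun t : ℝ => Dmap c v (∫ τ in Iic t, Gs (τ • v + x) v)) (Iic 0) :=
  (Dmap c v).integrable_comp H.integrable_integral_short_line

theorem continuous_Dmap_short (H : Incoming Gl Gs c α L N v x v' X z) :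
    Continuous (fun t : ℝ => Dmap c v (∫ τ in Iic t, Gs (τ • v + x) v)) :=
  (Dmap c v).continuous.comp
    (continuous_integral_Iic H.continuous_short_line H.integrable_short_line)

theorem integrable_remainder (H : Incoming Gl Gs c α L N v x v' X z) :
    IntegrableOn (fun t => deriv X t - shiftedVelocity Gl c v' x z t
      - Dmap c v (∫ τ in Iic t, Gs (τ • v + x) v)) (Iic 0) :=
  integrableOn_Iic_of_norm_le_wt ((H.traj.continuous_deriv.sub H.continuous_shiftedVelocity).sub
    H.continuous_Dmap_short) H.regime.v_pos H.regime.α_pos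
    fun _ ht => H.norm_deriv_sub_shiftedVelocity_sub_le ht

theorem integrable_shiftedVelocity_sub (H : Incoming Gl Gs c α L N v x v' X z) :
    IntegrableOn (fun t => shiftedVelocity Gl c v' x z t - deriv z t) (Iic 0) := by
  have h := (H.integrable_deriv_sub.sub H.integrable_remainder).sub H.integrable_Dmap_short
  refine h.congr_fun (fun t _ => ?_) measurableSet_Iic
  simp only [Pi.sub_apply]
  abel

/-- The total displacement of the trajectory relative to the free one, on a half line. -/
theorem norm_integral_deriv_sub_sub_le (H : Incoming Gl Gs c α L N v x v' X z) :
    ‖(∫ t in Iic 0, (deriv X t - deriv z t))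
        - (∫ t in Iic 0, (shiftedVelocity Gl c v' x z t - deriv z t))
        - Dmap c v (∫ t in Iic (0 : ℝ), ∫ τ in Iic t, Gs (τ • v + x) v)‖
      ≤ 5664 * √(1 - ‖v‖ ^ 2 / c ^ 2) * N * smallness c α N v x
        / (α * (α + 1) * ‖v‖ ^ 2) := by
  have R := H.regime
  have hα := R.α_pos
  have hv := R.v_pos
  rw [← ContinuousLinearMap.integral_comp_comm _ H.integrable_integral_short_line,
    ← integral_sub H.integrable_deriv_sub H.integrable_shiftedVelocity_sub,
    ← integral_sub (by exact H.integrable_deriv_sub.sub H.integrable_shiftedVelocity_sub)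
      H.integrable_Dmap_short]
  refine (norm_integral_Iic_le_wt
    (K := 5664 * √(1 - ‖v‖ ^ 2 / c ^ 2) * N * smallness c α N v x / ((α + 1) * ‖v‖))
    hv hα le_rfl fun t ht => ?_).trans_eq ?_
  · rw [sub_sub_sub_cancel_right]
    exact H.norm_deriv_sub_shiftedVelocity_sub_le ht
  · rw [wt_zero, mul_one]
    field_simp

/-- The difference of the two trajectories has a limit at `-∞`. -/
theorem tendsto_sub (H : Incoming Gl Gs c α L N v x v' X z) :
    Tendsto (fun t => X t - z t) atBot (𝓝 (X 0 - ∫ t in Iic 0, (deriv X t - deriv z t))) := by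
  have h := (intervalIntegral_tendsto_integral_Iic 0 H.integrable_deriv_sub tendsto_id).const_sub
    (X 0)
  refine h.congr fun t => ?_
  rw [intervalIntegral.integral_eq_sub_of_hasDerivAt
    (fun τ _ => (H.traj.hasDerivAt τ).sub (H.free.hasDerivAt τ))
    ((H.traj.continuous_deriv.sub H.free.continuous_deriv).intervalIntegrable _ _)]
  simp [H.free_zero]

theorem shiftedVelocity_zero (H : Incoming Gl Gs c α L N v x v' X z) {t : ℝ} (ht : t ≤ 0) :
    shiftedVelocity Gl c v' 0 z t = deriv z t := by
  simp only [shiftedVelocity, add_zero]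
  rw [← H.free.ginv_eq H.lt H.lim_free (H.integrable_long_free.mono_set (Iic_subset_Iic.2 ht)),
    H.free.gmap_ginv_deriv]

/-- The displacement at time `0` relative to `-∞`. -/
theorem integral_deriv_sub (H : Incoming Gl Gs c α L N v x v' X z) {y : Sp n}
    (hy : Tendsto (fun t => X t - (z t + y)) atBot (𝓝 0)) :
    ∫ t in Iic 0, (deriv X t - deriv z t) = X 0 - y := by
  have h : Tendsto (fun t => X t - z t) atBot (𝓝 y) := by
    have := hy.add_const y
    rw [zero_add] at this
    exact this.congr fun t => by abel
  have := integral_Iic_of_hasDerivAt_of_tendsto'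
    (fun τ _ => (H.traj.hasDerivAt τ).sub (H.free.hasDerivAt τ)) H.integrable_deriv_sub h
  simpa [H.free_zero] using this

end Incoming

/-! ### Free solutions at admissible velocities -/

theorem mu_le_iff {c σ ρ : ℝ} (hc : 0 < c) (hσ : 0 < σ) (hρ : 0 ≤ ρ) (hρc : ρ < c) :
    mu c σ ≤ ρ ↔ σ * √(1 - ρ ^ 2 / c ^ 2) ≤ ρ ^ 2 := by
  have hs : 0 ≤ 1 - ρ ^ 2 / c ^ 2 := by
    have : ρ ^ 2 / c ^ 2 ≤ 1 := by rw [div_le_one (by positivity)]; gcongr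
    linarith
  have h4 : σ ^ 2 / c ^ 4 = (σ / c ^ 2) ^ 2 := by rw [div_pow]; ring
  have hqa : ρ ^ 2 / c ^ 2 * σ = ρ ^ 2 * (σ / c ^ 2) := by ring
  have hT := Real.sq_sqrt (show 0 ≤ (σ / c ^ 2) ^ 2 + 4 by positivity)
  have hT0 : 0 < √((σ / c ^ 2) ^ 2 + 4) := Real.sqrt_pos.2 (by positivity)
  have ha : 0 < σ / c ^ 2 := by positivity
  have hq : 0 ≤ ρ ^ 2 := by positivity
  -- both sides are equivalent to `σ² ≤ ρ⁴ + σ²ρ²/c²`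
  have h1 : σ * √(1 - ρ ^ 2 / c ^ 2) ≤ ρ ^ 2 ↔ σ ^ 2 - σ * (ρ ^ 2 * (σ / c ^ 2)) ≤ (ρ ^ 2) ^ 2 := by
    rw [← sq_le_sq₀ (by positivity) hq, mul_pow, Real.sq_sqrt hs, ← hqa]
    ring_nf
  rw [h1, mu, Real.sqrt_le_left hρ, h4, div_le_iff₀ (by positivity)]
  generalize ρ ^ 2 = q at *
  generalize √((σ / c ^ 2) ^ 2 + 4) = T at *
  generalize σ / c ^ 2 = a at *
  constructor
  · intro h
    rcases le_total (2 * σ) (q * a) with h2 | h2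
    · nlinarith
    · have h3 : (2 * σ - q * a) ^ 2 ≤ (q * T) ^ 2 := by
        refine pow_le_pow_left₀ (by linarith) ?_ 2
        linarith
      have : (q * T) ^ 2 = q ^ 2 * (a ^ 2 + 4) := by rw [mul_pow, hT]
      nlinarith
  · intro h
    have h3 : (2 * σ - q * a) ^ 2 ≤ (q * T) ^ 2 := by
      have : (q * T) ^ 2 = q ^ 2 * (a ^ 2 + 4) := by rw [mul_pow, hT]
      nlinarith
    have := (abs_le_of_sq_le_sq' h3 (by positivity)).2
    linarith

namespace Setting

variable {n : ℕ} (S : Setting n)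

theorem max_βl_pos : 0 < max (S.βl 1) (S.βl 2) := lt_max_of_lt_left (S.βl_pos 1 (by norm_num))

theorem muL_pos (hn : 2 ≤ n) : 0 < S.muL := by
  have := S.max_βl_pos
  have := S.α_pos
  have := S.c_pos
  have : (0 : ℝ) < n := by exact_mod_cast (by omega : 0 < n)
  unfold muL mu
  positivity

theorem muL_le_iff (hn : 2 ≤ n) {ρ : ℝ} (hρ : 0 ≤ ρ) (hρc : ρ < S.c) :
    S.muL ≤ ρ ↔ 256 * √(1 - ρ ^ 2 / S.c ^ 2) * (n ^ 2 * max (S.βl 1) (S.βl 2)) ≤ S.α * ρ ^ 2 := by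
  have h1 := S.max_βl_pos
  have h2 := S.α_pos
  have h3 : (0 : ℝ) < n := by exact_mod_cast (by omega : 0 < n)
  rw [muL, mu_le_iff S.c_pos (by positivity) hρ hρc, mul_comm S.α, ← div_le_iff₀ h2]
  refine iff_of_eq (congrArg (· ≤ ρ ^ 2) ?_)
  field_simp
  ring

/-- The constant of the linear bound for the free solutions. -/
theorem free_const_bounds (hn : 2 ≤ n) {ρ : ℝ} (hμ : S.muL ≤ ρ) (hρc : ρ < S.c) :
    24 * √(1 - ρ ^ 2 / S.c ^ 2) * (n * S.βl 1) / (S.α * ρ)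
        ≤ (2 : ℝ) ^ (9 / 2 : ℝ) * (n : ℝ) ^ (3 / 2 : ℝ) * S.βl 1 * √(1 - ρ ^ 2 / S.c ^ 2)
          / (S.α * ρ) ∧
      (2 : ℝ) ^ (9 / 2 : ℝ) * (n : ℝ) ^ (3 / 2 : ℝ) * S.βl 1 * √(1 - ρ ^ 2 / S.c ^ 2)
          / (S.α * ρ) ≤ ρ / 16 := by
  have hρ := (S.muL_pos hn).trans_le hμ
  have hα := S.α_pos
  have hβ := S.βl_pos 1 (by norm_num)
  have hs := Real.sqrt_nonneg (1 - ρ ^ 2 / S.c ^ 2)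
  have hn2 : (2 : ℝ) ≤ n := by exact_mod_cast hn
  have h := (S.muL_le_iff hn hρ.le hρc).1 hμ
  have hβm := le_max_left (S.βl 1) (S.βl 2)
  have e1 : (2 : ℝ) ^ (9 / 2 : ℝ) = 16 * √2 := by
    rw [show (9 / 2 : ℝ) = (4 : ℕ) + 1 / 2 by norm_num, Real.rpow_add two_pos, Real.rpow_natCast,
      ← Real.sqrt_eq_rpow]
    norm_num
  have e2 : (n : ℝ) ^ (3 / 2 : ℝ) = n * √n := by
    rw [show (3 / 2 : ℝ) = 1 + 1 / 2 by norm_num, Real.rpow_add (by linarith), Real.rpow_one,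
      ← Real.sqrt_eq_rpow]
  have h2 := Real.mul_self_sqrt (show (0 : ℝ) ≤ 2 by norm_num)
  have h2n : √2 ≤ √(n : ℝ) := Real.sqrt_le_sqrt hn2
  have h20 := Real.sqrt_nonneg (2 : ℝ)
  have hnn := Real.mul_self_sqrt (show (0 : ℝ) ≤ n by linarith)
  rw [e1, e2]
  constructor
  · have h3 : (24 : ℝ) ≤ 16 * √2 * √n := by nlinarith
    gcongr ?_ / _
    calc 24 * √(1 - ρ ^ 2 / S.c ^ 2) * (n * S.βl 1)
        = 24 * (n * S.βl 1 * √(1 - ρ ^ 2 / S.c ^ 2)) := by ring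
      _ ≤ 16 * √2 * √n * (n * S.βl 1 * √(1 - ρ ^ 2 / S.c ^ 2)) := by gcongr
      _ = _ := by ring
  · rw [div_le_iff₀ (by positivity)]
    have h3 : √2 * √n ≤ n := by nlinarith
    calc _ = 16 * (√2 * √n) * n * S.βl 1 * √(1 - ρ ^ 2 / S.c ^ 2) := by ring
      _ ≤ 16 * n * n * max (S.βl 1) (S.βl 2) * √(1 - ρ ^ 2 / S.c ^ 2) := by gcongr
      _ = 256 * √(1 - ρ ^ 2 / S.c ^ 2) * (n ^ 2 * max (S.βl 1) (S.βl 2)) / 16 := by ring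
      _ ≤ S.α * ρ ^ 2 / 16 := by gcongr
      _ = _ := by ring

theorem existsUnique_isFree_atBot (hn : 2 ≤ n) {v : Sp n} (hμ : S.muL ≤ ‖v‖) (hv : ‖v‖ < S.c) :
    ∃! z, S.IsFree atBot v z := by
  have hρ := (S.muL_pos hn).trans_le hμ
  have hβ := S.βl_pos 1 (by norm_num)
  have h := S.free_const_bounds hn hμ hv
  have := S.max_βl_pos
  exact existsUnique_free (S.forceDecay_Fl (by omega)) S.α_pos S.α_le_one (by positivity)
    (by positivity) rfl hρ hv ((S.muL_le_iff hn hρ.le hv).1 hμ) h.1 (h.2.trans (by linarith))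

theorem existsUnique_isFree_atTop (hn : 2 ≤ n) {v : Sp n} (hμ : S.muL ≤ ‖v‖) (hv : ‖v‖ < S.c) :
    ∃! z, S.IsFree atTop v z := by
  obtain ⟨z, hz, huniq⟩ := S.rev.existsUnique_isFree_atBot hn (v := -v)
    (by rw [norm_neg]; exact hμ) (by rw [norm_neg]; exact hv)
  refine ⟨fun t => z (-t), S.isFree_reverse_iff.2 (by simpa using hz), fun z' hz' => ?_⟩
  rw [← huniq _ (S.isFree_reverse_iff.1 hz')]
  simp

theorem isFree_zMinus (hn : 2 ≤ n) {v : Sp n} (hμ : S.muL ≤ ‖v‖) (hv : ‖v‖ < S.c) :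
    S.IsFree atBot v (S.zMinus v) :=
  Classical.epsilon_spec (S.existsUnique_isFree_atBot hn hμ hv).exists

theorem isFree_zPlus (hn : 2 ≤ n) {v : Sp n} (hμ : S.muL ≤ ‖v‖) (hv : ‖v‖ < S.c) :
    S.IsFree atTop v (S.zPlus v) :=
  Classical.epsilon_spec (S.existsUnique_isFree_atTop hn hμ hv).exists

variable {S}

theorem IsFree.tendsto_deriv {e : Filter ℝ} {v : Sp n} {z : ℝ → Sp n} (h : S.IsFree e v z) :
    Tendsto (deriv z) e (𝓝 v) := by
  simpa using h.2.1.add_const v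

theorem IsFree.norm_sub_le {e : Filter ℝ} {v : Sp n} {z : ℝ → Sp n} (hn : 2 ≤ n)
    (hμ : S.muL ≤ ‖v‖) (hv : ‖v‖ < S.c) (h : S.IsFree e v z) (t : ℝ) :
    ‖z t - t • v‖ ≤ ‖v‖ / 16 * |t| :=
  (h.2.2.2 t).trans (mul_le_mul_of_nonneg_right (S.free_const_bounds hn hμ hv).2 (abs_nonneg t))

end Setting

/-! ### Conservation of energy -/

theorem EMField.inner_force {n : ℕ} (f : EMField n) (c : ℝ) (x v : Sp n) :
    inner ℝ v (f.force c x v) = -fderiv ℝ f.V x v := by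
  have hB : inner ℝ v (WithLp.toLp 2 ((f.B x).mulVec (WithLp.ofLp v)) : Sp n) = 0 := by
    have ht : (f.B x).transpose = -f.B x := by
      ext i k
      exact f.antisymm_B x i k
    have h1 : WithLp.ofLp v ⬝ᵥ (f.B x).mulVec (WithLp.ofLp v)
        = -(WithLp.ofLp v ⬝ᵥ (f.B x).mulVec (WithLp.ofLp v)) := by
      conv_lhs => rw [Matrix.dotProduct_mulVec, ← Matrix.mulVec_transpose, ht, Matrix.neg_mulVec,
        neg_dotProduct, dotProduct_comm]
    rw [EuclideanSpace.inner_eq_star_dotProduct]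
    simp only [star_trivial]
    rw [dotProduct_comm]
    linarith
  rw [EMField.force, inner_add_right, inner_neg_right, inner_smul_right, hB, real_inner_comm,
    gradient, InnerProductSpace.toDual_symm_apply]
  simp

namespace Setting

variable {n : ℕ} {S : Setting n} {X : ℝ → Sp n}

/-- Conservation of energy: the magnetic force is orthogonal to the velocity and does no work. -/
theorem hasDerivAt_energy (hX : IsTrajectory S.c S.F X) (t : ℝ) :
    HasDerivAt (fun t => S.c ^ 2 * gam S.c (ginv S.c (deriv X t))
      + (S.l.V (X t) + S.s.V (X t))) 0 t := by
  have hc := S.c_pos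
  have hp := gam_pos S.c (ginv S.c (deriv X t))
  have h1 : HasDerivAt (fun t => gam S.c (ginv S.c (deriv X t)))
      (2 * inner ℝ (ginv S.c (deriv X t)) (S.F (X t) (deriv X t)) / S.c ^ 2
        / (2 * gam S.c (ginv S.c (deriv X t)))) t :=
    (((hX.2.2 t).norm_sq.div_const _).const_add 1).sqrt (by positivity)
  have h2 : ∀ f : EMField n, HasDerivAt (fun t => f.V (X t)) (fderiv ℝ f.V (X t) (deriv X t)) t :=
    fun f => ((f.contDiff_V.differentiable (by norm_num)) _).hasFDerivAt.comp_hasDerivAt t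
      (hX.hasDerivAt t)
  refine ((h1.const_mul (S.c ^ 2)).add ((h2 S.l).add (h2 S.s))).congr_deriv ?_
  have e : inner ℝ (deriv X t) (S.F (X t) (deriv X t))
      = -fderiv ℝ S.l.V (X t) (deriv X t) - fderiv ℝ S.s.V (X t) (deriv X t) := by
    rw [F, Fl, Fs, inner_add_right, EMField.inner_force, EMField.inner_force]
    ring
  have e2 : ∀ f : Sp n, inner ℝ (deriv X t) f = 1 / gam S.c (ginv S.c (deriv X t))
      * inner ℝ (ginv S.c (deriv X t)) f := fun f => by
    conv_lhs => rw [← hX.gmap_ginv_deriv t, gmap_eq, inner_smul_left]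
    simp
  replace e2 := e2 (S.F (X t) (deriv X t))
  rw [e] at e2
  field_simp at e2 ⊢
  linarith

theorem norm_V_le (S : Setting n) (x : Sp n) :
    |S.l.V x + S.s.V x| ≤ (S.βl 0 + S.βs 1) * (1 + ‖x‖) ^ (-S.α) := by
  have h1 := S.longRange.1 [] (by simp) x
  have h2 := S.shortRange.1 [] (by simp) x
  simp only [pderivs, List.length_nil, Nat.cast_zero, add_zero, zero_add] at h1 h2
  have h3 : (1 + ‖x‖) ^ (-(S.α + 1)) ≤ (1 + ‖x‖) ^ (-S.α) :=
    Real.rpow_le_rpow_of_exponent_le (by linarith [norm_nonneg x]) (by linarith)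
  have := S.βs_pos 1 (by norm_num) (by norm_num)
  calc _ ≤ |S.l.V x| + |S.s.V x| := abs_add_le _ _
    _ ≤ S.βl 0 * (1 + ‖x‖) ^ (-S.α) + S.βs 1 * (1 + ‖x‖) ^ (-S.α) :=
        add_le_add h1 (h2.trans (by gcongr))
    _ = _ := by ring

theorem tendsto_V_of_tube {e : Filter ℝ} (he : Tendsto (fun t : ℝ => |t|) e atTop) {v x : Sp n}
    (hv : 0 < ‖v‖) (hvx : inner ℝ v x = 0) (hXt : ∀ t, X t ∈ tube v x t) :
    Tendsto (fun t => S.l.V (X t) + S.s.V (X t)) e (𝓝 0) := by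
  have h1 : Tendsto (fun t => 1 + ‖X t‖) e atTop := by
    refine tendsto_atTop_mono (fun t => le_norm_of_mem_tube hvx (hXt t)) ?_
    exact (tendsto_atTop_add_const_left _ _ (he.const_mul_atTop hv)).const_mul_atTop (by norm_num)
  have h2 := ((tendsto_rpow_neg_atTop S.α_pos).comp h1).const_mul (S.βl 0 + S.βs 1)
  rw [mul_zero] at h2
  exact squeeze_zero_norm (fun t => S.norm_V_le (X t)) h2

/-- By conservation of energy the asymptotic velocities have the same length. -/
theorem norm_velocity_eq (hX : IsTrajectory S.c S.F X) {v x a w : Sp n} (hv : 0 < ‖v‖)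
    (hvx : inner ℝ v x = 0) (hXt : ∀ t, X t ∈ tube v x t) (hw : ‖w‖ < S.c) (ha : ‖a‖ < S.c)
    (hbot : Tendsto (deriv X) atBot (𝓝 w)) (htop : Tendsto (deriv X) atTop (𝓝 a)) :
    ‖a‖ = ‖w‖ := by
  have hc := S.c_pos
  have hconst : ∀ t, S.c ^ 2 * gam S.c (ginv S.c (deriv X t)) + (S.l.V (X t) + S.s.V (X t))
      = S.c ^ 2 * gam S.c (ginv S.c (deriv X 0)) + (S.l.V (X 0) + S.s.V (X 0)) := fun t =>
    is_const_of_deriv_eq_zero (fun t => (hasDerivAt_energy hX t).differentiableAt)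
      (fun t => (hasDerivAt_energy hX t).deriv) t 0
  have hgc : Continuous (gam S.c : Sp n → ℝ) := by unfold gam; fun_prop
  have hlim : ∀ {e : Filter ℝ} [e.NeBot] {u : Sp n}, Tendsto (fun t : ℝ => |t|) e atTop →
      ‖u‖ < S.c → Tendsto (deriv X) e (𝓝 u) → S.c ^ 2 * (1 / √(1 - ‖u‖ ^ 2 / S.c ^ 2))
        = S.c ^ 2 * gam S.c (ginv S.c (deriv X 0)) + (S.l.V (X 0) + S.s.V (X 0)) := by
    intro e _ u he hu h
    have h1 := (((hgc.tendsto _).comp (tendsto_ginv_deriv hu h)).const_mul (S.c ^ 2)).add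
      (tendsto_V_of_tube (S := S) he hv hvx hXt)
    rw [gam_ginv hu, add_zero] at h1
    exact tendsto_nhds_unique h1 (tendsto_const_nhds.congr fun t => (hconst t).symm)
  have h := (hlim tendsto_abs_atTop_atTop ha htop).trans (hlim tendsto_abs_atBot_atTop hw hbot).symm
  have h3 : √(1 - ‖a‖ ^ 2 / S.c ^ 2) = √(1 - ‖w‖ ^ 2 / S.c ^ 2) := by
    have := mul_left_cancel₀ (by positivity) h
    simpa using this
  rw [Real.sqrt_inj (one_sub_sq_pos ha).le (one_sub_sq_pos hw).le] at h3
  have h4 : ‖a‖ ^ 2 = ‖w‖ ^ 2 := by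
    field_simp at h3
    linarith
  exact (sq_eq_sq₀ (norm_nonneg _) (norm_nonneg _)).1 h4

end Setting

/-! ### The scattering map at high energies -/

theorem tube_neg {n : ℕ} (v x : Sp n) (t : ℝ) : tube (-v) x t = tube v x (-t) := by
  simp [tube]

theorem Regime.integrable_force_univ {n : ℕ} {c α L N : ℝ} {Gl Gs : Sp n → Sp n → Sp n}
    {v x : Sp n} (R : Regime Gl Gs c α L N v x) {X w : ℝ → Sp n} (hX : Continuous X)
    (hw : Continuous w) (hXt : ∀ t, X t ∈ tube v x t) (hwc : ∀ t, ‖w t‖ ≤ 2 * c) :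
    Integrable fun τ => Gl (X τ) (w τ) + Gs (X τ) (w τ) := by
  refine integrable_of_wt_bound (K₁ := 12 * L) (K₂ := 0)
    (R.continuous_force.comp (hX.prodMk hw)) R.v_pos R.α_pos R.α_pos fun τ => ?_
  simpa using R.norm_force_le (hXt τ) (hwc τ)

theorem smallness_neg {n : ℕ} (c α N : ℝ) (v x : Sp n) :
    smallness c α N (-v) x = smallness c α N v x := by
  simp [smallness]

namespace Setting

variable {n : ℕ} {S : Setting n} {v x : Sp n}

/-- The regime in which all the estimates hold, with constants for both forces in terms of `β`. -/
abbrev HighEnergy (S : Setting n) (v x : Sp n) : Prop :=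
  Regime S.Fl S.Fs S.c S.α (n * S.β) (n ^ 2 * S.β) v x

theorem β_pos (S : Setting n) : 0 < S.β := lt_max_of_lt_left S.max_βl_pos

theorem highEnergy_of_small (hn : 2 ≤ n) (hv : 0 < ‖v‖) (hvc : ‖v‖ < S.c)
    (hvx : inner ℝ v x = 0)
    (h : 1728 * (√(1 - ‖v‖ ^ 2 / S.c ^ 2) * (n ^ 2 * S.β) * (1 + ‖x‖)) ≤ S.α * ‖v‖ ^ 2) :
    S.HighEnergy v x where
  long := (S.forceDecay_Fl (by omega)).mono S.c_pos
    (mul_le_mul_of_nonneg_left ((le_max_left _ _).trans (le_max_left _ _)) (by positivity))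
    (mul_le_mul_of_nonneg_left (le_max_left _ _) (by positivity))
  short := (S.forceDecay_Fs (by omega)).mono S.c_pos
    (mul_le_mul_of_nonneg_left ((le_max_left _ _).trans (le_max_right _ _)) (by positivity))
    (mul_le_mul_of_nonneg_left (le_max_right _ _) (by positivity))
  α_pos := S.α_pos
  α_le := S.α_le_one
  L_nonneg := by have := S.β_pos; positivity
  L_le := by
    have := S.β_pos
    have h1 : (1 : ℝ) ≤ n := by exact_mod_cast (by omega : 1 ≤ n)
    gcongr
    nlinarith
  v_pos := hv
  v_lt := hvc
  orth := hvx
  small := h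

theorem HighEnergy.reverse (hn : 2 ≤ n) (R : S.HighEnergy v x) : S.rev.HighEnergy (-v) x :=
  highEnergy_of_small hn (by rw [norm_neg]; exact R.v_pos) (by rw [norm_neg]; exact R.v_lt)
    (by rw [inner_neg_left, R.orth, neg_zero]) (by rw [norm_neg]; exact R.small)

theorem HighEnergy.muL_le (hn : 2 ≤ n) (R : S.HighEnergy v x) : S.muL ≤ ‖v‖ := by
  refine (S.muL_le_iff hn R.v_pos.le R.v_lt).2 (le_trans ?_ R.small)
  have := S.max_βl_pos
  have hβ := S.β_pos
  have h1 : max (S.βl 1) (S.βl 2) ≤ S.β := le_max_left _ _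
  calc 256 * √(1 - ‖v‖ ^ 2 / S.c ^ 2) * (n ^ 2 * max (S.βl 1) (S.βl 2))
      ≤ 256 * √(1 - ‖v‖ ^ 2 / S.c ^ 2) * (n ^ 2 * S.β) := by gcongr
    _ = 256 * (√(1 - ‖v‖ ^ 2 / S.c ^ 2) * (n ^ 2 * S.β) * (1 + 0)) := by ring
    _ ≤ _ := by
        gcongr
        · norm_num
        · exact norm_nonneg x

theorem HighEnergy.existsUnique_isIncoming (hn : 2 ≤ n) (R : S.HighEnergy v x) :
    ∃! X, S.IsIncoming v x X := by
  have hz := S.isFree_zMinus hn (R.muL_le hn) R.v_lt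
  obtain ⟨X, hX, -, -, hlim⟩ := Regime.exists_incoming R hz.1 hz.tendsto_deriv hz.2.2.1
    (hz.norm_sub_le hn (R.muL_le hn) R.v_lt)
  exact ⟨X, ⟨hX, hlim⟩, fun X' h' => Regime.incoming_unique R h'.1 hX hz.tendsto_deriv
    (hz.norm_sub_le hn (R.muL_le hn) R.v_lt) h'.2 hlim⟩

theorem HighEnergy.isIncoming_sol (hn : 2 ≤ n) (R : S.HighEnergy v x) :
    S.IsIncoming v x (S.sol v x) :=
  Classical.epsilon_spec (R.existsUnique_isIncoming hn).exists

theorem HighEnergy.sol_mem_tube (hn : 2 ≤ n) (R : S.HighEnergy v x) :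
    (∀ t, S.sol v x t ∈ tube v x t) ∧
      ‖S.sol v x 0 - x‖ ≤ 28 * smallness S.c S.α (n ^ 2 * S.β) v x := by
  have hz := S.isFree_zMinus hn (R.muL_le hn) R.v_lt
  obtain ⟨X, hX, h1, h2, hlim⟩ := Regime.exists_incoming R hz.1 hz.tendsto_deriv hz.2.2.1
    (hz.norm_sub_le hn (R.muL_le hn) R.v_lt)
  rw [(R.existsUnique_isIncoming hn).unique (R.isIncoming_sol hn) ⟨hX, hlim⟩]
  exact ⟨h1, h2⟩

theorem tendsto_of_tendsto_norm_add {e : Filter ℝ} {X z : ℝ → Sp n} {w y : Sp n}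
    (h : Tendsto (fun t => ‖deriv X t - deriv z t‖ + ‖X t - (z t + y)‖) e (𝓝 0))
    (hz : Tendsto (deriv z) e (𝓝 w)) :
    Tendsto (deriv X) e (𝓝 w) ∧ Tendsto (fun t => X t - (z t + y)) e (𝓝 0) := by
  constructor
  · have h1 : Tendsto (fun t => deriv X t - deriv z t) e (𝓝 0) :=
      squeeze_zero_norm (fun t => le_add_of_nonneg_right (norm_nonneg _)) h
    simpa using h1.add hz
  · exact squeeze_zero_norm (fun t => le_add_of_nonneg_left (norm_nonneg _)) h

theorem HighEnergy.tendsto_deriv_sol_atBot (hn : 2 ≤ n) (R : S.HighEnergy v x) :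
    Tendsto (deriv (S.sol v x)) atBot (𝓝 v) :=
  (tendsto_of_tendsto_norm_add (R.isIncoming_sol hn).2
    (S.isFree_zMinus hn (R.muL_le hn) R.v_lt).tendsto_deriv).1

theorem HighEnergy.norm_ginv_deriv_sol_sub_le (hn : 2 ≤ n) (R : S.HighEnergy v x) (t : ℝ) :
    ‖ginv S.c (deriv (S.sol v x) t) - ginv S.c v‖ ≤ 24 * (n * S.β) / (S.α * ‖v‖) :=
  Regime.norm_ginv_sub_le R (R.isIncoming_sol hn).1 R.v_lt (R.tendsto_deriv_sol_atBot hn)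
    (fun τ _ => (R.sol_mem_tube hn).1 τ) le_rfl

/-- The motion before the collision. -/
theorem HighEnergy.incoming_past (hn : 2 ≤ n) (R : S.HighEnergy v x) :
    Incoming S.Fl S.Fs S.c S.α (n * S.β) (n ^ 2 * S.β) v x v (S.sol v x) (S.zMinus v) := by
  have hz := S.isFree_zMinus hn (R.muL_le hn) R.v_lt
  exact
  { regime := R
    traj := (R.isIncoming_sol hn).1
    free := hz.1
    lt := R.v_lt
    lim_traj := R.tendsto_deriv_sol_atBot hn
    lim_free := hz.tendsto_deriv
    traj_mem := fun t _ => (R.sol_mem_tube hn).1 t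
    free_near := fun t _ => (hz.norm_sub_le hn (R.muL_le hn) R.v_lt t).trans
      (by gcongr; norm_num)
    free_zero := hz.2.2.1
    traj_zero := (R.sol_mem_tube hn).2
    impulse := fun t _ => R.norm_ginv_deriv_sol_sub_le hn t }

theorem HighEnergy.integrable_force_sol (hn : 2 ≤ n) (R : S.HighEnergy v x) :
    Integrable fun τ => S.F (S.sol v x τ) (deriv (S.sol v x) τ) :=
  have hX := (R.isIncoming_sol hn).1
  Regime.integrable_force_univ R hX.continuous hX.continuous_deriv (R.sol_mem_tube hn).1
    hX.norm_deriv_le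

/-- The velocity converges at `+∞`, because the impulse transferred along the whole trajectory is
finite. -/
theorem HighEnergy.tendsto_deriv_sol_atTop (hn : 2 ≤ n) (R : S.HighEnergy v x) :
    Tendsto (deriv (S.sol v x)) atTop
      (𝓝 (gmap S.c (ginv S.c v + ∫ τ, S.F (S.sol v x τ) (deriv (S.sol v x) τ)))) := by
  have hX := (R.isIncoming_sol hn).1
  have hi := R.integrable_force_sol hn
  have h1 := (aecover_Iic (μ := volume) (tendsto_id (α := ℝ))).integral_tendsto_of_countably_generated hi
  have h2 := ((contDiff_gmap S.c).continuous.tendsto _).comp (h1.const_add (ginv S.c v))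
  refine h2.congr fun t => ?_
  rw [← hX.gmap_ginv_deriv t, hX.ginv_eq R.v_lt (R.tendsto_deriv_sol_atBot hn) hi.integrableOn]
  rfl

/-- The velocity at `+∞` of the solution with the incoming data `(v, x)`. -/
noncomputable def outVelocity (S : Setting n) (v x : Sp n) : Sp n :=
  gmap S.c (ginv S.c v + ∫ τ, S.F (S.sol v x τ) (deriv (S.sol v x) τ))

theorem outVelocity_lt : ‖S.outVelocity v x‖ < S.c := norm_gmap_lt S.c_pos _

theorem HighEnergy.norm_outVelocity (hn : 2 ≤ n) (R : S.HighEnergy v x) :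
    ‖S.outVelocity v x‖ = ‖v‖ :=
  norm_velocity_eq (R.isIncoming_sol hn).1 R.v_pos R.orth (R.sol_mem_tube hn).1 R.v_lt
    outVelocity_lt (R.tendsto_deriv_sol_atBot hn) (R.tendsto_deriv_sol_atTop hn)

theorem HighEnergy.muL_le_outVelocity (hn : 2 ≤ n) (R : S.HighEnergy v x) :
    S.muL ≤ ‖S.outVelocity v x‖ := by
  rw [R.norm_outVelocity hn]; exact R.muL_le hn

theorem HighEnergy.norm_outVelocity_sub_le (hn : 2 ≤ n) (R : S.HighEnergy v x) :
    ‖S.outVelocity v x - v‖ ≤ ‖v‖ / 16 := by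
  have h : ‖ginv S.c v + (∫ τ, S.F (S.sol v x τ) (deriv (S.sol v x) τ)) - ginv S.c v‖
      ≤ 24 * (n * S.β) / (S.α * ‖v‖) := by
    have h1 := ((tendsto_ginv_deriv outVelocity_lt (R.tendsto_deriv_sol_atTop hn)).sub_const
      (ginv S.c v)).norm
    simp only [outVelocity, ginv_gmap S.c_pos] at h1
    exact le_of_tendsto h1 (Eventually.of_forall fun t => R.norm_ginv_deriv_sol_sub_le hn t)
  refine (R.norm_gmap_sub_velocity_le h).trans ?_
  have := R.eps_le
  have := R.v_pos
  nlinarith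

/-- The motion after the collision, read backwards in time. -/
theorem HighEnergy.incoming_future (hn : 2 ≤ n) (R : S.HighEnergy v x) :
    Incoming S.rev.Fl S.rev.Fs S.c S.α (n * S.β) (n ^ 2 * S.β) (-v) x (-S.outVelocity v x)
      (fun t => S.sol v x (-t)) (fun t => S.zPlus (S.outVelocity v x) (-t)) := by
  have hz := S.isFree_zPlus hn (R.muL_le_outVelocity hn) outVelocity_lt
  have hzr := S.isFree_reverse_iff.1 hz
  have hX := (R.isIncoming_sol hn).1
  exact
  { regime := R.reverse hn
    traj := by
      have := hX.reverse
      rw [← rev_F] at this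
      exact this
    free := hzr.1
    lt := by rw [norm_neg]; exact outVelocity_lt
    lim_traj := by
      rw [deriv_comp_neg']
      exact ((R.tendsto_deriv_sol_atTop hn).comp tendsto_neg_atBot_atTop).neg
    lim_free := hzr.tendsto_deriv
    traj_mem := fun t _ => by rw [tube_neg]; exact (R.sol_mem_tube hn).1 (-t)
    free_near := fun t _ => by
      have h1 := hz.norm_sub_le hn (R.muL_le_outVelocity hn) outVelocity_lt (-t)
      have h2 := R.norm_outVelocity_sub_le hn
      have h3 : S.zPlus (S.outVelocity v x) (-t) - t • -v
          = (S.zPlus (S.outVelocity v x) (-t) - (-t) • S.outVelocity v x)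
            + (-t) • (S.outVelocity v x - v) := by module
      rw [R.norm_outVelocity hn, abs_neg] at h1
      rw [h3, norm_neg]
      refine (norm_add_le _ _).trans ?_
      rw [norm_smul, Real.norm_eq_abs, abs_neg]
      nlinarith [abs_nonneg t]
    free_zero := by simpa using hz.2.2.1
    traj_zero := by
      rw [smallness_neg, neg_zero]
      exact (R.sol_mem_tube hn).2
    impulse := fun t _ => by
      rw [deriv_comp_neg', ginv_neg, ginv_neg, ← neg_sub', norm_neg, norm_neg]
      exact R.norm_ginv_deriv_sol_sub_le hn (-t) }

/-- The position at `+∞`, relative to the free motion, of the solution with the incoming data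
`(v, x)`. -/
noncomputable def outPosition (S : Setting n) (v x : Sp n) : Sp n :=
  S.sol v x 0 - ∫ t in Iic 0, (deriv (fun t => S.sol v x (-t)) t
    - deriv (fun t => S.zPlus (S.outVelocity v x) (-t)) t)

theorem HighEnergy.isOutgoing (hn : 2 ≤ n) (R : S.HighEnergy v x) :
    S.IsOutgoing (S.sol v x) (S.outVelocity v x, S.outPosition v x) := by
  refine ⟨R.muL_le_outVelocity hn, outVelocity_lt, ?_⟩
  have hz := S.isFree_zPlus hn (R.muL_le_outVelocity hn) outVelocity_lt
  have h1 := (R.tendsto_deriv_sol_atTop hn).sub hz.tendsto_deriv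
  have h2 := (R.incoming_future hn).tendsto_sub.comp tendsto_neg_atTop_atBot
  simp only [Function.comp_def, neg_neg, neg_zero] at h2
  have h3 := (h2.sub_const (S.outPosition v x)).norm
  have h4 := h1.norm.add h3
  simp only [outPosition, outVelocity, sub_self, norm_zero, add_zero] at h4
  refine h4.congr fun t => ?_
  simp only [outPosition, outVelocity, sub_sub]

theorem HighEnergy.existsUnique_isOutgoing (hn : 2 ≤ n) (R : S.HighEnergy v x) :
    ∃! q, S.IsOutgoing (S.sol v x) q := by
  have h := R.isOutgoing hn
  refine ⟨_, h, ?_⟩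
  rintro ⟨w, y⟩ ⟨h1, h2, h3⟩
  obtain ⟨e1, e2⟩ := tendsto_of_tendsto_norm_add h3 (S.isFree_zPlus hn h1 h2).tendsto_deriv
  obtain ⟨e3, e4⟩ := tendsto_of_tendsto_norm_add h.2.2
    (S.isFree_zPlus hn h.1 h.2.1).tendsto_deriv
  obtain rfl : w = S.outVelocity v x := tendsto_nhds_unique e1 e3
  have e5 := e4.sub e2
  simp only [sub_zero, sub_sub_sub_cancel_left, add_sub_add_left_eq_sub] at e5
  exact Prod.ext rfl (sub_eq_zero.1 (tendsto_nhds_unique tendsto_const_nhds e5))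

theorem HighEnergy.scat_eq (hn : 2 ≤ n) (R : S.HighEnergy v x) :
    S.scat v x = (S.outVelocity v x, S.outPosition v x) :=
  (R.existsUnique_isOutgoing hn).unique
    (Classical.epsilon_spec (R.existsUnique_isOutgoing hn).exists) (R.isOutgoing hn)

theorem HighEnergy.a_eq (hn : 2 ≤ n) (R : S.HighEnergy v x) : S.a v x = S.outVelocity v x := by
  rw [a, R.scat_eq hn]

theorem HighEnergy.b_eq (hn : 2 ≤ n) (R : S.HighEnergy v x) : S.b v x = S.outPosition v x := by
  rw [b, R.scat_eq hn]

theorem HighEnergy.mem_domain (hn : 2 ≤ n) (R : S.HighEnergy v x) : (v, x) ∈ S.domain := by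
  refine ⟨R.muL_le hn, R.v_lt, S.existsUnique_isFree_atBot hn (R.muL_le hn) R.v_lt,
    R.existsUnique_isIncoming hn, R.existsUnique_isOutgoing hn, ?_⟩
  rw [R.a_eq hn]
  exact S.existsUnique_isFree_atTop hn (R.muL_le_outVelocity hn) outVelocity_lt

end Setting

/-! ### Integrals along straight lines -/

section Reflection

variable {E : Type*} [NormedAddCommGroup E] {f : ℝ → E}

theorem integrableOn_Ioi_of_comp_neg {a : ℝ} (h : IntegrableOn (fun t => f (-t)) (Iic (-a))) :
    IntegrableOn f (Ioi a) := by
  have := (MeasurePreserving.integrableOn_comp_preimage (Measure.measurePreserving_neg volume)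
    (Homeomorph.neg ℝ).measurableEmbedding).2 h
  simp only [Function.comp_def, neg_neg] at this
  refine this.mono_set fun t ht => ?_
  have : a < t := ht
  simp only [mem_preimage, mem_Iic]
  linarith

variable [NormedSpace ℝ E]

theorem integral_Ioi_eq_integral_Iic (f : ℝ → E) (a : ℝ) :
    ∫ t in Ioi a, f t = ∫ t in Iic (-a), f (-t) := by
  rw [integral_comp_neg_Iic, neg_neg]

theorem integral_Iic_comp_mul_left (f : ℝ → E) (a : ℝ) {b : ℝ} (hb : 0 < b) :
    ∫ t in Iic a, f (b * t) = b⁻¹ • ∫ t in Iic (b * a), f t := by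
  have h1 := integral_comp_neg_Iic a fun t => f (b * -t)
  have h2 := integral_comp_neg_Iic (b * a) fun t => f (-t)
  simp only [neg_neg, mul_neg] at h1 h2
  rw [h1, h2, integral_comp_mul_left_Ioi (fun t => f (-t)) _ hb, mul_neg]

theorem integral_smul_add_smul {μ : Measure ℝ} {g : ℝ → E} (hf : Integrable f μ)
    (hg : Integrable g μ) (a b : ℝ) :
    ∫ t, (a • f t + b • g t) ∂μ = a • (∫ t, f t ∂μ) + b • ∫ t, g t ∂μ := by
  have := integral_add (hf.smul a) (hg.smul b)
  simpa only [Pi.smul_apply, integral_smul] using this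

end Reflection

theorem EMField.force_smul {n : ℕ} (f : EMField n) (c : ℝ) (x w : Sp n) (k : ℝ) :
    f.force c x (k • w) = (1 - k) • f.force c x 0 + k • f.force c x w := by
  simp only [EMField.force, WithLp.ofLp_smul, Matrix.mulVec_smul, WithLp.toLp_smul,
    WithLp.ofLp_zero, Matrix.mulVec_zero, WithLp.toLp_zero]
  module

theorem continuous_along_line {n : ℕ} {G : Sp n → Sp n → Sp n}
    (hG : Continuous fun q : Sp n × Sp n => G q.1 q.2) (θ x w : Sp n) :
    Continuous fun t : ℝ => G (t • θ + x) w :=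
  have h : Continuous fun t : ℝ => (t • θ + x, w) := by fun_prop
  hG.comp h

namespace Setting

variable {n : ℕ} {S : Setting n} {θ x w : Sp n}

theorem continuous_Fl_line (S : Setting n) (θ x w : Sp n) :
    Continuous fun t : ℝ => S.Fl (t • θ + x) w :=
  continuous_along_line (G := S.Fl) (S.l.continuous_force S.c) θ x w

theorem continuous_Fs_line (S : Setting n) (θ x w : Sp n) :
    Continuous fun t : ℝ => S.Fs (t • θ + x) w :=
  continuous_along_line (G := S.Fs) (S.s.continuous_force S.c) θ x w

section Bounds

variable (hn : 2 ≤ n) (hθ : ‖θ‖ = 1) (hx : inner ℝ θ x = 0) (hw : ‖w‖ ≤ 2 * S.c)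
include hn hθ hx hw

theorem norm_Fl_line_le (t : ℝ) :
    ‖S.Fl (t • θ + x) w‖ ≤ 6 * (n * S.βl 1) * wt 1 (S.α + 1) t := by
  have := S.βl_pos 1 (by norm_num)
  exact (S.forceDecay_Fl (by omega)).tube_bound (by positivity) (by linarith [S.α_pos])
    (by linarith [S.α_le_one]) hθ hx (line_mem_tube θ x t) hw

theorem norm_Fs_line_le (t : ℝ) :
    ‖S.Fs (t • θ + x) w‖ ≤ 6 * (n * S.βs 2) * wt 1 (S.α + 1 + 1) t := by
  have := S.βs_pos 2 (by norm_num) (by norm_num)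
  have := (S.forceDecay_Fs (by omega)).tube_bound (by positivity) (by linarith [S.α_pos])
    (by linarith [S.α_le_one]) hθ hx (line_mem_tube θ x t) hw
  rwa [show S.α + 2 = S.α + 1 + 1 by ring] at this

theorem integrable_Fs_line : Integrable fun t : ℝ => S.Fs (t • θ + x) w :=
  integrable_of_wt_bound (K₂ := 0) (S.continuous_Fs_line θ x w) one_pos
    (add_pos S.α_pos one_pos) S.α_pos fun t => by simpa using norm_Fs_line_le hn hθ hx hw t

theorem integrable_F_line : Integrable fun t : ℝ => S.F (t • θ + x) w :=
  (integrable_of_wt_bound (K₂ := 0) (S.continuous_Fl_line θ x w) one_pos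
    S.α_pos S.α_pos fun t => by simpa using norm_Fl_line_le hn hθ hx hw t).add
    (integrable_Fs_line hn hθ hx hw)

theorem integrable_iter_past :
    IntegrableOn (fun σ : ℝ => ∫ τ in Iic σ, S.Fs (τ • θ + x) w) (Iic 0) :=
  integrableOn_Iic_of_norm_le_wt (continuous_integral_Iic (S.continuous_Fs_line θ x w)
    (integrable_Fs_line hn hθ hx hw).integrableOn (a := 0)) one_pos S.α_pos fun _ ht =>
    norm_integral_Iic_le_wt one_pos (add_pos S.α_pos one_pos) ht fun τ _ =>
      norm_Fs_line_le hn hθ hx hw τ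

end Bounds

theorem iter_future_eq (S : Setting n) (θ x w : Sp n) (σ : ℝ) :
    ∫ τ in Ioi σ, S.Fs (τ • θ + x) w = ∫ τ in Iic (-σ), S.Fs (τ • -θ + x) w := by
  rw [integral_Ioi_eq_integral_Iic]
  simp

theorem integrable_iter_future (hn : 2 ≤ n) (hθ : ‖θ‖ = 1) (hx : inner ℝ θ x = 0)
    (hw : ‖w‖ ≤ 2 * S.c) :
    IntegrableOn (fun σ : ℝ => ∫ τ in Ioi σ, S.Fs (τ • θ + x) w) (Ioi 0) := by
  refine integrableOn_Ioi_of_comp_neg ?_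
  simp only [iter_future_eq, neg_neg, neg_zero]
  exact integrable_iter_past hn (by rwa [norm_neg]) (by rw [inner_neg_left, hx, neg_zero]) hw

theorem norm_Vs_line_le (hθ : ‖θ‖ = 1) (hx : inner ℝ θ x = 0) (t : ℝ) :
    ‖S.s.V (t • θ + x)‖ ≤ S.βs 1 * 2 * wt 1 (S.α + 1) t := by
  have h := S.shortRange.1 [] (by simp) (t • θ + x)
  simp only [pderivs, List.length_nil, Nat.cast_zero, add_zero, zero_add] at h
  have hβ := S.βs_pos 1 (by norm_num) (by norm_num)
  have hα := S.α_pos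
  have h1 := one_le_base (zero_le_one (α := ℝ)) t
  have h2 := le_norm_of_mem_tube hx (line_mem_tube θ x t)
  rw [hθ] at h2
  calc _ ≤ S.βs 1 * (1 + ‖t • θ + x‖) ^ (-(S.α + 1)) := h
    _ ≤ S.βs 1 * (7 / 8 * (1 + 1 * |t|)) ^ (-(S.α + 1)) := by
        refine mul_le_mul_of_nonneg_left ?_ hβ.le
        exact Real.rpow_le_rpow_of_nonpos (by positivity) h2 (by linarith)
    _ ≤ S.βs 1 * (2 * (1 + 1 * |t|) ^ (-(S.α + 1))) := by
        gcongr
        exact rpow_seven_eighths_le (by linarith [S.α_le_one]) h1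
    _ = _ := by rw [wt]; ring

theorem continuous_Vs_line (S : Setting n) (θ x : Sp n) :
    Continuous fun t : ℝ => S.s.V (t • θ + x) :=
  S.s.contDiff_V.continuous.comp (by fun_prop)

theorem integrable_Vs_line (hθ : ‖θ‖ = 1) (hx : inner ℝ θ x = 0) :
    Integrable fun t : ℝ => S.s.V (t • θ + x) :=
  integrable_of_wt_bound (K₂ := 0) (S.continuous_Vs_line θ x) one_pos S.α_pos S.α_pos
    fun t => by simpa using norm_Vs_line_le hθ hx t

theorem lineIntegralsConverge (hn : 2 ≤ n) (hθ : ‖θ‖ = 1) (hx : inner ℝ θ x = 0)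
    (hw : ‖w‖ ≤ 2 * S.c) : S.LineIntegralsConverge θ x w :=
  ⟨integrable_F_line hn hθ hx hw, integrable_Fs_line hn hθ hx hw,
    integrable_iter_past hn hθ hx hw, integrable_iter_future hn hθ hx hw,
    integrable_Vs_line hθ hx⟩

/-- The component of the short range force along the line is the derivative of the potential, as
the magnetic force is orthogonal to the velocity. -/
theorem inner_integral_Fs_past (hn : 2 ≤ n) (hθ : ‖θ‖ = 1) (hx : inner ℝ θ x = 0) {k : ℝ}
    (hk : k ≠ 0) (hkc : |k| ≤ 2 * S.c) (σ : ℝ) :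
    inner ℝ θ (∫ τ in Iic σ, S.Fs (τ • θ + x) (k • θ)) = -S.s.V (σ • θ + x) := by
  have hw : ‖k • θ‖ ≤ 2 * S.c := by rw [norm_smul, hθ, mul_one]; exact hkc
  have hi := (integrable_Fs_line (S := S) hn hθ hx hw).integrableOn (s := Iic σ)
  have hd : ∀ τ : ℝ, HasDerivAt (fun τ : ℝ => -S.s.V (τ • θ + x))
      (inner ℝ θ (S.Fs (τ • θ + x) (k • θ))) τ := fun τ => by
    have h1 : HasDerivAt (fun τ : ℝ => τ • θ + x) θ τ := by
      have := ((hasDerivAt_id τ).smul_const θ).add_const x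
      rwa [one_smul] at this
    have h2 := (((S.s.contDiff_V.differentiable (by norm_num)) _).hasFDerivAt.comp_hasDerivAt τ
      h1).neg
    refine h2.congr_deriv ?_
    have h3 := S.s.inner_force S.c (τ • θ + x) (k • θ)
    rw [inner_smul_left, map_smul, smul_eq_mul] at h3
    simp only [conj_trivial] at h3
    rw [Fs]
    exact (mul_left_cancel₀ hk (by rw [h3]; ring)).symm
  have hlim : Tendsto (fun τ : ℝ => -S.s.V (τ • θ + x)) atBot (𝓝 0) := by
    have h := (tendsto_wt_atBot one_pos (by linarith [S.α_pos] : 0 < S.α + 1)).const_mul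
      (S.βs 1 * 2)
    rw [mul_zero] at h
    exact squeeze_zero_norm (fun t => by rw [norm_neg]; exact norm_Vs_line_le hθ hx t) h
  have h := integral_Iic_of_hasDerivAt_of_tendsto' (a := σ) (fun τ _ => hd τ)
    ((innerSL ℝ θ).integrable_comp hi) hlim
  rw [sub_zero] at h
  rw [← h]
  exact (ContinuousLinearMap.integral_comp_comm (innerSL ℝ θ) hi).symm

theorem inner_integral_Fs_future (hn : 2 ≤ n) (hθ : ‖θ‖ = 1) (hx : inner ℝ θ x = 0) {k : ℝ}
    (hk : k ≠ 0) (hkc : |k| ≤ 2 * S.c) (σ : ℝ) :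
    inner ℝ θ (∫ τ in Ioi σ, S.Fs (τ • θ + x) (k • θ)) = S.s.V (σ • θ + x) := by
  have h := inner_integral_Fs_past (S := S) hn (θ := -θ) (x := x) (k := -k) (by rwa [norm_neg])
    (by rw [inner_neg_left, hx, neg_zero]) (neg_ne_zero.2 hk) (by rwa [abs_neg]) (-σ)
  simp only [smul_neg, neg_smul, neg_neg, inner_neg_left, neg_inj] at h
  rw [iter_future_eq]
  simpa using h

theorem inner_iterFs (hn : 2 ≤ n) (hθ : ‖θ‖ = 1) (hx : inner ℝ θ x = 0) {k : ℝ}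
    (hk : k ≠ 0) (hkc : |k| ≤ 2 * S.c) :
    inner ℝ θ (S.iterFs θ x (k • θ)) = -∫ σ : ℝ, S.s.V (σ • θ + x) := by
  have hw : ‖k • θ‖ ≤ 2 * S.c := by rw [norm_smul, hθ, mul_one]; exact hkc
  have h1 := ContinuousLinearMap.integral_comp_comm (innerSL ℝ θ)
    (integrable_iter_past (S := S) hn hθ hx hw)
  have h2 := ContinuousLinearMap.integral_comp_comm (innerSL ℝ θ)
    (integrable_iter_future (S := S) hn hθ hx hw)
  simp only [innerSL_apply_apply, inner_integral_Fs_past hn hθ hx hk hkc,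
    inner_integral_Fs_future hn hθ hx hk hkc] at h1 h2
  have hi := integrable_Vs_line (S := S) hθ hx
  rw [iterFs, inner_sub_right, ← h1, ← h2, integral_neg,
    ← intervalIntegral.integral_Iic_add_Ioi (b := 0) hi.integrableOn hi.integrableOn]
  ring

/-- Change of parametrization of the line. -/
theorem integral_F_smul {ρ : ℝ} (hρ : 0 < ρ) :
    ∫ τ : ℝ, S.F (τ • (ρ • θ) + x) w = ρ⁻¹ • S.lineF θ x w := by
  have h := Measure.integral_comp_mul_left (fun τ : ℝ => S.F (τ • θ + x) w) ρ
  rw [abs_of_pos (inv_pos.2 hρ)] at h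
  rw [lineF, ← h]
  simp only [smul_smul, mul_comm]

theorem iter_Fs_smul {ρ : ℝ} (hρ : 0 < ρ) : S.iterFs (ρ • θ) x w = (ρ ^ 2)⁻¹ • S.iterFs θ x w := by
  have h1 : ∀ σ : ℝ, ∫ τ in Iic σ, S.Fs (τ • (ρ • θ) + x) w
      = ρ⁻¹ • ∫ τ in Iic (ρ * σ), S.Fs (τ • θ + x) w := fun σ => by
    rw [← integral_Iic_comp_mul_left _ _ hρ]
    simp only [smul_smul, mul_comm]
  have h2 : ∀ σ : ℝ, ∫ τ in Ioi σ, S.Fs (τ • (ρ • θ) + x) w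
      = ρ⁻¹ • ∫ τ in Ioi (ρ * σ), S.Fs (τ • θ + x) w := fun σ => by
    rw [← integral_comp_mul_left_Ioi (fun τ : ℝ => S.Fs (τ • θ + x) w) _ hρ]
    simp only [smul_smul, mul_comm]
  simp only [iterFs, h1, h2, integral_smul]
  rw [integral_Iic_comp_mul_left (fun t => ∫ τ in Iic t, S.Fs (τ • θ + x) w) _ hρ,
    integral_comp_mul_left_Ioi (fun t => ∫ τ in Ioi t, S.Fs (τ • θ + x) w) _ hρ, mul_zero,
    smul_smul, smul_smul, ← smul_sub]
  congr 1
  ring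

theorem lineF_smul_velocity (hn : 2 ≤ n) (hθ : ‖θ‖ = 1) (hx : inner ℝ θ x = 0)
    (hw : ‖w‖ ≤ 2 * S.c) (k : ℝ) :
    S.lineF θ x (k • w) = (1 - k) • S.lineF θ x 0 + k • S.lineF θ x w := by
  have h0 : ‖(0 : Sp n)‖ ≤ 2 * S.c := by have := S.c_pos; rw [norm_zero]; positivity
  simp only [lineF]
  rw [← integral_smul_add_smul (integrable_F_line hn hθ hx h0) (integrable_F_line hn hθ hx hw)]
  refine integral_congr_ae (ae_of_all _ fun τ => ?_)
  simp only [F, Fl, Fs, EMField.force_smul _ _ _ w k]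
  module

theorem iterFs_smul_velocity (hn : 2 ≤ n) (hθ : ‖θ‖ = 1) (hx : inner ℝ θ x = 0)
    (hw : ‖w‖ ≤ 2 * S.c) (k : ℝ) :
    S.iterFs θ x (k • w) = (1 - k) • S.iterFs θ x 0 + k • S.iterFs θ x w := by
  have h0 : ‖(0 : Sp n)‖ ≤ 2 * S.c := by have := S.c_pos; rw [norm_zero]; positivity
  have hs : ∀ s : Set ℝ, ∫ τ in s, S.Fs (τ • θ + x) (k • w)
      = (1 - k) • (∫ τ in s, S.Fs (τ • θ + x) 0) + k • ∫ τ in s, S.Fs (τ • θ + x) w := fun s => by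
    rw [← integral_smul_add_smul (integrable_Fs_line hn hθ hx h0).integrableOn
      (integrable_Fs_line hn hθ hx hw).integrableOn]
    simp only [Fs, EMField.force_smul _ _ _ w k]
  simp only [iterFs, hs]
  rw [integral_smul_add_smul (integrable_iter_past hn hθ hx h0) (integrable_iter_past hn hθ hx hw),
    integral_smul_add_smul (integrable_iter_future hn hθ hx h0)
      (integrable_iter_future hn hθ hx hw)]
  module

end Setting

/-! ### Error estimates for the scattering data -/

theorem Dmap_neg {n : ℕ} (c : ℝ) (v : Sp n) : Dmap c (-v) = Dmap c v := by
  ext1 k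
  simp only [Dmap_apply, norm_neg, inner_neg_left]
  module

namespace Setting

variable {n : ℕ} {S : Setting n} {v x θ : Sp n}

theorem rev_Fl_reverse (S : Setting n) (z : ℝ → Sp n) (y : Sp n) :
    (fun τ => S.rev.Fl (z (-τ) + y) (deriv (fun t => z (-t)) τ))
      = fun τ => S.FlAlong z y (-τ) := by
  funext τ
  simp only [rev_Fl, deriv_comp_neg', neg_neg, FlAlong]

theorem HighEnergy.WPast_eq (hn : 2 ≤ n) (R : S.HighEnergy v x) {σ : ℝ} (hσ : σ ≤ 0) :
    S.WPast v x σ = shiftedVelocity S.Fl S.c v x (S.zMinus v) σ - deriv (S.zMinus v) σ := by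
  rw [← (R.incoming_past hn).shiftedVelocity_zero hσ]
  rfl

/-- The velocity of the free motion after the collision, displaced by `y`, read backwards. -/
theorem shiftedVelocity_reverse (S : Setting n) (a y : Sp n) (z : ℝ → Sp n) (σ : ℝ) :
    shiftedVelocity S.rev.Fl S.c (-a) y (fun t => z (-t)) (-σ)
      = -gmap S.c (ginv S.c a - ∫ τ in Ioi σ, S.FlAlong z y τ) := by
  rw [shiftedVelocity, rev_Fl_reverse, ← gmap_neg, integral_Ioi_eq_integral_Iic, ginv_neg]
  congr 1
  abel

theorem HighEnergy.WFuture_eq (hn : 2 ≤ n) (R : S.HighEnergy v x) {σ : ℝ} (hσ : 0 ≤ σ) :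
    S.WFuture v x σ = -(shiftedVelocity S.rev.Fl S.c (-S.outVelocity v x) x
      (fun t => S.zPlus (S.outVelocity v x) (-t)) (-σ)
        - deriv (fun t => S.zPlus (S.outVelocity v x) (-t)) (-σ)) := by
  rw [← (R.incoming_future hn).shiftedVelocity_zero (neg_nonpos.2 hσ), shiftedVelocity_reverse,
    shiftedVelocity_reverse, WFuture, R.a_eq hn]
  abel

theorem HighEnergy.wConverges (hn : 2 ≤ n) (R : S.HighEnergy v x) : S.WConverges v x := by
  have hp := R.incoming_past hn
  have hf := R.incoming_future hn
  have h1 := hf.integrable_long_shift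
  have h2 := hf.integrable_long_free
  have h3 := S.rev_Fl_reverse (S.zPlus (S.outVelocity v x)) 0
  simp only [add_zero] at h3
  rw [h3] at h2
  rw [rev_Fl_reverse] at h1
  refine ⟨hp.integrable_long_shift, ?_, ?_, ?_, ?_, ?_⟩
  · refine hp.integrable_long_free.congr_fun (fun τ _ => ?_) measurableSet_Iic
    simp only [FlAlong, add_zero]
  · rw [R.a_eq hn]
    exact integrableOn_Ioi_of_comp_neg (by simpa using h1)
  · rw [R.a_eq hn]
    exact integrableOn_Ioi_of_comp_neg (by simpa using h2)
  · exact hp.integrable_shiftedVelocity_sub.congr_fun (fun σ hσ => (R.WPast_eq hn hσ).symm)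
      measurableSet_Iic
  · refine integrableOn_Ioi_of_comp_neg ?_
    rw [neg_zero]
    refine hf.integrable_shiftedVelocity_sub.neg.congr_fun (fun σ hσ => ?_) measurableSet_Iic
    simp only [R.WFuture_eq hn (neg_nonneg.2 hσ), neg_neg, Pi.neg_apply]

/-- The change of impulse is the total force along the trajectory. -/
theorem HighEnergy.asc_eq (hn : 2 ≤ n) (R : S.HighEnergy v x) :
    (1 / √(1 - ‖v‖ ^ 2 / S.c ^ 2)) • S.asc v x
      = ∫ τ, S.F (S.sol v x τ) (deriv (S.sol v x) τ) := by
  have h : ginv S.c (S.outVelocity v x)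
      = ginv S.c v + ∫ τ, S.F (S.sol v x τ) (deriv (S.sol v x) τ) := ginv_gmap S.c_pos _
  rw [asc, R.a_eq hn, smul_sub]
  rw [ginv, ginv, R.norm_outVelocity hn] at h
  rw [h, add_sub_cancel_left]

theorem HighEnergy.norm_integral_force_sub_le (hn : 2 ≤ n) (R : S.HighEnergy v x) :
    ‖(∫ τ, S.F (S.sol v x τ) (deriv (S.sol v x) τ)) - ∫ τ : ℝ, S.F (τ • v + x) v‖
      ≤ 1536 * (n ^ 2 * S.β) * smallness S.c S.α (n ^ 2 * S.β) v x / (S.α * ‖v‖) := by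
  have hi := R.integrable_force_sol hn
  have hi' : Integrable fun τ : ℝ => S.F (τ • v + x) v :=
    Regime.integrable_force_univ R (X := fun τ : ℝ => τ • v + x) (w := fun _ => v)
      (Incoming.continuous_line v x) continuous_const (fun t => line_mem_tube v x t)
      fun _ => (R.incoming_past hn).norm_velocity_le
  have h1 := (R.incoming_past hn).norm_integral_force_sub_line_le
  have h2 := (R.incoming_future hn).norm_integral_force_sub_line_le
  rw [smallness_neg, norm_neg] at h2
  have e1 : (∫ τ in Iic 0, (S.rev.Fl (S.sol v x (-τ)) (deriv (fun t => S.sol v x (-t)) τ)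
      + S.rev.Fs (S.sol v x (-τ)) (deriv (fun t => S.sol v x (-t)) τ)))
      = ∫ τ in Ioi 0, S.F (S.sol v x τ) (deriv (S.sol v x) τ) := by
    rw [integral_Ioi_eq_integral_Iic, neg_zero]
    simp only [rev_Fl, rev_Fs, deriv_comp_neg', neg_neg, F]
  have e2 : (∫ τ in Iic (0 : ℝ), (S.rev.Fl (τ • -v + x) (-v) + S.rev.Fs (τ • -v + x) (-v)))
      = ∫ τ in Ioi (0 : ℝ), S.F (τ • v + x) v := by
    rw [integral_Ioi_eq_integral_Iic, neg_zero]
    simp only [rev_Fl, rev_Fs, neg_neg, F, smul_neg, neg_smul]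
  rw [e1, e2] at h2
  rw [← intervalIntegral.integral_Iic_add_Ioi (b := 0) hi.integrableOn hi.integrableOn,
    ← intervalIntegral.integral_Iic_add_Ioi (b := 0) hi'.integrableOn hi'.integrableOn,
    add_sub_add_comm]
  exact (norm_add_le _ _).trans ((add_le_add h1 h2).trans_eq (by ring))

theorem HighEnergy.norm_asc_sub_le {ρ : ℝ} (hn : 2 ≤ n) (hρ : 0 < ρ) (hθ : ‖θ‖ = 1)
    (R : S.HighEnergy (ρ • θ) x) :
    ‖(ρ / √(1 - ρ ^ 2 / S.c ^ 2)) • S.asc (ρ • θ) x - S.lineF θ x (ρ • θ)‖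
      ≤ 1536 * (n ^ 2 * S.β) * smallness S.c S.α (n ^ 2 * S.β) (ρ • θ) x / S.α := by
  have hv : ‖ρ • θ‖ = ρ := by rw [norm_smul, hθ, mul_one, Real.norm_of_nonneg hρ.le]
  have h1 := R.asc_eq hn
  have h2 := R.norm_integral_force_sub_le hn
  have hα := S.α_pos
  rw [integral_F_smul hρ] at h2
  rw [hv] at h1 h2
  have e : (ρ / √(1 - ρ ^ 2 / S.c ^ 2)) • S.asc (ρ • θ) x - S.lineF θ x (ρ • θ)
      = ρ • ((∫ τ, S.F (S.sol (ρ • θ) x τ) (deriv (S.sol (ρ • θ) x) τ))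
        - ρ⁻¹ • S.lineF θ x (ρ • θ)) := by
    rw [← h1, smul_sub, smul_smul, smul_smul, mul_inv_cancel₀ hρ.ne', one_smul, mul_one_div]
  rw [e, norm_smul, Real.norm_of_nonneg hρ.le]
  calc _ ≤ _ := mul_le_mul_of_nonneg_left h2 hρ.le
    _ = _ := by field_simp

theorem HighEnergy.bsc_sub_W_eq (hn : 2 ≤ n) (R : S.HighEnergy v x) :
    S.bsc v x - S.W v x
      = ((∫ t in Iic 0, (deriv (S.sol v x) t - deriv (S.zMinus v) t))
          - ∫ t in Iic 0, (shiftedVelocity S.Fl S.c v x (S.zMinus v) t - deriv (S.zMinus v) t))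
        - ((∫ t in Iic 0, (deriv (fun t => S.sol v x (-t)) t
              - deriv (fun t => S.zPlus (S.outVelocity v x) (-t)) t))
          - ∫ t in Iic 0, (shiftedVelocity S.rev.Fl S.c (-S.outVelocity v x) x
              (fun t => S.zPlus (S.outVelocity v x) (-t)) t
              - deriv (fun t => S.zPlus (S.outVelocity v x) (-t)) t)) := by
  have h1 : ∫ σ in Iic 0, S.WPast v x σ = ∫ t in Iic 0,
      (shiftedVelocity S.Fl S.c v x (S.zMinus v) t - deriv (S.zMinus v) t) :=
    setIntegral_congr_fun measurableSet_Iic fun σ hσ => R.WPast_eq hn hσ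
  have h2 : ∫ σ in Ioi 0, S.WFuture v x σ = -∫ t in Iic 0,
      (shiftedVelocity S.rev.Fl S.c (-S.outVelocity v x) x
        (fun t => S.zPlus (S.outVelocity v x) (-t)) t
        - deriv (fun t => S.zPlus (S.outVelocity v x) (-t)) t) := by
    rw [integral_Ioi_eq_integral_Iic, neg_zero, ← integral_neg]
    refine setIntegral_congr_fun measurableSet_Iic fun σ hσ => ?_
    simp only [R.WFuture_eq hn (neg_nonneg.2 hσ), neg_neg]
  have h3 := (R.incoming_past hn).integral_deriv_sub
    (tendsto_of_tendsto_norm_add (R.isIncoming_sol hn).2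
      (S.isFree_zMinus hn (R.muL_le hn) R.v_lt).tendsto_deriv).2
  rw [bsc, R.b_eq hn, outPosition, W, h1, h2, h3]
  abel

theorem HighEnergy.norm_bsc_sub_W_sub_le (hn : 2 ≤ n) (R : S.HighEnergy v x) :
    ‖S.bsc v x - S.W v x - Dmap S.c v (S.iterFs v x v)‖
      ≤ 11328 * √(1 - ‖v‖ ^ 2 / S.c ^ 2) * (n ^ 2 * S.β)
        * smallness S.c S.α (n ^ 2 * S.β) v x / (S.α * (S.α + 1) * ‖v‖ ^ 2) := by
  have h1 := (R.incoming_past hn).norm_integral_deriv_sub_sub_le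
  have h2 := (R.incoming_future hn).norm_integral_deriv_sub_sub_le
  have e : ∫ t in Iic (0 : ℝ), ∫ τ in Iic t, S.rev.Fs (τ • -v + x) (-v)
      = ∫ t in Ioi (0 : ℝ), ∫ τ in Ioi t, S.Fs (τ • v + x) v := by
    rw [integral_Ioi_eq_integral_Iic, neg_zero]
    simp only [rev_Fs, neg_neg, iter_future_eq]
  rw [smallness_neg, norm_neg, Dmap_neg, e] at h2
  rw [R.bsc_sub_W_eq hn, iterFs, map_sub, sub_sub_sub_comm]
  exact (norm_sub_le _ _).trans ((add_le_add h1 h2).trans_eq (by ring))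

theorem HighEnergy.norm_bsc_sub_le {ρ : ℝ} (hn : 2 ≤ n) (hρ : 0 < ρ) (hθ : ‖θ‖ = 1)
    (R : S.HighEnergy (ρ • θ) x) :
    ‖(ρ ^ 2 / √(1 - ρ ^ 2 / S.c ^ 2)) • (S.bsc (ρ • θ) x - S.W (ρ • θ) x)
        - S.iterFs θ x (ρ • θ) - (∫ σ : ℝ, S.s.V (σ • θ + x)) • ((ρ ^ 2 / S.c ^ 2) • θ)‖
      ≤ 11328 * (n ^ 2 * S.β) * smallness S.c S.α (n ^ 2 * S.β) (ρ • θ) x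
        / (S.α * (S.α + 1)) := by
  have hv : ‖ρ • θ‖ = ρ := by rw [norm_smul, hθ, mul_one, Real.norm_of_nonneg hρ.le]
  have hx : inner ℝ θ x = 0 := by
    have := R.orth
    rw [inner_smul_left] at this
    exact (mul_eq_zero.1 this).resolve_left (by simpa using hρ.ne')
  have hρc : ρ < S.c := by have := R.v_lt; rwa [hv] at this
  have h1 := R.norm_bsc_sub_W_sub_le hn
  have hα := S.α_pos
  have hc := S.c_pos
  have hs := R.s_pos
  have hinner := inner_iterFs (S := S) (x := x) hn hθ hx hρ.ne'
    (by rw [abs_of_pos hρ]; linarith)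
  rw [iter_Fs_smul hρ, Dmap_apply] at h1
  rw [hv] at h1 hs
  rw [inner_smul_left, inner_smul_right, hinner] at h1
  simp only [conj_trivial] at h1
  have hs2 : 0 < ρ ^ 2 / √(1 - ρ ^ 2 / S.c ^ 2) := by positivity
  generalize √(1 - ρ ^ 2 / S.c ^ 2) = s at *
  generalize (∫ σ : ℝ, S.s.V (σ • θ + x)) = V at *
  generalize S.iterFs θ x (ρ • θ) = J at *
  have e : (ρ ^ 2 / s) • (S.bsc (ρ • θ) x - S.W (ρ • θ) x) - J - V • ((ρ ^ 2 / S.c ^ 2) • θ)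
      = (ρ ^ 2 / s) • (S.bsc (ρ • θ) x - S.W (ρ • θ) x - s • ((ρ ^ 2)⁻¹ • J
        - (ρ * ((ρ ^ 2)⁻¹ * -V) / S.c ^ 2) • ρ • θ)) := by
    match_scalars <;> field_simp
  rw [e, norm_smul, Real.norm_of_nonneg hs2.le]
  calc _ ≤ _ := mul_le_mul_of_nonneg_left h1 hs2.le
    _ = _ := by field_simp

end Setting

/-! ### The threshold speed and the explicit error bounds -/

theorem two_rpow_three_halves : (2 : ℝ) ^ (3 / 2 : ℝ) = 2 * √2 := by
  rw [show (3 / 2 : ℝ) = 1 + 1 / 2 by norm_num, Real.rpow_add two_pos, Real.rpow_one,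
    ← Real.sqrt_eq_rpow]

theorem two_rpow_mul_lt {r c : ℝ} (h : r < (2 : ℝ) ^ (-(3 / 2) : ℝ) * c) :
    (2 : ℝ) ^ (3 / 2 : ℝ) * r < c := by
  have h0 : (0 : ℝ) < 2 ^ (3 / 2 : ℝ) := by positivity
  rw [Real.rpow_neg two_pos.le, inv_mul_eq_div, lt_div_iff₀ h0] at h
  linarith

/-- The smallness condition at speeds above `ρ₀`. -/
theorem small_of_rhoZero_lt {n : ℕ} {c σ r β α ρ : ℝ} (hn : 0 < n) (hc : 0 < c) (hσ : 0 ≤ σ)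
    (hβ : 0 < β) (hα : 0 < α) (hr : 0 < r) (hr1 : r < 1) (hrc : (2 : ℝ) ^ (3 / 2 : ℝ) * r < c)
    (hρ : rhoZero n c σ r β α < ρ) :
    0 < ρ ∧ 0 < ρ / (2 * √2) - r ∧
      1728 * (√(1 - ρ ^ 2 / c ^ 2) * (n ^ 2 * β) * (1 + σ)) ≤ α * ρ ^ 2 := by
  obtain ⟨⟨h1, h2⟩, h3⟩ : IsRhoRoot n c σ r β α (rhoZero n c σ r β α) :=
    Classical.epsilon_spec (existsUnique_isRhoRoot hn hc hσ hβ hα hr hr1 hrc).exists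
  generalize rhoZero n c σ r β α = ρ₀ at *
  rw [two_rpow_three_halves] at h1
  have hk : 0 < 2 * √2 := by positivity
  have hρ₀ : 0 < ρ₀ := lt_trans (by positivity) h1
  have hρ0 : 0 < ρ := hρ₀.trans hρ
  have hu₀ : 0 < ρ₀ / (2 * √2) - r := by
    rw [sub_pos, lt_div_iff₀ hk]; linarith
  have huu : ρ₀ / (2 * √2) - r ≤ ρ / (2 * √2) - r := by gcongr
  have hu : 0 < ρ / (2 * √2) - r := hu₀.trans_le huu
  refine ⟨hρ0, hu, ?_⟩
  have hq : 0 < (1 - r) ^ (α + 2) := Real.rpow_pos_of_pos (by linarith) _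
  have hle : rhoFun n c σ r β α ρ ≤ rhoFun n c σ r β α ρ₀ := by
    rw [rhoFun, rhoFun, two_rpow_three_halves]
    gcongr
  rw [← h3, rhoFun, two_rpow_three_halves, div_le_one (by positivity)] at hle
  have hu8 : (ρ / (2 * √2) - r) ^ 2 ≤ ρ ^ 2 / 8 := by
    have h4 : (ρ / (2 * √2)) ^ 2 = ρ ^ 2 / 8 := by
      rw [div_pow, mul_pow, Real.sq_sqrt two_pos.le]; norm_num
    rw [← h4]
    gcongr
    linarith
  have hq2 : (1 - r) ^ (α + 2) ≤ (1 - r) ^ 2 := by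
    rw [← Real.rpow_natCast]
    exact Real.rpow_le_rpow_of_exponent_ge (by linarith) (by linarith) (by push_cast; linarith)
  -- the maximum of `r(1-r)²` on `[0,1]` is attained at `r = 1/3`
  have hmax : r * (1 - r) ^ 2 ≤ 4 / 27 := by
    nlinarith [mul_nonneg (sq_nonneg (3 * r - 1)) (show 0 ≤ 4 - 3 * r by linarith)]
  have hs := Real.sqrt_nonneg (1 - ρ ^ 2 / c ^ 2)
  generalize ρ / (2 * √2) - r = u at *
  generalize √(1 - ρ ^ 2 / c ^ 2) = s at *
  have h5 : 32 * (s * (n ^ 2 * β) * (1 + σ)) / u ≤ α * u * (4 / 27) := by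
    calc 32 * (s * (n ^ 2 * β) * (1 + σ)) / u = 32 * n ^ 2 * s * β * (1 + σ + 0) * (0 + 1 / u) := by
          ring
      _ ≤ 32 * n ^ 2 * s * β * (1 + σ + 1 / c) * (1 + 1 / u) := by
          gcongr
          · positivity
          · norm_num
      _ ≤ α * u * r * (1 - r) ^ (α + 2) := hle
      _ ≤ α * u * r * (1 - r) ^ 2 := by gcongr
      _ = α * u * (r * (1 - r) ^ 2) := by ring
      _ ≤ _ := by gcongr
  rw [div_le_iff₀ hu] at h5
  nlinarith

theorem four_div_le (u : ℝ) : 4 / u ≤ (1 + 1 / u) ^ 2 := by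
  have : (1 + 1 / u) ^ 2 = 4 / u + (1 - 1 / u) ^ 2 := by ring
  have := sq_nonneg (1 - 1 / u)
  linarith

/-- Compares an error in terms of `ρ` with one in terms of `u = ρ / 2^(3/2) - r`: of the powers of
`u ≤ ρ / 2` in the denominator, one is absorbed by `4 / u ≤ (1 + 1 / u) ^ 2`, and the factor `q`,
a power of `1 - r`, only helps. -/
theorem velocity_error_le {n ρ u q s β α A B σ : ℝ} (hρ : 0 < ρ) (hu : 0 < u) (huρ : u ≤ ρ / 2)
    (hq : 0 < q) (hq1 : q ≤ 1) (hs : 0 ≤ s) (hα : 0 < α) (hσ : 0 ≤ σ)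
    (hA : 1 + σ ≤ A) (hB : 1 ≤ B) :
    1536 * (n ^ 2 * β) * (s * (n ^ 2 * β) * (1 + σ) / (α * ρ ^ 2)) / α
      ≤ β ^ 2 * s * (640 * n ^ 4 * ρ * A * B * (1 + 1 / u) ^ 2 / (α ^ 2 * u ^ 2 * q)) := by
  calc _ = β ^ 2 * s * (1536 * n ^ 4 * (1 + σ) / (α ^ 2 * ρ ^ 2)) := by ring
    _ ≤ β ^ 2 * s * (2560 * n ^ 4 * (1 + σ) / (α ^ 2 * ρ ^ 2)) := by gcongr; norm_num
    _ = β ^ 2 * s * (2560 * n ^ 4 * ρ * (1 + σ) / (α ^ 2 * ρ ^ 3)) := by field_simp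
    _ ≤ β ^ 2 * s * (2560 * n ^ 4 * ρ * (1 + σ) / (α ^ 2 * u ^ 3)) := by
        gcongr
        linarith
    _ = β ^ 2 * s * (640 * n ^ 4 * ρ * (1 + σ) * 1 * (4 / u) / (α ^ 2 * u ^ 2 * 1)) := by
        field_simp; ring
    _ ≤ _ := by
        have := four_div_le u
        have : 0 ≤ n ^ 4 := by positivity
        have : 0 ≤ A := by linarith
        have : 0 ≤ B := by linarith
        gcongr

theorem position_error_le {n ρ u q s β α A B σ : ℝ} (hρ : 0 < ρ) (hu : 0 < u) (huρ : u ≤ ρ / 2)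
    (hq : 0 < q) (hq1 : q ≤ 1) (hs : 0 ≤ s) (hα : 0 < α) (hσ : 0 ≤ σ)
    (hA : 1 + σ ≤ A) (hB : 1 ≤ B) :
    11328 * (n ^ 2 * β) * (s * (n ^ 2 * β) * (1 + σ) / (α * ρ ^ 2)) / (α * (α + 1))
      ≤ β ^ 2 * s * (464 * n ^ 4 * ρ ^ 2 * A * B * (1 + 1 / u) ^ 2
        / (α ^ 2 * (α + 1) * u ^ 3 * q)) := by
  calc _ = β ^ 2 * s * (11328 * n ^ 4 * (1 + σ) / (α ^ 2 * (α + 1) * ρ ^ 2)) := by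
        field_simp
    _ ≤ β ^ 2 * s * (29696 * n ^ 4 * (1 + σ) / (α ^ 2 * (α + 1) * ρ ^ 2)) := by
        gcongr; norm_num
    _ = β ^ 2 * s * (1856 * n ^ 4 * ρ ^ 2 * (1 + σ) / (α ^ 2 * (α + 1) * (ρ / 2) ^ 4)) := by
        field_simp; ring
    _ ≤ β ^ 2 * s * (1856 * n ^ 4 * ρ ^ 2 * (1 + σ) / (α ^ 2 * (α + 1) * u ^ 4)) := by
        gcongr
    _ = β ^ 2 * s * (464 * n ^ 4 * ρ ^ 2 * (1 + σ) * 1 * (4 / u)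
          / (α ^ 2 * (α + 1) * u ^ 3 * 1)) := by field_simp; ring
    _ ≤ _ := by
        have := four_div_le u
        have : 0 ≤ n ^ 4 := by positivity
        have : 0 ≤ A := by linarith
        have : 0 ≤ B := by linarith
        gcongr

namespace Setting

variable {n : ℕ} {S : Setting n} {x θ : Sp n}

theorem highEnergy_of_rhoZero_lt (hn : 2 ≤ n) (hθ : ‖θ‖ = 1) (hx : inner ℝ θ x = 0) {r ρ : ℝ}
    (hr : r ∈ Ioo (0 : ℝ) (min 1 ((2 : ℝ) ^ (-(3 / 2) : ℝ) * S.c)))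
    (hρ : ρ ∈ Ioo (rhoZero n S.c ‖x‖ r S.β S.α) S.c) :
    0 < ρ ∧ 0 < ρ / (2 * √2) - r ∧ S.HighEnergy (ρ • θ) x := by
  obtain ⟨h1, h2, h3⟩ := small_of_rhoZero_lt (by omega) S.c_pos (norm_nonneg x) S.β_pos S.α_pos
    hr.1 (hr.2.trans_le (min_le_left _ _)) (two_rpow_mul_lt (hr.2.trans_le (min_le_right _ _)))
    hρ.1
  have hv : ‖ρ • θ‖ = ρ := by rw [norm_smul, hθ, mul_one, Real.norm_of_nonneg h1.le]
  refine ⟨h1, h2, highEnergy_of_small hn ?_ ?_ ?_ ?_⟩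
  · rwa [hv]
  · rw [hv]; exact hρ.2
  · rw [inner_smul_left, hx, mul_zero]
  · rwa [hv]

/-- All speeds close to `c` are above the threshold for a suitable `r`. -/
theorem eventually_highEnergy (S : Setting n) (hn : 2 ≤ n) (hθ : ‖θ‖ = 1)
    (hx : inner ℝ θ x = 0) : ∀ᶠ ρ in 𝓝[<] S.c, 0 < ρ ∧ S.HighEnergy (ρ • θ) x := by
  have hc := S.c_pos
  have hm : 0 < min 1 ((2 : ℝ) ^ (-(3 / 2) : ℝ) * S.c) := by positivity
  have hr : min 1 ((2 : ℝ) ^ (-(3 / 2) : ℝ) * S.c) / 2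
      ∈ Ioo (0 : ℝ) (min 1 ((2 : ℝ) ^ (-(3 / 2) : ℝ) * S.c)) := ⟨by positivity, by linarith⟩
  have h0 : rhoZero n S.c ‖x‖ (min 1 ((2 : ℝ) ^ (-(3 / 2) : ℝ) * S.c) / 2) S.β S.α < S.c :=
    (Classical.epsilon_spec (existsUnique_isRhoRoot (by omega) hc (norm_nonneg x) S.β_pos S.α_pos
      hr.1 (hr.2.trans_le (min_le_left _ _))
      (two_rpow_mul_lt (hr.2.trans_le (min_le_right _ _)))).exists).1.2
  filter_upwards [Ioo_mem_nhdsLT h0] with ρ hρ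
  have h := highEnergy_of_rhoZero_lt hn hθ hx hr hρ
  exact ⟨h.1, h.2.2⟩

theorem tendsto_smallness (S : Setting n) (hθ : ‖θ‖ = 1) (N : ℝ) :
    Tendsto (fun ρ : ℝ => smallness S.c S.α N (ρ • θ) x) (𝓝[<] S.c) (𝓝 0) := by
  have hc := S.c_pos
  have hα := S.α_pos
  have h0 : smallness S.c S.α N (S.c • θ) x = 0 := by
    rw [smallness, norm_smul, hθ, mul_one, Real.norm_of_nonneg hc.le, div_self (by positivity)]
    simp
  rw [← h0]
  have hne : S.α * ‖S.c • θ‖ ^ 2 ≠ 0 := by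
    rw [norm_smul, hθ, mul_one, Real.norm_of_nonneg hc.le]
    positivity
  have : ContinuousAt (fun ρ : ℝ => smallness S.c S.α N (ρ • θ) x) S.c := by
    unfold smallness
    fun_prop (disch := assumption)
  exact this.tendsto.mono_left nhdsWithin_le_nhds

/-- Functions which are affine along the ray through `θ`, such as the line integrals of the forces in
the velocity, are continuous along it. -/
theorem tendsto_of_affine {f : Sp n → Sp n} {c : ℝ} (hc : 0 < c)
    (hf : ∀ k : ℝ, f (k • c • θ) = (1 - k) • f 0 + k • f (c • θ)) :
    Tendsto (fun ρ : ℝ => f (ρ • θ)) (𝓝[<] c) (𝓝 (f (c • θ))) := by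
  have h1 : (fun ρ : ℝ => f (ρ • θ)) = fun ρ => (1 - ρ / c) • f 0 + (ρ / c) • f (c • θ) := by
    funext ρ
    rw [← hf, smul_smul, div_mul_cancel₀ _ hc.ne']
  have h2 : ContinuousAt (fun ρ : ℝ => f (ρ • θ)) c := by
    rw [h1]
    fun_prop
  exact h2.tendsto.mono_left nhdsWithin_le_nhds

theorem tendsto_asc (hn : 2 ≤ n) (hθ : ‖θ‖ = 1) (hx : inner ℝ θ x = 0) :
    Tendsto (fun ρ : ℝ => (ρ / √(1 - ρ ^ 2 / S.c ^ 2)) • S.asc (ρ • θ) x) (𝓝[<] S.c)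
      (𝓝 (S.lineF θ x (S.c • θ))) := by
  have hc := S.c_pos
  have hw : ‖S.c • θ‖ ≤ 2 * S.c := by
    rw [norm_smul, hθ, mul_one, Real.norm_of_nonneg hc.le]; linarith
  have h1 := tendsto_of_affine hc fun k => lineF_smul_velocity (S := S) hn hθ hx hw k
  have h2 : Tendsto (fun ρ : ℝ => (ρ / √(1 - ρ ^ 2 / S.c ^ 2)) • S.asc (ρ • θ) x
      - S.lineF θ x (ρ • θ)) (𝓝[<] S.c) (𝓝 0) := by
    refine squeeze_zero_norm' ((S.eventually_highEnergy hn hθ hx).mono fun ρ h =>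
      h.2.norm_asc_sub_le hn h.1 hθ) ?_
    simpa using ((S.tendsto_smallness hθ (n ^ 2 * S.β)).const_mul
      (1536 * (n ^ 2 * S.β))).div_const S.α
  simpa using h2.add h1

theorem tendsto_bsc (hn : 2 ≤ n) (hθ : ‖θ‖ = 1) (hx : inner ℝ θ x = 0) :
    Tendsto (fun ρ : ℝ =>
        (ρ ^ 2 / √(1 - ρ ^ 2 / S.c ^ 2)) • (S.bsc (ρ • θ) x - S.W (ρ • θ) x)) (𝓝[<] S.c)
      (𝓝 (S.iterFs θ x (S.c • θ) + xray S.s.V θ x • θ)) := by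
  have hc := S.c_pos
  have hw : ‖S.c • θ‖ ≤ 2 * S.c := by
    rw [norm_smul, hθ, mul_one, Real.norm_of_nonneg hc.le]; linarith
  have h1 := tendsto_of_affine hc fun k => iterFs_smul_velocity (S := S) hn hθ hx hw k
  have h2 : Tendsto (fun ρ : ℝ =>
      (ρ ^ 2 / √(1 - ρ ^ 2 / S.c ^ 2)) • (S.bsc (ρ • θ) x - S.W (ρ • θ) x)
        - S.iterFs θ x (ρ • θ) - (∫ σ : ℝ, S.s.V (σ • θ + x)) • ((ρ ^ 2 / S.c ^ 2) • θ))
      (𝓝[<] S.c) (𝓝 0) := by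
    refine squeeze_zero_norm' ((S.eventually_highEnergy hn hθ hx).mono fun ρ h =>
      h.2.norm_bsc_sub_le hn h.1 hθ) ?_
    simpa using ((S.tendsto_smallness hθ (n ^ 2 * S.β)).const_mul
      (11328 * (n ^ 2 * S.β))).div_const (S.α * (S.α + 1))
  have h3 : Tendsto (fun ρ : ℝ => (∫ σ : ℝ, S.s.V (σ • θ + x)) • ((ρ ^ 2 / S.c ^ 2) • θ))
      (𝓝[<] S.c) (𝓝 (xray S.s.V θ x • θ)) := by
    have h4 : ContinuousAt (fun ρ : ℝ => (∫ σ : ℝ, S.s.V (σ • θ + x)) • ((ρ ^ 2 / S.c ^ 2) • θ))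
        S.c := by fun_prop
    have h5 := h4.tendsto.mono_left (nhdsWithin_le_nhds (s := Iio S.c))
    simp only [div_self (pow_pos hc 2).ne', one_smul] at h5
    exact h5
  have h6 := (h2.add h3).add h1
  simp only [sub_add_cancel, zero_add] at h6
  rwa [add_comm] at h6

end Setting

end RelScattering

theorem mainTheorem1 (n : ℕ) (hn : 2 ≤ n) (S : Setting n) (θ x : Sp n)
    (hθ : ‖θ‖ = 1) (hx : inner ℝ θ x = 0) :
    -- well-definedness of all the quantities in the limits, for `ρ < c` close to `c`
    ((∀ᶠ ρ in 𝓝[<] S.c, (ρ • θ, x) ∈ S.domain ∧ S.WConverges (ρ • θ) x) ∧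
      S.LineIntegralsConverge θ x (S.c • θ)) ∧
    -- the high energy limit of `a_sc`
    Tendsto (fun ρ : ℝ => (ρ / √(1 - ρ ^ 2 / S.c ^ 2)) • S.asc (ρ • θ) x) (𝓝[<] S.c)
      (𝓝 (S.lineF θ x (S.c • θ))) ∧
    -- the high energy limit of `b_sc - W`
    Tendsto (fun ρ : ℝ =>
        (ρ ^ 2 / √(1 - ρ ^ 2 / S.c ^ 2)) • (S.bsc (ρ • θ) x - S.W (ρ • θ) x)) (𝓝[<] S.c)
      (𝓝 (S.iterFs θ x (S.c • θ) + xray S.s.V θ x • θ)) ∧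
    -- the error bounds for `ρ₀(|x|, r, β, α) < ρ < c`
    ∀ r ∈ Ioo (0 : ℝ) (min 1 ((2 : ℝ) ^ (-(3 / 2) : ℝ) * S.c)),
      ∀ ρ ∈ Ioo (rhoZero n S.c ‖x‖ r S.β S.α) S.c,
        (ρ • θ, x) ∈ S.domain ∧ S.WConverges (ρ • θ) x ∧
        S.LineIntegralsConverge θ x (ρ • θ) ∧
        ‖(ρ / √(1 - ρ ^ 2 / S.c ^ 2)) • S.asc (ρ • θ) x - S.lineF θ x (ρ • θ)‖ ≤
          S.β ^ 2 * √(1 - ρ ^ 2 / S.c ^ 2) *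
            (640 * (n : ℝ) ^ 4 * ρ * (r / S.c + ‖x‖ + 1) * (1 / S.c + 1)
                * (1 + 1 / (ρ / (2 * √2) - r)) ^ 2
              / (S.α ^ 2 * (ρ / (2 * √2) - r) ^ 2 * (1 - r) ^ (2 * S.α + 3))) ∧
        ‖(ρ ^ 2 / √(1 - ρ ^ 2 / S.c ^ 2)) • (S.bsc (ρ • θ) x - S.W (ρ • θ) x)
            - S.iterFs θ x (ρ • θ)
            - (∫ σ : ℝ, S.s.V (σ • θ + x)) • ((ρ ^ 2 / S.c ^ 2) • θ)‖ ≤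
          S.β ^ 2 * √(1 - ρ ^ 2 / S.c ^ 2) *
            (464 * (n : ℝ) ^ 4 * ρ ^ 2 * (r / S.c + ‖x‖ + 1) * (1 / S.c + 1)
                * (1 + 1 / (ρ / (2 * √2) - r)) ^ 2
              / (S.α ^ 2 * (S.α + 1) * (ρ / (2 * √2) - r) ^ 3 * (1 - r) ^ (2 * S.α + 2))) := by
  have hc := S.c_pos
  have hα := S.α_pos
  have hlin : ∀ ρ : ℝ, 0 < ρ → ρ ≤ S.c → S.LineIntegralsConverge θ x (ρ • θ) := fun ρ h0 h =>
    Setting.lineIntegralsConverge hn hθ hx (by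
      rw [norm_smul, hθ, mul_one, Real.norm_of_nonneg h0.le]; linarith)
  refine ⟨⟨(S.eventually_highEnergy hn hθ hx).mono fun ρ h =>
    ⟨h.2.mem_domain hn, h.2.wConverges hn⟩, hlin _ hc le_rfl⟩, Setting.tendsto_asc hn hθ hx,
    Setting.tendsto_bsc hn hθ hx, fun r hr ρ hρ => ?_⟩
  obtain ⟨hρ0, hu, R⟩ := Setting.highEnergy_of_rhoZero_lt hn hθ hx hr hρ
  have hr1 : r < 1 := hr.2.trans_le (min_le_left _ _)
  have hr0 := hr.1
  have hv : ‖ρ • θ‖ = ρ := by rw [norm_smul, hθ, mul_one, Real.norm_of_nonneg hρ0.le]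
  have hsm : smallness S.c S.α (n ^ 2 * S.β) (ρ • θ) x
      = √(1 - ρ ^ 2 / S.c ^ 2) * (n ^ 2 * S.β) * (1 + ‖x‖) / (S.α * ρ ^ 2) := by
    rw [smallness, hv]
  have huρ : ρ / (2 * √2) - r ≤ ρ / 2 := by
    have : ρ / (2 * √2) ≤ ρ / 2 := by
      gcongr
      have : (1 : ℝ) ≤ √2 := Real.one_le_sqrt.2 one_le_two
      linarith
    linarith
  have hpow : ∀ e : ℝ, 0 ≤ e → 0 < (1 - r) ^ e ∧ (1 - r) ^ e ≤ 1 := fun e he =>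
    ⟨Real.rpow_pos_of_pos (by linarith) _, Real.rpow_le_one (by linarith) (by linarith) he⟩
  have hA : 1 + ‖x‖ ≤ r / S.c + ‖x‖ + 1 := by
    have : 0 ≤ r / S.c := by positivity
    linarith
  have hB : 1 ≤ 1 / S.c + 1 := by
    have : 0 ≤ 1 / S.c := by positivity
    linarith
  refine ⟨R.mem_domain hn, R.wConverges hn, hlin ρ hρ0 hρ.2.le, ?_, ?_⟩
  · refine (R.norm_asc_sub_le hn hρ0 hθ).trans ?_
    rw [hsm]
    exact velocity_error_le hρ0 hu huρ (hpow _ (by linarith)).1 (hpow _ (by linarith)).2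
      (Real.sqrt_nonneg _) hα (norm_nonneg x) hA hB
  · refine (R.norm_bsc_sub_le hn hρ0 hθ).trans ?_
    rw [hsm]
    exact position_error_le hρ0 hu huρ (hpow _ (by linarith)).1 (hpow _ (by linarith)).2
      (Real.sqrt_nonneg _) hα (norm_nonneg x) hA hB
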